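/- **Conventions.** All $L_\infty$-algebras $\mathfrak g$ are finite-dimensional and $\mathbb N_+$-graded and are given by their Chevalley–Eilenberg algebra $\mathrm{CE}(\mathfrak g)=(\wedge^\bullet\mathfrak g^*,d)$, a differential graded-commutative algebra (dgca) over $\mathbb R$ that is free on generators of positive degree. The Weil algebra $W(\mathfrak g)$ is free on $\mathfrak g^*\oplus\mathfrak g^*[1]$ with $d a=d_{\mathrm{CE}}a+\sigma a$ and $d\sigma a=-\sigma(d_{\mathrm{CE}}a)$ for $a\in\mathfrak g^*$, where the shift $\sigma:\mathfrak g^*\to\mathfrak g^*[1]$ is extended as a derivation of degree $1$ vanishing on $\mathfrak g^*[1]$. The invariant polynomials $\mathrm{inv}(\mathfrak g)\subset W(\mathfrak g)$ are the elements $P$ with $\iota_XP=0$ and $\iota_XdP=0$ for all $X\in\mathfrak g$, where $\iota_X$ is the contraction with $X$ (which vanishes on $\mathfrak g^*[1]$). $b^{k-1}\mathfrak u(1)$ has $\mathrm{CE}$-algebra free on one generator $h$ of degree $k$, with $dh=0$. If $\mathfrak h\hookrightarrow\mathfrak g$ is a normal sub-$L_\infty$-algebra with dual $t^*:\mathrm{CE}(\mathfrak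 g)\to\mathrm{CE}(\mathfrak h)$, the mapping cone $\mathrm{CE}(\mathfrak h\hookrightarrow\mathfrak g)$ is free on $\mathfrak g^*\oplus\mathfrak h^*[1]$ with $d a=d_{\mathfrak g}a+\sigma t^*a$ and $d\,\sigma t^*a=-\sigma t^*(d_{\mathfrak g}a)$ for $a\in\mathfrak g^*$. Let $\pi:Y\to X$ be a smooth surjective submersion of finite-dimensional manifolds and $\Omega^\bullet_{\mathrm{vert}}(Y)$ the quotient of $\Omega^\bullet(Y)$ by the forms vanishing on vertical vectors. A *$\mathfrak g$-descent object* is a dgca morphism $A_{\mathrm{vert}}:\mathrm{CE}(\mathfrak g)\to\Omega^\bullet_{\mathrm{vert}}(Y)$. A *$\mathfrak g$-connection descent object* is a triple $(A_{\mathrm{vert}},A,K)$ of dgca morphisms, with $A_{\mathrm{vert}}$ as before, $A:W(\mathfrak g)\to\Omega^\bullet(Y)$ and $K:\mathrm{inv}(\mathfrak g)\to\Omega^\bullet(X)$, compatible with the canonical maps $\mathrm{inv}(\mathfrak g)\hookrightarrow W(\mathfrak g)\twoheadrightarrow\mathrm{CE}(\mathfrak g)$ and $\Omega^\bullet(X)\xrightarrow{\pi^*}\Omega^\bullet(Y)\twoheadrightarrow\Omega^\bullet_{\mathrm{vert}}(Y)$.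 The characteristic class of a closed $P\in\mathrm{inv}(\mathfrak g)$ is $[K(P)]\in H_{dR}(X)$; we write $P(F_A)=A(P)$. Two dgca morphisms $A\to B$ are *concordant* if they are the two endpoint restrictions of a dgca morphism $A\to B\otimes\Omega^\bullet([0,1])$. A morphism out of $\mathrm{CE}(\mathfrak g)$ is *trivial* if it is concordant to one that vanishes on all generators. **Theorem.** Let $n\ge 1$, let $\mu\in\mathrm{CE}(\mathfrak g)$ be a cocycle of degree $n+1$ that transgresses to the invariant polynomial $P\in\mathrm{inv}(\mathfrak g)$ through $\mathrm{cs}\in W(\mathfrak g)$, that is, $\mathrm{cs}$ has degree $n+1$, $d\,\mathrm{cs}=P$ and $\mathrm{cs}|_{\mathrm{CE}(\mathfrak g)}=\mu$. Let $\mathfrak g_\mu$ be the String-like extension: $\mathrm{CE}(\mathfrak g_\mu)$ is $\mathrm{CE}(\mathfrak g)$ with a further generator $b$ of degree $n$ and $db=-\mu$. Let $\mathrm{CE}(\mathrm{cs}_P(\mathfrak g))$ be $W(\mathfrak g)$ with further generators $c,b$ of degrees $n+1,n$ and $dc=P$, $db=c-\mathrm{cs}$. Put $C=\mathrm{CE}(b^{n-1}\mathfrak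 u(1)\hookrightarrow\mathfrak g_\mu)$ and $\hat C=\mathrm{CE}(\mathrm{inn}(b^{n-1}\mathfrak u(1))\hookrightarrow\mathrm{cs}_P(\mathfrak g))$, where $\mathrm{CE}(\mathrm{inn}(\mathfrak h))=W(\mathfrak h)$ and the two subalgebras are dual to the generator $b$ and to the generators $b,c$. 1. There are dgca morphisms $f:\mathrm{CE}(\mathfrak g)\to C$ and $f^{-1}:C\to\mathrm{CE}(\mathfrak g)$ which are the identity on $\mathfrak g^*$, with $f^{-1}(b)=0$, $f^{-1}(\sigma b)=\mu$, and $j:\mathrm{CE}(b^n\mathfrak u(1))\to C$, $h\mapsto\sigma b$. There are dgca morphisms $\hat f:W(\mathfrak g)\to\hat C$ and $\hat f^{-1}:\hat C\to W(\mathfrak g)$ which are the identity on $\mathfrak g^*\oplus\mathfrak g^*[1]$, with $\hat f^{-1}(b)=\hat f^{-1}(c)=0$, $\hat f^{-1}(\sigma b)=\mathrm{cs}$, $\hat f^{-1}(\sigma c)=-P$, and $\hat\jmath:W(b^n\mathfrak u(1))\to\hat C$, $h\mapsto\sigma b$, $\sigma h\mapsto-\sigma c$. Moreover $f^{-1}f=\mathrm{id}$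 and $\hat f^{-1}\hat f=\mathrm{id}$, while $f f^{-1}$ and $\hat f\hat f^{-1}$ are concordant and cochain homotopic to the identity, so that $f^{-1}$ and $\hat f^{-1}$ are weak inverses of $f$ and $\hat f$. 2. (Obstruction, descent objects.) For every $\mathfrak g$-descent object $A_{\mathrm{vert}}$ on $X$, the $b^n\mathfrak u(1)$-descent object $A_{\mathrm{vert}}\circ f^{-1}\circ j$, given by $h\mapsto A_{\mathrm{vert}}(\mu)$, is the obstruction to a lift: $A_{\mathrm{vert}}$ extends along $\mathrm{CE}(\mathfrak g)\hookrightarrow\mathrm{CE}(\mathfrak g_\mu)$ to a $\mathfrak g_\mu$-descent object if and only if $A_{\mathrm{vert}}\circ f^{-1}\circ j$ is trivial. 3. (Obstruction, connection descent objects.) For every $\mathfrak g$-connection descent object $(A_{\mathrm{vert}},A,K)$ on $X$, $$A'_{\mathrm{vert}}=A_{\mathrm{vert}}\circ f^{-1}\circ j,\qquad A'=A\circ\hat f^{-1}\circ\hat\jmath,\qquad K'=K\circ(\hat f^{-1}\circ\hat\jmath)|_{\mathrm{inv}(b^n\mathfrak u(1))}$$ is a $b^n\mathfrak u(1)$-connection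 descent object (in particular $\hat f^{-1}\hat\jmath$ maps $\mathrm{inv}(b^n\mathfrak u(1))$ into $\mathrm{inv}(\mathfrak g)$). Its connection form is the Chern–Simons form, $A'(h)=\mathrm{CS}_P(A):=A(\mathrm{cs})$, and its curvature is $A'(\sigma h)=P(F_A)$, which descends to $K'(\sigma h)=K(P)$ on $X$. The algebra $\mathrm{inv}(b^n\mathfrak u(1))$ is generated by $\sigma h$, and the single characteristic class $[K'(\sigma h)]\in H_{dR}(X)$ is the characteristic class $[K(P)]$ of $P$ for the original object. The pair $(A_{\mathrm{vert}},A)$ extends to a pair of dgca morphisms $\mathrm{CE}(\mathfrak g_\mu)\to\Omega^\bullet_{\mathrm{vert}}(Y)$, $W(\mathfrak g_\mu)\to\Omega^\bullet(Y)$ that is compatible with the projections $W(\mathfrak g_\mu)\to\mathrm{CE}(\mathfrak g_\mu)$ and $\Omega^\bullet(Y)\to\Omega^\bullet_{\mathrm{vert}}(Y)$ if and only if $A'_{\mathrm{vert}}$ is trivial. In particular, if $(A_{\mathrm{vert}},A,K)$ lifts to a $\mathfrak g_\mu$-connection descent object, then $A'_{\mathrm{vert}}$ is trivial. -/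

import Mathlib

open scoped ContDiff Manifold TensorProduct

noncomputable section

namespace LiftObstruction

/-! ### Differential graded-commutative algebras -/

universe u v w

/-- A differential graded-commutative algebra over `ℝ`, with its submodules `gr p` of elements of
degree `p`. -/
structure DGCA where
  carrier : Type u
  [ring : Ring carrier]
  [alg : Algebra ℝ carrier]
  gr : ℕ → Submodule ℝ carrier
  d : carrier →ₗ[ℝ] carrier
  one_mem : (1 : carrier) ∈ gr 0
  mul_mem : ∀ {p q : ℕ} {x y : carrier}, x ∈ gr p → y ∈ gr q → x * y ∈ gr (p + q)
  comm : ∀ {p q : ℕ} {x y : carrier}, x ∈ gr p → y ∈ gr q →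
    x * y = (-1 : ℝ) ^ (p * q) • (y * x)
  d_mem : ∀ {p : ℕ} {x : carrier}, x ∈ gr p → d x ∈ gr (p + 1)
  leibniz : ∀ {p : ℕ} {x : carrier}, x ∈ gr p → ∀ y : carrier,
    d (x * y) = d x * y + (-1 : ℝ) ^ p • (x * d y)
  d_d : ∀ x : carrier, d (d x) = 0

attribute [instance] DGCA.ring DGCA.alg

/-- Morphisms of differential graded-commutative algebras. -/
structure DGHom (A : DGCA.{u}) (B : DGCA.{v}) extends A.carrier →ₐ[ℝ] B.carrier where
  map_gr : ∀ (p : ℕ) (x : A.carrier), x ∈ A.gr p → toFun x ∈ B.gr p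
  map_d : ∀ x : A.carrier, toFun (A.d x) = B.d (toFun x)

namespace DGHom

instance (A : DGCA.{u}) (B : DGCA.{v}) : CoeFun (DGHom A B) (fun _ => A.carrier → B.carrier) :=
  ⟨fun f => f.toAlgHom⟩

/-- Composition `g ∘ f`. -/
def comp {A : DGCA.{u}} {B : DGCA.{v}} {C : DGCA.{w}} (g : DGHom B C) (f : DGHom A B) :
    DGHom A C where
  toAlgHom := g.toAlgHom.comp f.toAlgHom
  map_gr p x hx := g.map_gr p _ (f.map_gr p x hx)
  map_d x := (congrArg g (f.map_d x)).trans (g.map_d _)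

/-- The identity morphism. -/
def id (A : DGCA.{u}) : DGHom A A where
  toAlgHom := AlgHom.id ℝ A.carrier
  map_gr _ _ hx := hx
  map_d _ := rfl

end DGHom

namespace DGCA

/-- The closed elements. -/
def cocycles (A : DGCA.{u}) : Submodule ℝ A.carrier := LinearMap.ker A.d

/-- The exact elements among the closed ones. -/
def coboundaries (A : DGCA.{u}) : Submodule ℝ A.cocycles :=
  (LinearMap.range A.d).comap A.cocycles.subtype

/-- The (total) cohomology `H(A) = ker d / im d`. -/
abbrev Cohomology (A : DGCA.{u}) : Type u := A.cocycles ⧸ A.coboundaries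

/-- The cohomology class of a closed element. -/
def cls (A : DGCA.{u}) (x : A.carrier) (hx : A.d x = 0) : A.Cohomology :=
  Submodule.Quotient.mk ⟨x, hx⟩

end DGCA

/-- The map induced on cohomology. -/
def DGHom.mapCohomology {A : DGCA.{u}} {B : DGCA.{v}} (f : DGHom A B) :
    A.Cohomology →ₗ[ℝ] B.Cohomology :=
  Submodule.mapQ _ _
    (f.toAlgHom.toLinearMap.restrict (p := A.cocycles) (q := B.cocycles) (by
      intro x hx
      have hx' : A.d x = 0 := hx
      change B.d (f x) = 0
      have h := f.map_d x
      rw [hx'] at h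
      exact h.symm.trans (map_zero f.toAlgHom)))
    (by
      rintro ⟨x, hx⟩ ⟨y, hy⟩
      exact ⟨f y, (f.map_d y).symm.trans (congrArg f hy)⟩)

/-! ### Free graded-commutative algebras -/

/-- The relations of graded commutativity between generators. -/
inductive FGC.Rel {ι : Type} (deg : ι → ℕ) : FreeAlgebra ℝ ι → FreeAlgebra ℝ ι → Prop
  | comm (i j : ι) : FGC.Rel deg (FreeAlgebra.ι ℝ i * FreeAlgebra.ι ℝ j)
      ((-1 : ℝ) ^ (deg i * deg j) • (FreeAlgebra.ι ℝ j * FreeAlgebra.ι ℝ i))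

/-- The free graded-commutative algebra `∧•(V)` on the graded vector space `V` with homogeneous
basis `ι`, the basis vector `i` being of degree `deg i`. -/
def FGC {ι : Type} (deg : ι → ℕ) : Type := RingQuot (FGC.Rel deg)

namespace FGC

variable {ι : Type} {deg : ι → ℕ}

instance : Ring (FGC deg) := inferInstanceAs (Ring (RingQuot (FGC.Rel deg)))

instance : Algebra ℝ (FGC deg) := inferInstanceAs (Algebra ℝ (RingQuot (FGC.Rel deg)))

/-- The generators. -/
def gen (deg : ι → ℕ) (i : ι) : FGC deg := RingQuot.mkAlgHom ℝ (FGC.Rel deg) (FreeAlgebra.ι ℝ i)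

theorem gen_comm (i j : ι) :
    gen deg i * gen deg j = (-1 : ℝ) ^ (deg i * deg j) • (gen deg j * gen deg i) := by
  have h := RingQuot.mkAlgHom_rel ℝ (FGC.Rel.comm (deg := deg) i j)
  rw [map_mul, map_smul, map_mul] at h
  exact h

/-- The universal property: algebra maps are given on generators. -/
def lift {B : Type*} [Ring B] [Algebra ℝ B] (φ : ι → B)
    (h : ∀ i j, φ i * φ j = (-1 : ℝ) ^ (deg i * deg j) • (φ j * φ i)) : FGC deg →ₐ[ℝ] B :=
  RingQuot.liftAlgHom ℝ ⟨FreeAlgebra.lift ℝ φ, by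
    rintro _ _ ⟨i, j⟩
    simpa using h i j⟩

@[simp]
theorem lift_gen {B : Type*} [Ring B] [Algebra ℝ B] (φ : ι → B)
    (h : ∀ i j, φ i * φ j = (-1 : ℝ) ^ (deg i * deg j) • (φ j * φ i)) (i : ι) :
    lift φ h (gen deg i) = φ i := by
  simp only [lift, gen]
  erw [RingQuot.liftAlgHom_mkAlgHom_apply]
  simp

theorem algHom_ext {B : Type*} [Ring B] [Algebra ℝ B] {f g : FGC deg →ₐ[ℝ] B}
    (h : ∀ i, f (gen deg i) = g (gen deg i)) : f = g := by
  apply RingQuot.ringQuot_ext' ℝ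
  apply FreeAlgebra.hom_ext
  funext i
  exact h i

/-- The product of a list of generators. -/
def mon (deg : ι → ℕ) (l : List ι) : FGC deg := (l.map (gen deg)).prod

@[simp] theorem mon_nil : mon deg [] = 1 := rfl

@[simp] theorem mon_cons (i : ι) (l : List ι) : mon deg (i :: l) = gen deg i * mon deg l := by
  simp [mon]

theorem mon_append (l m : List ι) : mon deg (l ++ m) = mon deg l * mon deg m := by
  simp [mon]

theorem span_mon : Submodule.span ℝ (Set.range (mon deg)) = ⊤ := by
  rw [eq_top_iff]
  let S : Subalgebra ℝ (FGC deg) :=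
    (Submodule.span ℝ (Set.range (mon deg))).toSubalgebra
      (Submodule.subset_span ⟨[], rfl⟩) (by
        intro x y hx hy
        induction hx using Submodule.span_induction with
        | mem x hx =>
          obtain ⟨l, rfl⟩ := hx
          induction hy using Submodule.span_induction with
          | mem y hy =>
            obtain ⟨m, rfl⟩ := hy
            exact Submodule.subset_span ⟨l ++ m, mon_append l m⟩
          | zero => simp
          | add y z _ _ h1 h2 => rw [mul_add]; exact Submodule.add_mem _ h1 h2
          | smul a y _ h => rw [mul_smul_comm]; exact Submodule.smul_mem _ _ h
        | zero => simp
        | add y z _ _ h1 h2 => rw [add_mul]; exact Submodule.add_mem _ h1 h2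
        | smul a y _ h => rw [smul_mul_assoc]; exact Submodule.smul_mem _ _ h)
  let f : FGC deg →ₐ[ℝ] S := lift (fun i => ⟨gen deg i, Submodule.subset_span ⟨[i], by simp⟩⟩)
    (by intro i j; ext; exact gen_comm i j)
  have hf : S.val.comp f = AlgHom.id ℝ _ := algHom_ext (fun i => by simp [f])
  intro x _
  have := (f x).2
  rw [show ((f x : S) : FGC deg) = x from DFunLike.congr_fun hf x] at this
  exact this

theorem induction_mon {p : FGC deg → Prop} (hm : ∀ l, p (mon deg l))
    (ha : ∀ x y, p x → p y → p (x + y)) (hs : ∀ (a : ℝ) x, p x → p (a • x)) (x : FGC deg) :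
    p x := by
  have hx : x ∈ Submodule.span ℝ (Set.range (mon deg)) := by rw [span_mon]; trivial
  induction hx using Submodule.span_induction with
  | mem x hx => obtain ⟨l, rfl⟩ := hx; exact hm l
  | zero => simpa using hs 0 _ (hm [])
  | add x y _ _ h1 h2 => exact ha x y h1 h2
  | smul a x _ h => exact hs a x h

/-- The elements of degree `p`. -/
def gr (deg : ι → ℕ) (p : ℕ) : Submodule ℝ (FGC deg) :=
  Submodule.span ℝ {x | ∃ l : List ι, (l.map deg).sum = p ∧ x = mon deg l}

theorem mon_mem (l : List ι) : mon deg l ∈ gr deg (l.map deg).sum :=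
  Submodule.subset_span ⟨l, rfl, rfl⟩

theorem gen_mem (i : ι) : gen deg i ∈ gr deg (deg i) := by
  simpa using mon_mem (deg := deg) [i]

theorem one_mem : (1 : FGC deg) ∈ gr deg 0 := by simpa using mon_mem (deg := deg) []

theorem mul_mem {p q : ℕ} {x y : FGC deg} (hx : x ∈ gr deg p) (hy : y ∈ gr deg q) :
    x * y ∈ gr deg (p + q) := by
  induction hx using Submodule.span_induction with
  | mem x hx =>
    obtain ⟨l, rfl, rfl⟩ := hx
    induction hy using Submodule.span_induction with
    | mem y hy =>
      obtain ⟨m, rfl, rfl⟩ := hy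
      rw [← mon_append, ← List.sum_append, ← List.map_append]
      exact mon_mem _
    | zero => simp
    | add y z _ _ h1 h2 => rw [mul_add]; exact Submodule.add_mem _ h1 h2
    | smul a y _ h => rw [mul_smul_comm]; exact Submodule.smul_mem _ _ h
  | zero => simp
  | add y z _ _ h1 h2 => rw [add_mul]; exact Submodule.add_mem _ h1 h2
  | smul a y _ h => rw [smul_mul_assoc]; exact Submodule.smul_mem _ _ h

theorem gen_mul_mon (i : ι) (l : List ι) :
    gen deg i * mon deg l = (-1 : ℝ) ^ (deg i * (l.map deg).sum) • (mon deg l * gen deg i) := by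
  induction l with
  | nil => simp
  | cons j l ih =>
    rw [mon_cons, ← mul_assoc, gen_comm, smul_mul_assoc, mul_assoc, ih, mul_smul_comm, smul_smul,
      ← pow_add, mul_assoc]
    simp [mul_add]

theorem mon_mul_mon (l m : List ι) :
    mon deg l * mon deg m =
      (-1 : ℝ) ^ ((l.map deg).sum * (m.map deg).sum) • (mon deg m * mon deg l) := by
  induction l with
  | nil => simp
  | cons j l ih =>
    rw [mon_cons, mul_assoc, ih, mul_smul_comm, ← mul_assoc, gen_mul_mon, smul_mul_assoc,
      smul_smul, ← pow_add, mul_assoc, List.map_cons, List.sum_cons]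
    congr 2
    ring

theorem comm {p q : ℕ} {x y : FGC deg} (hx : x ∈ gr deg p) (hy : y ∈ gr deg q) :
    x * y = (-1 : ℝ) ^ (p * q) • (y * x) := by
  induction hx using Submodule.span_induction with
  | mem x hx =>
    obtain ⟨l, rfl, rfl⟩ := hx
    induction hy using Submodule.span_induction with
    | mem y hy =>
      obtain ⟨m, rfl, rfl⟩ := hy
      exact mon_mul_mon l m
    | zero => simp
    | add y z _ _ h1 h2 => rw [mul_add, add_mul, smul_add, h1, h2]
    | smul a y _ h => rw [mul_smul_comm, smul_mul_assoc, h, smul_comm]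
  | zero => simp
  | add y z _ _ h1 h2 => rw [mul_add, add_mul, smul_add, h1, h2]
  | smul a y _ h => rw [mul_smul_comm, smul_mul_assoc, h, smul_comm]

/-- The algebra map induced by a degree-preserving map of generators. -/
def map {κ : Type} {deg' : κ → ℕ} (e : ι → κ) (he : ∀ i, deg' (e i) = deg i) :
    FGC deg →ₐ[ℝ] FGC deg' :=
  lift (fun i => gen deg' (e i)) (by intro i j; rw [← he i, ← he j]; exact gen_comm _ _)

@[simp]
theorem map_gen {κ : Type} {deg' : κ → ℕ} (e : ι → κ) (he : ∀ i, deg' (e i) = deg i) (i : ι) :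
    map e he (gen deg i) = gen deg' (e i) := lift_gen _ _ _

theorem map_mem {κ : Type} {deg' : κ → ℕ} (e : ι → κ) (he : ∀ i, deg' (e i) = deg i) {p : ℕ}
    {x : FGC deg} (hx : x ∈ gr deg p) : map e he x ∈ gr deg' p := by
  induction hx using Submodule.span_induction with
  | mem x hx =>
    obtain ⟨l, rfl, rfl⟩ := hx
    have h1 : map e he (mon deg l) = mon deg' (l.map e) := by
      induction l with
      | nil => simp
      | cons i l ih => simp [ih]
    have h2 : (l.map deg).sum = ((l.map e).map deg').sum := by simp [Function.comp_def, he]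
    rw [h1, h2]
    exact mon_mem _
  | zero => simp
  | add y z _ _ h1 h2 => rw [map_add]; exact Submodule.add_mem _ h1 h2
  | smul a y _ h => rw [map_smul]; exact Submodule.smul_mem _ _ h

/-- The parity automorphism, `x ↦ (-1)^p x` in degree `p`. -/
def parity (deg : ι → ℕ) : FGC deg →ₐ[ℝ] FGC deg :=
  lift (fun i => (-1 : ℝ) ^ deg i • gen deg i) (by
    intro i j
    simp only [smul_mul_smul_comm]
    rw [gen_comm, smul_comm, mul_comm ((-1 : ℝ) ^ deg i) ((-1 : ℝ) ^ deg j)])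

@[simp] theorem parity_gen (i : ι) : parity deg (gen deg i) = (-1 : ℝ) ^ deg i • gen deg i :=
  lift_gen _ _ _

theorem parity_mem {p : ℕ} {x : FGC deg} (hx : x ∈ gr deg p) :
    parity deg x = (-1 : ℝ) ^ p • x := by
  induction hx using Submodule.span_induction with
  | mem x hx =>
    obtain ⟨l, rfl, rfl⟩ := hx
    induction l with
    | nil => simp
    | cons i l ih => simp [ih, smul_smul, pow_add, mul_comm]
  | zero => simp
  | add y z _ _ h1 h2 => rw [map_add, smul_add, h1, h2]
  | smul a y _ h => rw [map_smul, h, smul_comm]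

theorem parity_pow_gen (k : ℕ) (i : ι) :
    ((parity deg) ^ k) (gen deg i) = (-1 : ℝ) ^ (k * deg i) • gen deg i := by
  induction k with
  | zero => simp
  | succ k ih =>
    rw [pow_succ', AlgHom.mul_apply, ih, map_smul, parity_gen, smul_smul, ← pow_add]
    congr 2
    ring

/-- The condition on the values `v i` on the generators of a derivation of parity `k`. -/
def IsDerivData (deg : ι → ℕ) (k : ℕ) (v : ι → FGC deg) : Prop :=
  ∀ i j, gen deg i * v j = (-1 : ℝ) ^ (deg i * (deg j + k)) • (v j * gen deg i)

theorem isDerivData_of_mem {v : ι → FGC deg} (hv : ∀ i, v i ∈ gr deg (deg i + 1)) :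
    IsDerivData deg 1 v := fun i j => comm (gen_mem i) (hv j)

/-- Auxiliary: `x ↦ (ε^k x, τ x; 0, x)`, multiplicative precisely when `τ` is a derivation. -/
def derivAux (k : ℕ) (v : ι → FGC deg) (hv : IsDerivData deg k v) :
    FGC deg →ₐ[ℝ] Matrix (Fin 2) (Fin 2) (FGC deg) :=
  lift (fun i => !![((parity deg) ^ k) (gen deg i), v i; 0, gen deg i]) (by
    intro i j
    have h2 : (-1 : ℝ) ^ (k * deg i) • (gen deg i * v j) =
        (-1 : ℝ) ^ (deg i * deg j) • (v j * gen deg i) := by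
      rw [hv i j, smul_smul, ← pow_add,
        show k * deg i + deg i * (deg j + k) = deg i * deg j + 2 * (k * deg i) by ring,
        pow_add, pow_mul (-1 : ℝ) 2]
      simp
    have h3 : v i * gen deg j =
        (-1 : ℝ) ^ (deg i * deg j) • ((-1 : ℝ) ^ (k * deg j) • (gen deg j * v i)) := by
      rw [hv j i, smul_smul, smul_smul, ← pow_add, ← pow_add,
        show deg i * deg j + k * deg j + deg j * (deg i + k) =
          2 * (deg i * deg j + k * deg j) by ring, pow_mul]
      simp
    rw [parity_pow_gen, parity_pow_gen]
    ext a b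
    fin_cases a <;> fin_cases b
    · simp only [Matrix.mul_apply, Fin.sum_univ_two, Matrix.smul_apply]
      simp only [Fin.zero_eta, Fin.isValue, Matrix.of_apply, Matrix.cons_val', Matrix.cons_val_zero,
        Matrix.cons_val_fin_one, Matrix.cons_val_one, mul_zero, add_zero, smul_mul_smul_comm]
      rw [gen_comm, smul_comm, mul_comm ((-1 : ℝ) ^ (k * deg i))]
    · simp only [Matrix.mul_apply, Fin.sum_univ_two, Matrix.smul_apply]
      simp [h2, h3, add_comm]
    · simp [Matrix.mul_apply, Fin.sum_univ_two]
    · simp only [Matrix.mul_apply, Fin.sum_univ_two, Matrix.smul_apply]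
      simp [gen_comm i j])

/-- The derivation of parity `k` (so that `τ (x y) = τ x y + ε^k(x) τ y`) with the values `v` on
the generators. -/
def deriv (k : ℕ) (v : ι → FGC deg) (hv : IsDerivData deg k v) : FGC deg →ₗ[ℝ] FGC deg where
  toFun x := derivAux k v hv x 0 1
  map_add' x y := by simp
  map_smul' a x := by simp

theorem derivAux_zero_zero (k : ℕ) (v : ι → FGC deg) (hv : IsDerivData deg k v) (x : FGC deg) :
    derivAux k v hv x 0 0 = ((parity deg) ^ k) x ∧ derivAux k v hv x 1 0 = 0 ∧
      derivAux k v hv x 1 1 = x := by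
  induction x using induction_mon with
  | hm l =>
    induction l with
    | nil => simp
    | cons i l ih =>
      have hg : derivAux k v hv (gen deg i) = !![((parity deg) ^ k) (gen deg i), v i; 0, gen deg i] :=
        lift_gen _ _ _
      simp only [mon_cons, map_mul, Matrix.mul_apply, Fin.sum_univ_two, hg, ih.1, ih.2.1, ih.2.2]
      simp
  | ha x y h1 h2 => simp [h1, h2]
  | hs a x h => simp [h]

@[simp]
theorem deriv_gen (k : ℕ) (v : ι → FGC deg) (hv : IsDerivData deg k v) (i : ι) :
    deriv k v hv (gen deg i) = v i := by
  simp [deriv, derivAux]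

theorem deriv_mul (k : ℕ) (v : ι → FGC deg) (hv : IsDerivData deg k v) (x y : FGC deg) :
    deriv k v hv (x * y) = deriv k v hv x * y + ((parity deg) ^ k) x * deriv k v hv y := by
  have hx := derivAux_zero_zero k v hv x
  have hy := derivAux_zero_zero k v hv y
  change derivAux k v hv (x * y) 0 1 = derivAux k v hv x 0 1 * y + _ * derivAux k v hv y 0 1
  rw [map_mul, Matrix.mul_apply, Fin.sum_univ_two, hx.1, hy.2.2, add_comm]

theorem deriv_one (k : ℕ) (v : ι → FGC deg) (hv : IsDerivData deg k v) :
    deriv k v hv 1 = 0 := by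
  have := deriv_mul k v hv 1 1
  simpa using this

theorem deriv_mem {v : ι → FGC deg} (hv : ∀ i, v i ∈ gr deg (deg i + 1)) {p : ℕ} {x : FGC deg}
    (hx : x ∈ gr deg p) : deriv 1 v (isDerivData_of_mem hv) x ∈ gr deg (p + 1) := by
  induction hx using Submodule.span_induction with
  | mem x hx =>
    obtain ⟨l, rfl, rfl⟩ := hx
    induction l with
    | nil => simp [deriv_one]
    | cons i l ih =>
      rw [mon_cons, deriv_mul, deriv_gen, pow_one, parity_gen, smul_mul_assoc, List.map_cons,
        List.sum_cons]
      refine Submodule.add_mem _ ?_ (Submodule.smul_mem _ _ ?_)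
      · rw [add_right_comm]
        exact mul_mem (hv i) (mon_mem l)
      · rw [add_assoc]
        exact mul_mem (gen_mem i) ih
  | zero => simp
  | add y z _ _ h1 h2 => rw [map_add]; exact Submodule.add_mem _ h1 h2
  | smul a y _ h => rw [map_smul]; exact Submodule.smul_mem _ _ h

theorem deriv_leibniz {v : ι → FGC deg} (hv : IsDerivData deg 1 v) {p : ℕ}
    {x : FGC deg} (hx : x ∈ gr deg p) (y : FGC deg) :
    deriv 1 v hv (x * y) = deriv 1 v hv x * y + (-1 : ℝ) ^ p • (x * deriv 1 v hv y) := by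
  rw [deriv_mul, pow_one, parity_mem hx, smul_mul_assoc]

theorem deriv_deriv {v : ι → FGC deg} (hv : ∀ i, v i ∈ gr deg (deg i + 1))
    (h : ∀ i, deriv 1 v (isDerivData_of_mem hv) (v i) = 0) (x : FGC deg) :
    deriv 1 v (isDerivData_of_mem hv) (deriv 1 v (isDerivData_of_mem hv) x) = 0 := by
  induction x using induction_mon with
  | hm l =>
    induction l with
    | nil => simp [deriv_one]
    | cons i l ih =>
      rw [mon_cons, deriv_leibniz _ (gen_mem i), map_add, map_smul, deriv_gen,
        deriv_leibniz _ (hv i), deriv_leibniz _ (gen_mem i), ih, h i, deriv_gen, pow_succ]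
      simp
  | ha x y h1 h2 => simp [h1, h2]
  | hs a x h => simp [h]

end FGC

/-! ### `L_∞`-algebras -/

/-- A finite-dimensional `L_∞`-algebra `𝔤`, `ℕ₊`-graded, in the dual description by its
Chevalley–Eilenberg algebra: `𝔤*` has the homogeneous basis `ι`, and `∧•(𝔤*)` carries a
differential. -/
structure LInfty where
  ι : Type
  [fin : Fintype ι]
  deg : ι → ℕ
  deg_pos : ∀ i, 0 < deg i
  d : FGC deg →ₗ[ℝ] FGC deg
  d_mem : ∀ {p : ℕ} {x : FGC deg}, x ∈ FGC.gr deg p → d x ∈ FGC.gr deg (p + 1)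
  leibniz : ∀ {p : ℕ} {x : FGC deg}, x ∈ FGC.gr deg p → ∀ y : FGC deg,
    d (x * y) = d x * y + (-1 : ℝ) ^ p • (x * d y)
  d_d : ∀ x : FGC deg, d (d x) = 0

attribute [instance] LInfty.fin

namespace LInfty

/-- The Chevalley–Eilenberg algebra `CE(𝔤)`. -/
def CE (g : LInfty) : DGCA.{0} where
  carrier := FGC g.deg
  gr := FGC.gr g.deg
  d := g.d
  one_mem := FGC.one_mem
  mul_mem := FGC.mul_mem
  comm := FGC.comm
  d_mem := g.d_mem
  leibniz := g.leibniz
  d_d := g.d_d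

/-- The generators of `CE(𝔤)`. -/
def gen (g : LInfty) (i : g.ι) : FGC g.deg := FGC.gen g.deg i

/-- A differential given on generators. -/
def ofGen {ι : Type} [Fintype ι] (deg : ι → ℕ) (hdeg : ∀ i, 0 < deg i) (v : ι → FGC deg)
    (hv : ∀ i, v i ∈ FGC.gr deg (deg i + 1))
    (h : ∀ i, FGC.deriv 1 v (FGC.isDerivData_of_mem hv) (v i) = 0) : LInfty where
  ι := ι
  deg := deg
  deg_pos := hdeg
  d := FGC.deriv 1 v (FGC.isDerivData_of_mem hv)
  d_mem := FGC.deriv_mem hv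
  leibniz := FGC.deriv_leibniz _
  d_d := FGC.deriv_deriv hv h

theorem d_one (g : LInfty) : g.d 1 = 0 := by
  have := g.leibniz FGC.one_mem 1
  simpa using this

theorem d_mul (g : LInfty) (x y : FGC g.deg) :
    g.d (x * y) = g.d x * y + FGC.parity g.deg x * g.d y := by
  induction x using FGC.induction_mon with
  | hm l => rw [g.leibniz (FGC.mon_mem l), FGC.parity_mem (FGC.mon_mem l), smul_mul_assoc]
  | ha x z h1 h2 => rw [add_mul, map_add, map_add, map_add, h1, h2, add_mul, add_mul]; abel
  | hs a x h => simp [h]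

end LInfty

namespace FGC

variable {ι κ : Type} {deg : ι → ℕ} {deg' : κ → ℕ}

theorem algHom_eq_zero {B : Type*} [Ring B] [Algebra ℝ B] (φ : FGC deg →ₐ[ℝ] B)
    (h : ∀ i, φ (gen deg i) = 0) {p : ℕ} (hp : 0 < p) {x : FGC deg} (hx : x ∈ gr deg p) :
    φ x = 0 := by
  induction hx using Submodule.span_induction with
  | mem x hx =>
    obtain ⟨l, rfl, rfl⟩ := hx
    cases l with
    | nil => simp at hp
    | cons i l => simp [h]
  | zero => simp
  | add y z _ _ h1 h2 => rw [map_add, h1, h2, add_zero]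
  | smul a y _ h => rw [map_smul, h, smul_zero]

/-- Two derivations along an algebra map agree if they agree on generators. -/
theorem deriv_ext (φ : FGC deg →ₐ[ℝ] FGC deg') (D E : FGC deg →ₗ[ℝ] FGC deg')
    (hD : ∀ i y, D (gen deg i * y) = D (gen deg i) * φ y + (-1 : ℝ) ^ deg i • (φ (gen deg i) * D y))
    (hE : ∀ i y, E (gen deg i * y) = E (gen deg i) * φ y + (-1 : ℝ) ^ deg i • (φ (gen deg i) * E y))
    (h1 : D 1 = E 1) (h : ∀ i, D (gen deg i) = E (gen deg i)) : D = E := by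
  ext x
  induction x using induction_mon with
  | hm l =>
    induction l with
    | nil => simpa using h1
    | cons i l ih => rw [mon_cons, hD, hE, h, ih]
  | ha x y h1 h2 => simp [h1, h2]
  | hs a x h => simp [h]

end FGC

namespace LInfty

/-- The inclusion of generators into a larger free algebra. -/
def incl (g : LInfty) {κ : Type} (deg' : κ → ℕ) :
    FGC g.deg →ₐ[ℝ] FGC (Sum.elim g.deg deg') := FGC.map Sum.inl (fun _ => rfl)

theorem deriv_incl (g : LInfty) {κ : Type} (deg' : κ → ℕ)
    (v : g.ι ⊕ κ → FGC (Sum.elim g.deg deg'))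
    (hv : FGC.IsDerivData (Sum.elim g.deg deg') 1 v)
    (h : ∀ i, v (Sum.inl i) = g.incl deg' (g.d (g.gen i))) (x : FGC g.deg) :
    FGC.deriv 1 v hv (g.incl deg' x) = g.incl deg' (g.d x) := by
  have := FGC.deriv_ext (g.incl deg') (FGC.deriv 1 v hv ∘ₗ (g.incl deg').toLinearMap)
    ((g.incl deg').toLinearMap ∘ₗ g.d) ?_ ?_ ?_ ?_
  · exact DFunLike.congr_fun this x
  · intro i y
    have hi : g.incl deg' (FGC.gen g.deg i) ∈ FGC.gr (Sum.elim g.deg deg') (g.deg i) :=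
      FGC.map_mem _ _ (FGC.gen_mem i)
    simp [FGC.deriv_leibniz hv hi]
  · intro i y
    simp [g.leibniz (FGC.gen_mem i)]
  · simp [FGC.deriv_one, g.d_one]
  · intro i
    have : FGC.deriv 1 v hv (g.incl deg' (FGC.gen g.deg i)) = v (Sum.inl i) := by
      rw [incl, FGC.map_gen (deg := g.deg) (deg' := Sum.elim g.deg deg') Sum.inl (fun _ => rfl) i,
        FGC.deriv_gen]
    simp only [LinearMap.comp_apply, AlgHom.toLinearMap_apply]
    exact this.trans (h i)

/-- The `L_∞`-algebra whose Chevalley–Eilenberg algebra arises from `CE(𝔤)` by adding one generator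
`b = gen (inr ())` of degree `n` with `d b = z`, for a closed `z` of degree `n + 1`. -/
def addGen (g : LInfty) (n : ℕ) (hn : 0 < n) (z : FGC g.deg) (hz : z ∈ FGC.gr g.deg (n + 1))
    (hdz : g.d z = 0) : LInfty :=
  ofGen (ι := g.ι ⊕ Unit) (Sum.elim g.deg (fun _ => n))
    (by rintro (i | _); exacts [g.deg_pos i, hn])
    (Sum.elim (fun i => g.incl _ (g.d (g.gen i))) (fun _ => g.incl _ z))
    (by
      rintro (i | _)
      · exact FGC.map_mem _ _ (g.d_mem (FGC.gen_mem i))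
      · exact FGC.map_mem _ _ hz)
    (by
      rintro (i | _)
      · simp only [Sum.elim_inl]
        rw [deriv_incl _ _ _ _ (fun _ => rfl), g.d_d, map_zero]
      · simp only [Sum.elim_inr]
        rw [deriv_incl _ _ _ _ (fun _ => rfl), hdz, map_zero])

/-- `b^{k-1}𝔲(1)`: one generator, of degree `k ≥ 1`, and zero differential. -/
def line (k : ℕ) (hk : 0 < k) : LInfty :=
  ofGen (ι := Unit) (fun _ => k) (fun _ => hk) (fun _ => 0) (fun _ => Submodule.zero_mem _)
    (fun _ => map_zero _)

end LInfty

/-! ### Normal sub-`L_∞`-algebras and mapping cones -/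

/-- A normal sub-`L_∞`-algebra `t : 𝔥 ↪ 𝔤`, in a basis of `𝔤*` adapted to the surjection
`𝔤* → 𝔥*`: the basis of `𝔥*` is the part `s` of the basis of `𝔤*`, and the remaining basis
vectors span the kernel. The map `t* = res` has to be a morphism `CE(𝔤) → CE(𝔥)`, and the
differentials of the basis vectors in the kernel have to lie in `∧•(ker t₁*)`. -/
structure NormalSub (h g : LInfty) where
  s : h.ι → g.ι
  inj : Function.Injective s
  deg_s : ∀ x, g.deg (s x) = h.deg x
  res : FGC g.deg →ₐ[ℝ] FGC h.deg
  res_s : ∀ x, res (g.gen (s x)) = h.gen x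
  res_ker : ∀ i, i ∉ Set.range s → res (g.gen i) = 0
  res_d : ∀ i, res (g.d (g.gen i)) = h.d (res (g.gen i))
  normal : ∀ i, i ∉ Set.range s →
    g.d (g.gen i) ∈ Algebra.adjoin ℝ (g.gen '' (Set.range s)ᶜ)

namespace NormalSub

variable {h g : LInfty} (t : NormalSub h g)

/-- The degrees of the generators of `∧•(𝔤* ⊕ 𝔥*[1])`. -/
def coneDeg (_t : NormalSub h g) : g.ι ⊕ h.ι → ℕ := Sum.elim g.deg (fun x => h.deg x + 1)

open Classical in
/-- The values of `σt*` on generators: `t*` followed by the shift on `𝔤*`, zero on `𝔥*[1]`. -/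
def shiftVal : g.ι ⊕ h.ι → FGC t.coneDeg
  | Sum.inl i => if hi : ∃ x, t.s x = i then FGC.gen t.coneDeg (Sum.inr hi.choose) else 0
  | Sum.inr _ => 0

theorem shiftVal_s (x : h.ι) : t.shiftVal (Sum.inl (t.s x)) = FGC.gen t.coneDeg (Sum.inr x) := by
  have hx : ∃ y, t.s y = t.s x := ⟨x, rfl⟩
  simp only [shiftVal, dif_pos hx]
  rw [t.inj hx.choose_spec]

theorem shiftVal_ker {i : g.ι} (hi : i ∉ Set.range t.s) : t.shiftVal (Sum.inl i) = 0 := by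
  simp only [shiftVal]
  exact dif_neg hi

theorem shiftVal_mem (i : g.ι ⊕ h.ι) : t.shiftVal i ∈ FGC.gr t.coneDeg (t.coneDeg i + 1) := by
  rcases i with i | x
  · by_cases hi : i ∈ Set.range t.s
    · obtain ⟨x, rfl⟩ := hi
      rw [shiftVal_s]
      have := FGC.gen_mem (deg := t.coneDeg) (Sum.inr x)
      simpa [coneDeg, t.deg_s] using this
    · rw [t.shiftVal_ker hi]
      exact Submodule.zero_mem _
  · exact Submodule.zero_mem _

/-- The derivation `σt*` of degree `1` of `∧•(𝔤* ⊕ 𝔥*[1])`. -/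
def shift : FGC t.coneDeg →ₗ[ℝ] FGC t.coneDeg :=
  FGC.deriv 1 t.shiftVal (FGC.isDerivData_of_mem t.shiftVal_mem)

/-- The inclusion `∧•(𝔤*) → ∧•(𝔤* ⊕ 𝔥*[1])`. -/
def incl : FGC g.deg →ₐ[ℝ] FGC t.coneDeg := g.incl _

@[simp] theorem incl_gen (i : g.ι) : t.incl (g.gen i) = FGC.gen t.coneDeg (Sum.inl i) :=
  FGC.map_gen _ (fun _ => rfl) _

theorem incl_mem {p : ℕ} {x : FGC g.deg} (hx : x ∈ FGC.gr g.deg p) :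
    t.incl x ∈ FGC.gr t.coneDeg p := FGC.map_mem _ (fun _ => rfl) hx

/-- The differential of the mapping cone on generators:
`d_t a = d a + σt*(a)` for `a ∈ 𝔤*`, and `d_t (σt*(a)) = -σt*(d a)`. -/
def coneVal : g.ι ⊕ h.ι → FGC t.coneDeg
  | Sum.inl i => t.incl (g.d (g.gen i)) + t.shift (t.incl (g.gen i))
  | Sum.inr x => -t.shift (t.incl (g.d (g.gen (t.s x))))

theorem shift_mem {p : ℕ} {x : FGC t.coneDeg} (hx : x ∈ FGC.gr t.coneDeg p) :
    t.shift x ∈ FGC.gr t.coneDeg (p + 1) := FGC.deriv_mem t.shiftVal_mem hx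

theorem coneVal_mem (i : g.ι ⊕ h.ι) : t.coneVal i ∈ FGC.gr t.coneDeg (t.coneDeg i + 1) := by
  rcases i with i | x
  · exact Submodule.add_mem _ (t.incl_mem (g.d_mem (FGC.gen_mem i)))
      (t.shift_mem (t.incl_mem (FGC.gen_mem i)))
  · refine Submodule.neg_mem _ ?_
    have := t.shift_mem (t.incl_mem (g.d_mem (FGC.gen_mem (t.s x))))
    rw [t.deg_s] at this
    exact this

/-- The differential `d_t`. -/
def coneD : FGC t.coneDeg →ₗ[ℝ] FGC t.coneDeg :=
  FGC.deriv 1 t.coneVal (FGC.isDerivData_of_mem t.coneVal_mem)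

theorem coneD_incl (x : FGC g.deg) :
    t.coneD (t.incl x) = t.incl (g.d x) + t.shift (t.incl x) := by
  have := FGC.deriv_ext t.incl (t.coneD ∘ₗ t.incl.toLinearMap)
    (t.incl.toLinearMap ∘ₗ g.d + t.shift ∘ₗ t.incl.toLinearMap) ?_ ?_ ?_ ?_
  · exact DFunLike.congr_fun this x
  · intro i y
    have hi : t.incl (FGC.gen g.deg i) ∈ FGC.gr t.coneDeg (g.deg i) := t.incl_mem (FGC.gen_mem i)
    simp [coneD, FGC.deriv_leibniz _ hi]
  · intro i y
    have hi : t.incl (FGC.gen g.deg i) ∈ FGC.gr t.coneDeg (g.deg i) := t.incl_mem (FGC.gen_mem i)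
    simp only [LinearMap.add_apply, LinearMap.comp_apply, AlgHom.toLinearMap_apply, map_mul,
      g.leibniz (FGC.gen_mem i), map_add, map_smul, shift, FGC.deriv_leibniz _ hi, add_mul, mul_add,
      smul_add]
    abel
  · simp [coneD, shift, FGC.deriv_one, g.d_one]
  · intro i
    change t.coneD (t.incl (g.gen i)) = t.incl (g.d (g.gen i)) + t.shift (t.incl (g.gen i))
    rw [incl_gen]
    simp [coneD, coneVal]

theorem shift_incl_adjoin {x : FGC g.deg}
    (hx : x ∈ Algebra.adjoin ℝ (g.gen '' (Set.range t.s)ᶜ)) : t.shift (t.incl x) = 0 := by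
  induction hx using Algebra.adjoin_induction with
  | mem x hx =>
    obtain ⟨i, hi, rfl⟩ := hx
    rw [incl_gen, shift, FGC.deriv_gen, t.shiftVal_ker hi]
  | algebraMap r =>
    rw [AlgHom.commutes, Algebra.algebraMap_eq_smul_one, map_smul, shift, FGC.deriv_one, smul_zero]
  | add x y _ _ h1 h2 => rw [map_add, map_add, h1, h2, add_zero]
  | mul x y _ _ h1 h2 =>
    rw [shift] at h1 h2 ⊢
    rw [map_mul, FGC.deriv_mul, h1, h2, zero_mul, mul_zero, add_zero]

theorem coneD_coneVal_inl (i : g.ι) : t.coneD (t.coneVal (Sum.inl i)) = 0 := by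
  simp only [coneVal, map_add]
  rw [coneD_incl, g.d_d, map_zero, zero_add, incl_gen]
  by_cases hi : i ∈ Set.range t.s
  · obtain ⟨x, rfl⟩ := hi
    rw [shift, FGC.deriv_gen, shiftVal_s, coneD, FGC.deriv_gen]
    simp [coneVal, shift]
  · rw [t.shift_incl_adjoin (t.normal i hi), shift, FGC.deriv_gen, t.shiftVal_ker hi, map_zero,
      add_zero]

theorem coneD_coneD_incl (x : FGC g.deg) : t.coneD (t.coneD (t.incl x)) = 0 := by
  induction x using FGC.induction_mon with
  | hm l =>
    induction l with
    | nil => simp [coneD, FGC.deriv_one]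
    | cons i l ih =>
      have hi : t.incl (FGC.gen g.deg i) ∈ FGC.gr t.coneDeg (g.deg i) :=
        t.incl_mem (FGC.gen_mem i)
      have h1 : t.coneD (t.incl (FGC.gen g.deg i)) = t.coneVal (Sum.inl i) := by
        change t.coneD (t.incl (g.gen i)) = _
        rw [incl_gen, coneD, FGC.deriv_gen]
      have h2 := t.coneD_coneVal_inl i
      have h3 := t.coneVal_mem (Sum.inl i)
      have h3' : t.coneVal (Sum.inl i) ∈ FGC.gr t.coneDeg (g.deg i + 1) := h3
      rw [coneD] at ih h1 h2 ⊢
      rw [FGC.mon_cons, map_mul, FGC.deriv_leibniz _ hi, map_add, map_smul, h1,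
        FGC.deriv_leibniz _ h3', FGC.deriv_leibniz _ hi, ih, h2, h1, pow_succ]
      simp
  | ha x y h1 h2 => simp [h1, h2]
  | hs a x h => simp [h]

theorem coneD_coneVal (i : g.ι ⊕ h.ι) : t.coneD (t.coneVal i) = 0 := by
  rcases i with i | x
  · exact t.coneD_coneVal_inl i
  · have h1 := t.coneD_incl (g.d (g.gen (t.s x)))
    rw [g.d_d, map_zero, zero_add] at h1
    simp only [coneVal, map_neg, ← h1, coneD_coneD_incl, neg_zero]

/-- The `L_∞`-algebra `(𝔥 ↪ 𝔤)` given by the mapping cone of `t*`. Its generators are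
`inl i` for the basis of `𝔤*`, and `inr x` (written `σ x`) for the basis of `𝔥*[1]`. -/
def cone : LInfty :=
  LInfty.ofGen (ι := g.ι ⊕ h.ι) t.coneDeg
    (by
      rintro (i | x)
      · exact g.deg_pos i
      · exact Nat.succ_pos _)
    t.coneVal t.coneVal_mem t.coneD_coneVal

/-- The identity of `𝔤`. -/
def refl (g : LInfty) : NormalSub g g where
  s := id
  inj := Function.injective_id
  deg_s _ := rfl
  res := AlgHom.id ℝ _
  res_s _ := rfl
  res_ker i hi := absurd ⟨i, rfl⟩ hi
  res_d _ := rfl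
  normal i hi := absurd ⟨i, rfl⟩ hi

end NormalSub

namespace LInfty

/-- `inn(𝔤)`, the mapping cone of the identity. Its Chevalley–Eilenberg algebra is the
Weil algebra of `𝔤`. -/
def inn (g : LInfty) : LInfty := (NormalSub.refl g).cone

/-- The Weil algebra `W(𝔤)`, with generators `inl i` in `𝔤*` and `inr i` (written `σ i`) in the
shifted copy `𝔤*[1]`. -/
abbrev W (g : LInfty) : DGCA.{0} := g.inn.CE

/-- The projection `W(𝔤) → CE(𝔤)`, killing `𝔤*[1]`. -/
def toCE (g : LInfty) : FGC g.inn.deg →ₐ[ℝ] FGC g.deg :=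
  FGC.lift (Sum.elim g.gen (fun _ => 0)) (by
    rintro (i | i) (j | j)
    · exact FGC.gen_comm i j
    · simp
    · simp
    · simp)

open Classical in
/-- The values of the contraction with the basis vector of `𝔤` dual to `i`. -/
def contractionVal (g : LInfty) (i : g.ι) : g.inn.ι → FGC g.inn.deg :=
  Sum.elim (fun j => if j = i then 1 else 0) (fun _ => 0)

theorem isDerivData_contractionVal (g : LInfty) (i : g.ι) :
    FGC.IsDerivData g.inn.deg (g.deg i) (g.contractionVal i) := by
  intro a b
  rcases b with j | j
  · by_cases h : j = i
    · subst h
      have : g.inn.deg (Sum.inl j) = g.deg j := rfl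
      simp [contractionVal, this, ← two_mul, mul_left_comm _ 2, pow_mul]
    · simp [contractionVal, h]
  · simp [contractionVal]

/-- The contraction `ι_X` of `W(𝔤)`, for `X` the basis vector of `𝔤` dual to `i`: the derivation of
degree `-deg i` which sends the generator `i` of `𝔤*` to `1` and all other generators, in
particular all of `𝔤*[1]`, to `0`. -/
def contraction (g : LInfty) (i : g.ι) : FGC g.inn.deg →ₗ[ℝ] FGC g.inn.deg :=
  FGC.deriv (g.deg i) (g.contractionVal i) (g.isDerivData_contractionVal i)

theorem contraction_parity (g : LInfty) (i : g.ι) (x : FGC g.inn.deg) :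
    g.contraction i (FGC.parity g.inn.deg x) =
      (-1 : ℝ) ^ g.deg i • FGC.parity g.inn.deg (g.contraction i x) := by
  have hc : ∀ a : g.inn.ι, g.contractionVal i a = 0 ∨
      (g.contractionVal i a = 1 ∧ g.inn.deg a = g.deg i) := by
    rintro (j | j)
    · by_cases h : j = i
      · subst h; right; exact ⟨by simp [contractionVal], rfl⟩
      · left; simp [contractionVal, h]
    · left; rfl
  induction x using FGC.induction_mon with
  | hm l =>
    induction l with
    | nil => simp [contraction, FGC.deriv_one]
    | cons a l ih =>
      have hcomm : ∀ y, ((FGC.parity g.inn.deg) ^ g.deg i) (FGC.parity g.inn.deg y) =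
          FGC.parity g.inn.deg (((FGC.parity g.inn.deg) ^ g.deg i) y) := by
        intro y
        rw [← AlgHom.mul_apply, ← AlgHom.mul_apply, ← pow_succ, ← pow_succ']
      have h1 : ∀ x y, g.contraction i (x * y) = g.contraction i x * y +
          ((FGC.parity g.inn.deg) ^ g.deg i) x * g.contraction i y := FGC.deriv_mul _ _ _
      have h2 : g.contraction i (FGC.gen g.inn.deg a) = g.contractionVal i a :=
        FGC.deriv_gen _ _ _ _
      rw [FGC.mon_cons, map_mul, h1, h1, map_add, map_mul, map_mul, ih,
        hcomm, smul_add, FGC.parity_gen, map_smul, h2, mul_smul_comm]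
      congr 1
      rcases hc a with h | ⟨h, hd⟩
      · simp [h]
      · simp [h, hd]
  | ha x y h1 h2 => simp [h1, h2]
  | hs a x h => rw [map_smul, map_smul, map_smul, map_smul, h, smul_comm]

/-- The invariant polynomials `inv(𝔤) = W(𝔤)_basic`: the elements annihilated by all contractions
`ι_X` and all `ι_X ∘ d`, equivalently by all `ι_X` and all Lie derivatives `[d, ι_X]`. -/
def invSubalgebra (g : LInfty) : Subalgebra ℝ (FGC g.inn.deg) where
  carrier := {P | ∀ i, g.contraction i P = 0 ∧ g.contraction i (g.inn.d P) = 0}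
  mul_mem' := by
    intro P Q hP hQ i
    have h1 : ∀ x y, g.contraction i (x * y) = g.contraction i x * y +
        ((FGC.parity g.inn.deg) ^ g.deg i) x * g.contraction i y := FGC.deriv_mul _ _ _
    refine ⟨by rw [h1, (hP i).1, (hQ i).1]; simp, ?_⟩
    rw [g.inn.d_mul, map_add, h1, h1, contraction_parity, (hP i).1, (hP i).2, (hQ i).1, (hQ i).2]
    simp
  add_mem' := by
    intro P Q hP hQ i
    simp [(hP i).1, (hP i).2, (hQ i).1, (hQ i).2]
  algebraMap_mem' := by
    intro r i
    have : g.contraction i 1 = 0 := FGC.deriv_one _ _ _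
    rw [Algebra.algebraMap_eq_smul_one]
    simp [this, g.inn.d_one]

/-- `inv(𝔤)` as a differential graded-commutative algebra. -/
def inv (g : LInfty) : DGCA.{0} where
  carrier := g.invSubalgebra
  gr p := (FGC.gr g.inn.deg p).comap g.invSubalgebra.val.toLinearMap
  d := g.inn.d.restrict (p := Subalgebra.toSubmodule g.invSubalgebra)
    (q := Subalgebra.toSubmodule g.invSubalgebra)
    (by intro P hP i; exact ⟨(hP i).2, by rw [g.inn.d_d, map_zero]⟩)
  one_mem := FGC.one_mem
  mul_mem := fun hx hy => FGC.mul_mem hx hy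
  comm := fun hx hy => Subtype.ext (FGC.comm hx hy)
  d_mem := fun hx => g.inn.d_mem hx
  leibniz := fun hx y => Subtype.ext (g.inn.leibniz hx y)
  d_d x := Subtype.ext (g.inn.d_d x)

end LInfty

/-! ### Transgression and String-like extensions -/

/-- A cocycle `μ` of degree `n + 1` on `𝔤` (`n ≥ 1`) and an invariant polynomial `P` on `𝔤`,
together with a transgression element `cs` exhibiting that `μ` transgresses to `P`. -/
structure Transgression (g : LInfty) (n : ℕ) where
  μ : FGC g.deg
  μ_mem : μ ∈ FGC.gr g.deg (n + 1)
  d_μ : g.d μ = 0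
  P : FGC g.inn.deg
  P_inv : P ∈ g.invSubalgebra
  cs : FGC g.inn.deg
  cs_mem : cs ∈ FGC.gr g.inn.deg (n + 1)
  d_cs : g.inn.d cs = P
  toCE_cs : g.toCE cs = μ

namespace Transgression

variable {g : LInfty} {n : ℕ} (T : Transgression g n)

theorem d_P : g.inn.d T.P = 0 := by rw [← T.d_cs, g.inn.d_d]

theorem P_mem : T.P ∈ FGC.gr g.inn.deg (n + 1 + 1) := by
  rw [← T.d_cs]; exact g.inn.d_mem T.cs_mem

/-- The String-like extension `𝔤_μ`: one more generator `b = gen (inr ())`, of degree `n`, with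
`d b = -μ`. -/
def stringExt (hn : 0 < n) : LInfty :=
  g.addGen n hn (-T.μ) (Submodule.neg_mem _ T.μ_mem) (by rw [map_neg, T.d_μ, neg_zero])

/-- The Chern `L_∞`-algebra `ch_P(𝔤)`: to `W(𝔤)` one adds `c = gen (inr ())`, of degree `n + 1`,
with `d c = P`. -/
def ch : LInfty := g.inn.addGen (n + 1) n.succ_pos T.P T.P_mem T.d_P

/-- The inclusion `W(𝔤) → CE(ch_P(𝔤))`. -/
def inclCh : FGC g.inn.deg →ₐ[ℝ] FGC T.ch.deg := g.inn.incl _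

theorem inclCh_mem {p : ℕ} {x : FGC g.inn.deg} (hx : x ∈ FGC.gr g.inn.deg p) :
    T.inclCh x ∈ FGC.gr T.ch.deg p := FGC.map_mem _ (fun _ => rfl) hx

theorem csAlg_mem : T.ch.gen (Sum.inr ()) - T.inclCh T.cs ∈ FGC.gr T.ch.deg (n + 1) :=
  Submodule.sub_mem _ (FGC.gen_mem (deg := T.ch.deg) (Sum.inr ())) (T.inclCh_mem T.cs_mem)

theorem csAlg_closed : T.ch.d (T.ch.gen (Sum.inr ()) - T.inclCh T.cs) = 0 := by
  have h1 : T.ch.d (T.ch.gen (Sum.inr ())) = T.inclCh T.P := by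
    change FGC.deriv 1 _ _ (FGC.gen _ _) = _
    rw [FGC.deriv_gen]; rfl
  have h2 : T.ch.d (T.inclCh T.cs) = T.inclCh (g.inn.d T.cs) :=
    LInfty.deriv_incl _ _ _ _ (fun _ => rfl) _
  rw [map_sub, h1, h2, T.d_cs, sub_self]

/-- The Chern–Simons `L_∞`-algebra `cs_P(𝔤)`: to `CE(ch_P(𝔤))` one adds `b = gen (inr ())`, of
degree `n`, with `d b = c - cs`. -/
def csAlg (hn : 0 < n) : LInfty :=
  T.ch.addGen n hn (T.ch.gen (Sum.inr ()) - T.inclCh T.cs) T.csAlg_mem T.csAlg_closed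

end Transgression

namespace LInfty

theorem ofGen_d_gen {ι : Type} [Fintype ι] (deg : ι → ℕ) (hdeg : ∀ i, 0 < deg i)
    (v : ι → FGC deg) (hv : ∀ i, v i ∈ FGC.gr deg (deg i + 1))
    (h : ∀ i, FGC.deriv 1 v (FGC.isDerivData_of_mem hv) (v i) = 0) (i : ι) :
    (ofGen deg hdeg v hv h).d (FGC.gen deg i) = v i := FGC.deriv_gen _ _ _ _

variable (g : LInfty) (n : ℕ) (hn : 0 < n) (z : FGC g.deg) (hz : z ∈ FGC.gr g.deg (n + 1))
  (hdz : g.d z = 0)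

/-- The inclusion `CE(𝔤) → CE(𝔤')` for `𝔤'` obtained by adding a generator. -/
def addGenIncl : FGC g.deg →ₐ[ℝ] FGC (g.addGen n hn z hz hdz).deg := g.incl _

theorem addGenIncl_gen (i : g.ι) :
    g.addGenIncl n hn z hz hdz (g.gen i) = (g.addGen n hn z hz hdz).gen (Sum.inl i) :=
  FGC.map_gen _ (fun _ => rfl) _

theorem addGenIncl_mem {p : ℕ} {x : FGC g.deg} (hx : x ∈ FGC.gr g.deg p) :
    g.addGenIncl n hn z hz hdz x ∈ FGC.gr (g.addGen n hn z hz hdz).deg p :=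
  FGC.map_mem _ (fun _ => rfl) hx

theorem addGen_d_incl (x : FGC g.deg) :
    (g.addGen n hn z hz hdz).d (g.addGenIncl n hn z hz hdz x) =
      g.addGenIncl n hn z hz hdz (g.d x) :=
  deriv_incl _ _ _ _ (fun _ => rfl) _

theorem addGen_d_gen :
    (g.addGen n hn z hz hdz).d ((g.addGen n hn z hz hdz).gen (Sum.inr ())) =
      g.addGenIncl n hn z hz hdz z :=
  ofGen_d_gen _ _ _ _ _ _

theorem addGenIncl_adjoin (x : FGC g.deg) (S : Set (g.addGen n hn z hz hdz).ι)
    (hS : ∀ i, Sum.inl i ∈ S) :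
    g.addGenIncl n hn z hz hdz x ∈ Algebra.adjoin ℝ ((g.addGen n hn z hz hdz).gen '' S) := by
  induction x using FGC.induction_mon with
  | hm l =>
    induction l with
    | nil => simp
    | cons i l ih =>
      rw [FGC.mon_cons, map_mul]
      refine Subalgebra.mul_mem _ (Algebra.subset_adjoin ⟨Sum.inl i, hS i, ?_⟩) ih
      exact (g.addGenIncl_gen n hn z hz hdz i).symm
  | ha x y h1 h2 => rw [map_add]; exact Subalgebra.add_mem _ h1 h2
  | hs a x h => rw [map_smul]; exact Subalgebra.smul_mem _ h a

/-- The inclusion `CE(𝔤) → CE(𝔤')` as a morphism. -/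
def addGenHom : DGHom g.CE (g.addGen n hn z hz hdz).CE where
  toAlgHom := g.addGenIncl n hn z hz hdz
  map_gr _ _ hx := g.addGenIncl_mem n hn z hz hdz hx
  map_d x := (g.addGen_d_incl n hn z hz hdz x).symm

/-- The restriction `CE(𝔤') → CE(b^{n-1}𝔲(1))` which keeps the added generator and kills the
others. -/
def addGenRes : FGC (g.addGen n hn z hz hdz).deg →ₐ[ℝ] FGC (line n hn).deg :=
  FGC.lift (Sum.elim (fun _ => 0) (fun _ => (line n hn).gen ())) (by
    rintro (i | _) (j | _)
    · simp
    · simp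
    · simp
    · exact FGC.gen_comm () ())

theorem addGenRes_inl (i : g.ι) :
    g.addGenRes n hn z hz hdz ((g.addGen n hn z hz hdz).gen (Sum.inl i)) = 0 :=
  FGC.lift_gen _ _ _

theorem addGenRes_inr :
    g.addGenRes n hn z hz hdz ((g.addGen n hn z hz hdz).gen (Sum.inr ())) = (line n hn).gen () :=
  FGC.lift_gen _ _ _

theorem addGenRes_incl {p : ℕ} (hp : 0 < p) {x : FGC g.deg} (hx : x ∈ FGC.gr g.deg p) :
    g.addGenRes n hn z hz hdz (g.addGenIncl n hn z hz hdz x) = 0 := by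
  refine FGC.algHom_eq_zero ((g.addGenRes n hn z hz hdz).comp (g.addGenIncl n hn z hz hdz)) ?_
    hp hx
  intro i
  exact (congrArg _ (g.addGenIncl_gen n hn z hz hdz i)).trans (g.addGenRes_inl n hn z hz hdz i)

/-- The sub-`L_∞`-algebra `b^{n-1}𝔲(1)` dual to the added generator. -/
def addGenSub : NormalSub (line n hn) (g.addGen n hn z hz hdz) where
  s _ := Sum.inr ()
  inj _ _ _ := rfl
  deg_s _ := rfl
  res := g.addGenRes n hn z hz hdz
  res_s _ := g.addGenRes_inr n hn z hz hdz
  res_ker i hi := by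
    rcases i with i | _
    · exact g.addGenRes_inl n hn z hz hdz i
    · exact absurd ⟨(), rfl⟩ hi
  res_d i := by
    rcases i with i | _
    · have h1 := g.addGen_d_incl n hn z hz hdz (g.gen i)
      rw [addGenIncl_gen] at h1
      have h2 := g.addGenRes_incl n hn z hz hdz (Nat.succ_pos _) (g.d_mem (FGC.gen_mem i))
      refine (congrArg _ h1).trans (h2.trans ?_)
      exact ((congrArg _ (g.addGenRes_inl n hn z hz hdz i)).trans (map_zero _)).symm
    · have h1 := g.addGen_d_gen n hn z hz hdz
      have h2 : (line n hn).d ((line n hn).gen ()) = 0 := ofGen_d_gen _ _ _ _ _ _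
      refine (congrArg _ h1).trans ?_
      rw [addGenRes_incl _ _ _ _ _ _ (Nat.succ_pos _) hz]
      exact ((congrArg _ (g.addGenRes_inr n hn z hz hdz)).trans h2).symm
  normal i hi := by
    rcases i with i | _
    · have h1 := g.addGen_d_incl n hn z hz hdz (g.gen i)
      rw [addGenIncl_gen] at h1
      rw [h1]
      refine g.addGenIncl_adjoin n hn z hz hdz _ _ ?_
      rintro j ⟨_, hj⟩
      exact Sum.inr_ne_inl hj
    · exact absurd ⟨(), rfl⟩ hi

/-- The map `W(𝔤) → W(𝔤')` which is the inclusion on the generators. -/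
def addGenIncl_inn : FGC g.inn.deg →ₐ[ℝ] FGC (g.addGen n hn z hz hdz).inn.deg :=
  FGC.map (Sum.map Sum.inl Sum.inl) (by rintro (i | i) <;> rfl)

end LInfty

namespace LInfty

theorem toCE_inl (g : LInfty) (i : g.ι) : g.toCE (g.inn.gen (Sum.inl i)) = g.gen i :=
  FGC.lift_gen _ _ _

theorem toCE_inr (g : LInfty) (i : g.ι) : g.toCE (g.inn.gen (Sum.inr i)) = 0 :=
  FGC.lift_gen _ _ _

end LInfty

theorem NormalSub.hom_shift {h g : LInfty} (t : NormalSub h g) {B : Type*} [Ring B] [Algebra ℝ B]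
    (φ : FGC t.coneDeg →ₐ[ℝ] B) (hφ : ∀ x, φ (FGC.gen t.coneDeg (Sum.inr x)) = 0)
    (y : FGC t.coneDeg) : φ (t.shift y) = 0 := by
  induction y using FGC.induction_mon with
  | hm l =>
    induction l with
    | nil => simp [NormalSub.shift, FGC.deriv_one]
    | cons i l ih =>
      have h1 : ∀ x y, t.shift (x * y) = t.shift x * y + ((FGC.parity _) ^ 1) x * t.shift y :=
        FGC.deriv_mul _ _ _
      have h2 : φ (t.shift (FGC.gen t.coneDeg i)) = 0 := by
        rw [NormalSub.shift, FGC.deriv_gen]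
        rcases i with i | i
        · by_cases hi : i ∈ Set.range t.s
          · obtain ⟨x, rfl⟩ := hi
            rw [t.shiftVal_s, hφ]
          · rw [t.shiftVal_ker hi, map_zero]
        · exact map_zero _
      rw [FGC.mon_cons, h1, map_add, map_mul, map_mul, ih, h2, zero_mul, mul_zero, add_zero]
  | ha x y h1 h2 => rw [map_add, map_add, h1, h2, add_zero]
  | hs a x h => rw [map_smul, map_smul, h, smul_zero]

namespace LInfty

theorem hom_mem {g h : LInfty} (f : FGC g.deg →ₐ[ℝ] FGC h.deg)
    (hf : ∀ i, f (g.gen i) ∈ FGC.gr h.deg (g.deg i)) {p : ℕ} {x : FGC g.deg}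
    (hx : x ∈ FGC.gr g.deg p) : f x ∈ FGC.gr h.deg p := by
  induction hx using Submodule.span_induction with
  | mem x hx =>
    obtain ⟨l, rfl, rfl⟩ := hx
    induction l with
    | nil => simpa using FGC.one_mem
    | cons i l ih =>
      rw [FGC.mon_cons, map_mul, List.map_cons, List.sum_cons]
      exact FGC.mul_mem (hf i) ih
  | zero => simp
  | add y z _ _ h1 h2 => rw [map_add]; exact Submodule.add_mem _ h1 h2
  | smul a y _ h => rw [map_smul]; exact Submodule.smul_mem _ _ h

theorem hom_d {g h : LInfty} (f : FGC g.deg →ₐ[ℝ] FGC h.deg)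
    (hf : ∀ i, f (g.gen i) ∈ FGC.gr h.deg (g.deg i))
    (hd : ∀ i, f (g.d (g.gen i)) = h.d (f (g.gen i))) (x : FGC g.deg) :
    f (g.d x) = h.d (f x) := by
  have := FGC.deriv_ext f (f.toLinearMap ∘ₗ g.d) (h.d ∘ₗ f.toLinearMap) ?_ ?_ ?_ hd
  · exact DFunLike.congr_fun this x
  · intro i y
    simp [g.leibniz (FGC.gen_mem i)]
  · intro i y
    have := h.leibniz (hf i) (f y)
    simpa [LInfty.gen] using this
  · simp [d_one]

/-- A morphism of Chevalley–Eilenberg algebras is given on generators. -/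
def homOfGen {g h : LInfty} (f : FGC g.deg →ₐ[ℝ] FGC h.deg)
    (hf : ∀ i, f (g.gen i) ∈ FGC.gr h.deg (g.deg i))
    (hd : ∀ i, f (g.d (g.gen i)) = h.d (f (g.gen i))) : DGHom g.CE h.CE where
  toAlgHom := f
  map_gr _ _ hx := hom_mem f hf hx
  map_d x := hom_d f hf hd x

/-- The inclusion of algebras `∧•(𝔤*) → W(𝔤)`. -/
def inclW (g : LInfty) : FGC g.deg →ₐ[ℝ] FGC g.inn.deg := (NormalSub.refl g).incl

/-- The shift derivation `σ` of `W(𝔤)`. -/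
def shiftW (g : LInfty) : FGC g.inn.deg →ₗ[ℝ] FGC g.inn.deg := (NormalSub.refl g).shift

theorem inn_d_inl (g : LInfty) (i : g.ι) : g.inn.d (g.inn.gen (Sum.inl i)) =
    g.inclW (g.d (g.gen i)) + g.inn.gen (Sum.inr i) := by
  refine (ofGen_d_gen (NormalSub.refl g).coneDeg _ _ (NormalSub.refl g).coneVal_mem
    (NormalSub.refl g).coneD_coneVal _).trans ?_
  refine congrArg (fun y : FGC g.inn.deg => g.inclW (g.d (g.gen i)) + y) ?_
  rw [NormalSub.incl_gen, NormalSub.shift, FGC.deriv_gen]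
  exact (NormalSub.refl g).shiftVal_s i

theorem inn_d_inr (g : LInfty) (i : g.ι) : g.inn.d (g.inn.gen (Sum.inr i)) =
    -g.shiftW (g.inclW (g.d (g.gen i))) :=
  ofGen_d_gen (NormalSub.refl g).coneDeg _ _ (NormalSub.refl g).coneVal_mem
    (NormalSub.refl g).coneD_coneVal _

theorem toCE_inclW (g : LInfty) (x : FGC g.deg) : g.toCE (g.inclW x) = x := by
  refine DFunLike.congr_fun (FGC.algHom_ext
    (f := g.toCE.comp g.inclW) (g := AlgHom.id ℝ _) ?_) x
  intro i
  exact (congrArg _ ((NormalSub.refl g).incl_gen i)).trans (g.toCE_inl i)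

theorem toCE_shiftW (g : LInfty) (x : FGC g.inn.deg) : g.toCE (g.shiftW x) = 0 :=
  (NormalSub.refl g).hom_shift g.toCE g.toCE_inr x

/-- The projection `W(𝔤) → CE(𝔤)` as a morphism. -/
def toCEHom (g : LInfty) : DGHom g.W g.CE :=
  homOfGen g.toCE
    (by
      rintro (i | i)
      · have h : g.gen i ∈ FGC.gr g.deg (g.deg i) := FGC.gen_mem i
        rwa [← toCE_inl] at h
      · have h := Submodule.zero_mem (FGC.gr g.deg (g.deg i + 1))
        rwa [← g.toCE_inr i] at h)
    (by
      rintro (i | i)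
      · rw [inn_d_inl, map_add, toCE_inr, add_zero, toCE_inclW, toCE_inl]
      · rw [inn_d_inr, map_neg, toCE_shiftW, toCE_inr, map_zero, neg_zero])

/-- The inclusion `inv(𝔤) → W(𝔤)` as a morphism. -/
def invHom (g : LInfty) : DGHom g.inv g.W where
  toAlgHom := g.invSubalgebra.val
  map_gr _ _ hx := hx
  map_d _ := rfl

end LInfty

namespace Transgression

variable {g : LInfty} {n : ℕ} (T : Transgression g n) (hn : 0 < n)

/-- The inclusion `CE(𝔤) → CE(𝔤_μ)`. -/
def stringIncl : DGHom g.CE (T.stringExt hn).CE := g.addGenHom n hn _ _ _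

/-- The inclusion `W(𝔤) → W(𝔤_μ)`. -/
def stringInclW : FGC g.inn.deg →ₐ[ℝ] FGC (T.stringExt hn).inn.deg := g.addGenIncl_inn n hn _ _ _

/-- `b^{n-1}𝔲(1) ↪ 𝔤_μ`. -/
def stringSub : NormalSub (LInfty.line n hn) (T.stringExt hn) := g.addGenSub n hn _ _ _

/-- The inclusion `W(𝔤) → CE(cs_P(𝔤))`. -/
def csIncl : FGC g.inn.deg →ₐ[ℝ] FGC (T.csAlg hn).deg :=
  (T.ch.addGenIncl n hn _ _ _).comp T.inclCh

theorem csIncl_gen (i : g.inn.ι) :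
    T.csIncl hn (g.inn.gen i) = (T.csAlg hn).gen (Sum.inl (Sum.inl i)) := by
  have h1 : T.inclCh (g.inn.gen i) = T.ch.gen (Sum.inl i) := FGC.map_gen _ (fun _ => rfl) _
  exact (congrArg _ h1).trans (T.ch.addGenIncl_gen _ _ _ _ _ _)

theorem csIncl_mem {p : ℕ} {x : FGC g.inn.deg} (hx : x ∈ FGC.gr g.inn.deg p) :
    T.csIncl hn x ∈ FGC.gr (T.csAlg hn).deg p :=
  T.ch.addGenIncl_mem _ _ _ _ _ (T.inclCh_mem hx)

theorem csIncl_d (x : FGC g.inn.deg) :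
    (T.csAlg hn).d (T.csIncl hn x) = T.csIncl hn (g.inn.d x) := by
  have h1 : T.ch.d (T.inclCh x) = T.inclCh (g.inn.d x) := g.inn.addGen_d_incl _ _ _ _ _ x
  exact (T.ch.addGen_d_incl n hn _ _ _ (T.inclCh x)).trans (congrArg _ h1)

theorem csAlg_d_c : (T.csAlg hn).d ((T.csAlg hn).gen (Sum.inl (Sum.inr ()))) =
    T.csIncl hn T.P := by
  have h1 : T.ch.d (T.ch.gen (Sum.inr ())) = T.inclCh T.P := g.inn.addGen_d_gen _ _ _ _ _
  have h2 := T.ch.addGen_d_incl n hn _ (T.csAlg_mem) T.csAlg_closed (T.ch.gen (Sum.inr ()))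
  have h3 := T.ch.addGenIncl_gen n hn _ (T.csAlg_mem) T.csAlg_closed (Sum.inr ())
  exact (congrArg _ h3.symm).trans (h2.trans (congrArg _ h1))

theorem csAlg_d_b : (T.csAlg hn).d ((T.csAlg hn).gen (Sum.inr ())) =
    (T.csAlg hn).gen (Sum.inl (Sum.inr ())) - T.csIncl hn T.cs := by
  refine (T.ch.addGen_d_gen n hn _ T.csAlg_mem T.csAlg_closed).trans ?_
  have h3 := T.ch.addGenIncl_gen n hn _ (T.csAlg_mem) T.csAlg_closed (Sum.inr ())
  rw [map_sub]
  exact congrArg (fun y => y - T.csIncl hn T.cs) h3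

/-- The restriction `CE(cs_P(𝔤)) → W(b^{n-1}𝔲(1))`, with `b ↦ h`, `c ↦ σ h` and all generators
of `W(𝔤)` mapped to `0`. -/
def csRes : FGC (T.csAlg hn).deg →ₐ[ℝ] FGC (LInfty.line n hn).inn.deg :=
  FGC.lift (Sum.elim (Sum.elim (fun _ => 0) (fun _ => (LInfty.line n hn).inn.gen (Sum.inr ())))
    (fun _ => (LInfty.line n hn).inn.gen (Sum.inl ()))) (by
    have h0 : ∀ (r : ℝ) (x : FGC (LInfty.line n hn).inn.deg), 0 * x = r • (x * 0) := by simp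
    have h0' : ∀ (r : ℝ) (x : FGC (LInfty.line n hn).inn.deg), x * 0 = r • (0 * x) := by simp
    rintro ((i | _) | _) ((j | _) | _)
    · exact h0 _ _
    · exact h0 _ _
    · exact h0 _ _
    · exact h0' _ _
    · exact FGC.gen_comm (deg := (LInfty.line n hn).inn.deg) (Sum.inr ()) (Sum.inr ())
    · exact FGC.gen_comm (deg := (LInfty.line n hn).inn.deg) (Sum.inr ()) (Sum.inl ())
    · exact h0' _ _
    · exact FGC.gen_comm (deg := (LInfty.line n hn).inn.deg) (Sum.inl ()) (Sum.inr ())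
    · exact FGC.gen_comm (deg := (LInfty.line n hn).inn.deg) (Sum.inl ()) (Sum.inl ()))

theorem csRes_W (i : g.inn.ι) : T.csRes hn ((T.csAlg hn).gen (Sum.inl (Sum.inl i))) = 0 :=
  FGC.lift_gen _ _ _

theorem csRes_c : T.csRes hn ((T.csAlg hn).gen (Sum.inl (Sum.inr ()))) =
    (LInfty.line n hn).inn.gen (Sum.inr ()) := FGC.lift_gen _ _ _

theorem csRes_b : T.csRes hn ((T.csAlg hn).gen (Sum.inr ())) =
    (LInfty.line n hn).inn.gen (Sum.inl ()) := FGC.lift_gen _ _ _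

theorem csRes_incl {p : ℕ} (hp : 0 < p) {x : FGC g.inn.deg} (hx : x ∈ FGC.gr g.inn.deg p) :
    T.csRes hn (T.csIncl hn x) = 0 := by
  refine FGC.algHom_eq_zero ((T.csRes hn).comp (T.csIncl hn)) ?_ hp hx
  intro i
  exact (congrArg _ (T.csIncl_gen hn i)).trans (T.csRes_W hn i)

/-- `inn(b^{n-1}𝔲(1)) ↪ cs_P(𝔤)`. -/
def csSub : NormalSub (LInfty.line n hn).inn (T.csAlg hn) where
  s := Sum.elim (fun _ => Sum.inr ()) (fun _ => Sum.inl (Sum.inr ()))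
  inj := by
    rintro (_ | _) (_ | _) h
    · rfl
    · exact absurd h Sum.inr_ne_inl
    · exact absurd h Sum.inl_ne_inr
    · rfl
  deg_s := by rintro (_ | _) <;> rfl
  res := T.csRes hn
  res_s := by
    rintro (_ | _)
    · exact T.csRes_b hn
    · exact T.csRes_c hn
  res_ker := by
    rintro ((i | _) | _) hi
    · exact T.csRes_W hn i
    · exact absurd ⟨Sum.inr (), rfl⟩ hi
    · exact absurd ⟨Sum.inl (), rfl⟩ hi
  res_d := by
    have h0 : (LInfty.line n hn).d ((LInfty.line n hn).gen ()) = 0 :=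
      LInfty.ofGen_d_gen _ _ _ _ _ _
    rintro ((i | _) | _)
    · have h1 := T.csIncl_d hn (g.inn.gen i)
      rw [T.csIncl_gen] at h1
      have h2 := T.csRes_incl hn (Nat.succ_pos _) (g.inn.d_mem (FGC.gen_mem i))
      refine (congrArg _ h1).trans (h2.trans ?_)
      exact ((congrArg _ (T.csRes_W hn i)).trans (map_zero _)).symm
    · refine (congrArg _ (T.csAlg_d_c hn)).trans
        ((T.csRes_incl hn (Nat.succ_pos _) T.P_mem).trans ?_)
      have h3 := (LInfty.line n hn).inn_d_inr ()
      rw [h0, map_zero, map_zero, neg_zero] at h3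
      exact ((congrArg _ (T.csRes_c hn)).trans h3).symm
    · have h4 := T.csAlg_d_b hn
      have h3 := (LInfty.line n hn).inn_d_inl ()
      rw [h0, map_zero, zero_add] at h3
      refine (congrArg _ h4).trans ?_
      rw [map_sub, T.csRes_incl hn (Nat.succ_pos _) T.cs_mem, sub_zero]
      exact (T.csRes_c hn).trans ((congrArg _ (T.csRes_b hn)).trans h3).symm
  normal := by
    have key : ∀ x, T.csIncl hn x ∈ Algebra.adjoin ℝ ((T.csAlg hn).gen ''
        (Set.range (fun i : g.inn.ι => (Sum.inl (Sum.inl i) : (T.csAlg hn).ι)))) := by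
      intro x
      induction x using FGC.induction_mon with
      | hm l =>
        induction l with
        | nil => simp
        | cons i l ih =>
          rw [FGC.mon_cons, map_mul]
          refine Subalgebra.mul_mem _ (Algebra.subset_adjoin ⟨Sum.inl (Sum.inl i), ⟨i, rfl⟩, ?_⟩) ih
          exact (T.csIncl_gen hn i).symm
      | ha x y h1 h2 => rw [map_add]; exact Subalgebra.add_mem _ h1 h2
      | hs a x h => rw [map_smul]; exact Subalgebra.smul_mem _ h a
    rintro ((i | _) | _) hi
    · have h1 := T.csIncl_d hn (g.inn.gen i)
      rw [T.csIncl_gen] at h1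
      rw [h1]
      refine Algebra.adjoin_mono (Set.image_mono ?_) (key _)
      rintro _ ⟨i, rfl⟩ ⟨_ | _, h⟩
      · exact Sum.inr_ne_inl h
      · exact Sum.inr_ne_inl (Sum.inl_injective h)
    · exact absurd ⟨Sum.inr (), rfl⟩ hi
    · exact absurd ⟨Sum.inl (), rfl⟩ hi

end Transgression

/-! ### Differential forms on `ℝ^k` -/

/-- The Cartesian space `ℝ^k`. -/
abbrev R (k : ℕ) : Type := EuclideanSpace ℝ (Fin k)

/-- The algebra `C^∞(ℝ^k)`. -/
def smooth (k : ℕ) : Subalgebra ℝ (R k → ℝ) where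
  carrier := {f | ContDiff ℝ ∞ f}
  mul_mem' := fun {a b} (hf : ContDiff ℝ ∞ a) (hg : ContDiff ℝ ∞ b) => hf.mul hg
  add_mem' := fun {a b} (hf : ContDiff ℝ ∞ a) (hg : ContDiff ℝ ∞ b) => hf.add hg
  algebraMap_mem' r := (contDiff_const : ContDiff ℝ ∞ (fun _ : R k => r))

theorem contDiff_smooth {k : ℕ} (f : smooth k) : ContDiff ℝ ∞ f.1 := f.2

theorem differentiableAt_smooth {k : ℕ} (f : smooth k) (x : R k) : DifferentiableAt ℝ f.1 x :=
  ((contDiff_smooth f).differentiable (by simp)).differentiableAt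

/-- The partial derivative `∂_i`. -/
def pd {k : ℕ} (i : Fin k) : smooth k →ₗ[ℝ] smooth k where
  toFun f := ⟨fun x => fderiv ℝ f.1 x (EuclideanSpace.single i 1),
    ((contDiff_smooth f).fderiv_right (m := ∞) (by simp)).clm_apply contDiff_const⟩
  map_add' f g := by
    ext x
    have hf : DifferentiableAt ℝ f.1 x := differentiableAt_smooth f _
    have hg : DifferentiableAt ℝ g.1 x := differentiableAt_smooth g _
    simp [fderiv_add hf hg]
  map_smul' a f := by
    ext x
    have hf : DifferentiableAt ℝ f.1 x := differentiableAt_smooth f _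
    simp [fderiv_const_smul hf]

theorem pd_mul {k : ℕ} (i : Fin k) (f g : smooth k) : pd i (f * g) = pd i f * g + f * pd i g := by
  ext x
  have hf : DifferentiableAt ℝ f.1 x := differentiableAt_smooth f _
  have hg : DifferentiableAt ℝ g.1 x := differentiableAt_smooth g _
  simp [pd, fderiv_mul hf hg]
  ring

theorem pd_pd {k : ℕ} (i j : Fin k) (f : smooth k) : pd i (pd j f) = pd j (pd i f) := by
  ext x
  have h : IsSymmSndFDerivAt ℝ f.1 x := (contDiff_smooth f).contDiffAt.isSymmSndFDerivAt
    (by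
      have h2 : ((2 : ℕ∞) : WithTop ℕ∞) ≤ ((⊤ : ℕ∞) : WithTop ℕ∞) := WithTop.coe_le_coe.mpr le_top
      simpa using h2)
  have hd : DifferentiableAt ℝ (fderiv ℝ f.1) x :=
    (((contDiff_smooth f).fderiv_right (m := ∞) (by simp)).differentiable (by simp)).differentiableAt
  have key : ∀ i j : Fin k, (pd i (pd j f)).1 x =
      fderiv ℝ (fderiv ℝ f.1) x (EuclideanSpace.single i 1) (EuclideanSpace.single j 1) := by
    intro i j
    simp only [pd, LinearMap.coe_mk, AddHom.coe_mk]
    rw [fderiv_clm_apply hd (differentiableAt_const _)]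
    simp
  exact (key i j).trans ((h _ _).trans (key j i).symm)

/-- The constant forms `∧•(ℝ^k)*`, on the generators `dx^i` of degree `1`. -/
abbrev constForms (k : ℕ) : Type := FGC (fun _ : Fin k => 1)

/-- The algebra `Ω•(ℝ^k) = C^∞(ℝ^k) ⊗ ∧•(ℝ^k)*` of differential forms. -/
abbrev EForms (k : ℕ) : Type := smooth k ⊗[ℝ] constForms k

instance (k : ℕ) : AddCommGroup (smooth k) := inferInstance
instance (k : ℕ) : Module ℝ (smooth k) := inferInstance
instance (k : ℕ) : Ring (EForms k) := Algebra.TensorProduct.instRing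
instance (k : ℕ) : Algebra ℝ (EForms k) := Algebra.TensorProduct.leftAlgebra
instance (k : ℕ) : AddCommGroup (EForms k) := inferInstance
instance (k : ℕ) : Module ℝ (EForms k) := Algebra.toModule
instance (k : ℕ) : IsScalarTower ℝ (EForms k) (EForms k) := IsScalarTower.right
instance (k : ℕ) : SMulCommClass ℝ (EForms k) (EForms k) := Algebra.to_smulCommClass

namespace EForms

variable {k m : ℕ}

/-- The forms of degree `p`. -/
def gr (k p : ℕ) : Submodule ℝ (EForms k) :=
  Submodule.span ℝ {x | ∃ f, ∃ a ∈ FGC.gr (fun _ : Fin k => 1) p, x = f ⊗ₜ[ℝ] a}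

/-- The differential `dx^i ∧ -`. -/
def d (k : ℕ) : EForms k →ₗ[ℝ] EForms k :=
  ∑ i : Fin k, TensorProduct.map (pd i) (LinearMap.mulLeft ℝ (FGC.gen (fun _ : Fin k => 1) i))

theorem d_tmul (f : smooth k) (a : constForms k) :
    d k (f ⊗ₜ a) = ∑ i : Fin k, (pd i f) ⊗ₜ (FGC.gen (fun _ : Fin k => 1) i * a) := by
  simp [d, LinearMap.sum_apply]

theorem one_mem : (1 : EForms k) ∈ gr k 0 :=
  Submodule.subset_span ⟨1, 1, FGC.one_mem, rfl⟩

theorem mul_mem {p q : ℕ} {x y : EForms k} (hx : x ∈ gr k p) (hy : y ∈ gr k q) :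
    x * y ∈ gr k (p + q) := by
  induction hx using Submodule.span_induction with
  | mem x hx =>
    obtain ⟨f, a, ha, rfl⟩ := hx
    induction hy using Submodule.span_induction with
    | mem y hy =>
      obtain ⟨g, b, hb, rfl⟩ := hy
      rw [Algebra.TensorProduct.tmul_mul_tmul]
      exact Submodule.subset_span ⟨_, _, FGC.mul_mem ha hb, rfl⟩
    | zero => simp
    | add y z _ _ h1 h2 => rw [mul_add]; exact Submodule.add_mem _ h1 h2
    | smul a y _ h => rw [mul_smul_comm]; exact Submodule.smul_mem _ _ h
  | zero => simp
  | add y z _ _ h1 h2 => rw [add_mul]; exact Submodule.add_mem _ h1 h2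
  | smul a y _ h => rw [smul_mul_assoc]; exact Submodule.smul_mem _ _ h

theorem comm {p q : ℕ} {x y : EForms k} (hx : x ∈ gr k p) (hy : y ∈ gr k q) :
    x * y = (-1 : ℝ) ^ (p * q) • (y * x) := by
  induction hx using Submodule.span_induction with
  | mem x hx =>
    obtain ⟨f, a, ha, rfl⟩ := hx
    induction hy using Submodule.span_induction with
    | mem y hy =>
      obtain ⟨g, b, hb, rfl⟩ := hy
      rw [Algebra.TensorProduct.tmul_mul_tmul, Algebra.TensorProduct.tmul_mul_tmul,
        FGC.comm ha hb, mul_comm f g, TensorProduct.tmul_smul]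
    | zero => simp
    | add y z _ _ h1 h2 => rw [mul_add, add_mul, smul_add, h1, h2]
    | smul a y _ h => rw [mul_smul_comm, smul_mul_assoc, h, smul_comm]
  | zero => simp
  | add y z _ _ h1 h2 => rw [mul_add, add_mul, smul_add, h1, h2]
  | smul a y _ h => rw [mul_smul_comm, smul_mul_assoc, h, smul_comm]

theorem d_mem {p : ℕ} {x : EForms k} (hx : x ∈ gr k p) : d k x ∈ gr k (p + 1) := by
  induction hx using Submodule.span_induction with
  | mem x hx =>
    obtain ⟨f, a, ha, rfl⟩ := hx
    rw [d_tmul]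
    refine Submodule.sum_mem _ fun i _ => Submodule.subset_span ⟨_, _, ?_, rfl⟩
    rw [add_comm]
    exact FGC.mul_mem (FGC.gen_mem (deg := fun _ : Fin k => 1) i) ha
  | zero => simp
  | add y z _ _ h1 h2 => rw [map_add]; exact Submodule.add_mem _ h1 h2
  | smul a y _ h => rw [map_smul]; exact Submodule.smul_mem _ _ h

theorem leibniz {p : ℕ} {x : EForms k} (hx : x ∈ gr k p) (y : EForms k) :
    d k (x * y) = d k x * y + (-1 : ℝ) ^ p • (x * d k y) := by
  induction hx using Submodule.span_induction with
  | mem x hx =>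
    obtain ⟨f, a, ha, rfl⟩ := hx
    induction y using TensorProduct.induction_on with
    | zero => simp
    | add y z h1 h2 => rw [mul_add, map_add, map_add, mul_add, mul_add, h1, h2, smul_add]; abel
    | tmul g b =>
      rw [Algebra.TensorProduct.tmul_mul_tmul, d_tmul, d_tmul, d_tmul, Finset.sum_mul,
        Finset.mul_sum, Finset.smul_sum, ← Finset.sum_add_distrib]
      refine Finset.sum_congr rfl fun i _ => ?_
      have h : FGC.gen (fun _ : Fin k => 1) i * a = (-1 : ℝ) ^ (1 * p) •
          (a * FGC.gen (fun _ : Fin k => 1) i) := FGC.comm (FGC.gen_mem i) ha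
      rw [Algebra.TensorProduct.tmul_mul_tmul, Algebra.TensorProduct.tmul_mul_tmul, pd_mul,
        TensorProduct.add_tmul, ← mul_assoc, ← mul_assoc, h, smul_mul_assoc, one_mul,
        TensorProduct.tmul_smul, TensorProduct.tmul_smul]
  | zero => simp
  | add x z _ _ h1 h2 => simp only [add_mul, map_add, smul_add, h1, h2]; abel
  | smul a x _ h => simp only [smul_mul_assoc, map_smul, h, smul_add, smul_comm a]

theorem d_d (x : EForms k) : d k (d k x) = 0 := by
  induction x using TensorProduct.induction_on with
  | zero => simp
  | add y z h1 h2 => rw [map_add, map_add, h1, h2, add_zero]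
  | tmul f a =>
    rw [d_tmul, map_sum]
    simp only [d_tmul]
    set S := ∑ i : Fin k, ∑ j : Fin k, (pd j (pd i f)) ⊗ₜ[ℝ]
      (FGC.gen (fun _ : Fin k => 1) j * (FGC.gen (fun _ : Fin k => 1) i * a)) with hS
    have h : S = -S := by
      conv_lhs => rw [hS, Finset.sum_comm]
      rw [hS, ← Finset.sum_neg_distrib]
      refine Finset.sum_congr rfl fun i _ => ?_
      rw [← Finset.sum_neg_distrib]
      refine Finset.sum_congr rfl fun j _ => ?_
      rw [pd_pd, ← mul_assoc, FGC.gen_comm, ← mul_assoc, ← TensorProduct.tmul_neg]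
      simp
    have h2 : (2 : ℝ) • S = 0 := by
      rw [two_smul]
      nth_rewrite 1 [h]
      simp
    exact (smul_eq_zero.mp h2).resolve_left two_ne_zero

/-- A smooth function as a form. -/
def fn (k : ℕ) : smooth k →ₐ[ℝ] EForms k := Algebra.TensorProduct.includeLeft

theorem fn_mem (f : smooth k) : fn k f ∈ gr k 0 :=
  Submodule.subset_span ⟨f, 1, FGC.one_mem, rfl⟩

theorem fn_comm (f : smooth k) (x : EForms k) : fn k f * x = x * fn k f := by
  induction x using TensorProduct.induction_on with
  | zero => simp
  | add y z h1 h2 => rw [mul_add, add_mul, h1, h2]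
  | tmul g a => simp [fn, Algebra.TensorProduct.tmul_mul_tmul, mul_comm]

/-- Smooth maps `ℝ^k → ℝ^m`. -/
def SMap (k m : ℕ) : Type := {φ : R k → R m // ContDiff ℝ ∞ φ}

/-- Composition of functions with a smooth map. -/
def pullFn (φ : SMap k m) : smooth m →ₐ[ℝ] smooth k where
  toFun f := ⟨f.1 ∘ φ.1, (contDiff_smooth f).comp φ.2⟩
  map_one' := rfl
  map_mul' _ _ := rfl
  map_zero' := rfl
  map_add' _ _ := rfl
  commutes' _ := rfl

/-- The components of a smooth map. -/
def coord (φ : SMap k m) (j : Fin m) : smooth k :=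
  ⟨fun x => φ.1 x j, (contDiff_piLp_apply (p := 2)).comp φ.2⟩

/-- The pullback of differential forms: `f ↦ f ∘ φ` on functions and `dx^j ↦ dφ^j`. -/
def pull (φ : SMap k m) : EForms m →ₐ[ℝ] EForms k :=
  Algebra.TensorProduct.lift ((fn k).comp (pullFn φ))
    (FGC.lift (fun j => d k (fn k (coord φ j)))
      (fun i j => comm (d_mem (fn_mem (coord φ i))) (d_mem (fn_mem (coord φ j)))))
    (fun _ _ => show Commute _ _ from fn_comm _ _)

theorem pull_fn (φ : SMap k m) (f : smooth m) : pull φ (fn m f) = fn k (pullFn φ f) := by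
  simp [pull, fn]

theorem pull_dx (φ : SMap k m) (j : Fin m) :
    pull φ (1 ⊗ₜ FGC.gen (fun _ : Fin m => 1) j) = d k (fn k (coord φ j)) := by
  refine (Algebra.TensorProduct.lift_tmul _ _ _ _ _).trans ?_
  rw [map_one, one_mul, FGC.lift_gen]

theorem tmul_eq (f : smooth k) (a : constForms k) : f ⊗ₜ a = fn k f * (1 ⊗ₜ[ℝ] a) := by
  simp [fn, Algebra.TensorProduct.tmul_mul_tmul]

theorem pull_const_mem (φ : SMap k m) {p : ℕ} {a : constForms m}
    (ha : a ∈ FGC.gr (fun _ : Fin m => 1) p) : pull φ (1 ⊗ₜ a) ∈ gr k p := by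
  induction ha using Submodule.span_induction with
  | mem x hx =>
    obtain ⟨l, rfl, rfl⟩ := hx
    induction l with
    | nil =>
      rw [FGC.mon_nil, ← Algebra.TensorProduct.one_def, map_one]
      exact one_mem
    | cons i l ih =>
      have h : (1 : smooth m) ⊗ₜ[ℝ] FGC.mon (fun _ : Fin m => 1) (i :: l) =
          (1 ⊗ₜ FGC.gen (fun _ : Fin m => 1) i) * (1 ⊗ₜ FGC.mon (fun _ : Fin m => 1) l) := by
        simp [Algebra.TensorProduct.tmul_mul_tmul]
      rw [h, map_mul, pull_dx, List.map_cons, List.sum_cons]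
      exact mul_mem (by simpa using d_mem (fn_mem (coord φ i))) ih
  | zero => simp
  | add y z _ _ h1 h2 => rw [TensorProduct.tmul_add, map_add]; exact Submodule.add_mem _ h1 h2
  | smul a y _ h => rw [TensorProduct.tmul_smul, map_smul]; exact Submodule.smul_mem _ _ h

theorem pull_mem (φ : SMap k m) {p : ℕ} {x : EForms m} (hx : x ∈ gr m p) :
    pull φ x ∈ gr k p := by
  induction hx using Submodule.span_induction with
  | mem x hx =>
    obtain ⟨f, a, ha, rfl⟩ := hx
    rw [tmul_eq, map_mul, pull_fn, ← zero_add p]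
    exact mul_mem (fn_mem _) (pull_const_mem φ ha)
  | zero => simp
  | add y z _ _ h1 h2 => rw [map_add]; exact Submodule.add_mem _ h1 h2
  | smul a y _ h => rw [map_smul]; exact Submodule.smul_mem _ _ h

theorem pd_pullFn (φ : SMap k m) (f : smooth m) (i : Fin k) :
    pd i (pullFn φ f) = ∑ j : Fin m, pullFn φ (pd j f) * pd i (coord φ j) := by
  ext x
  have hφ : DifferentiableAt ℝ φ.1 x := (φ.2.differentiable (by simp)).differentiableAt
  have hf : DifferentiableAt ℝ f.1 (φ.1 x) := differentiableAt_smooth f _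
  have h1 : (pd i (pullFn φ f)).1 x =
      fderiv ℝ f.1 (φ.1 x) (fderiv ℝ φ.1 x (EuclideanSpace.single i 1)) := by
    have h0 : fderiv ℝ (f.1 ∘ φ.1) x = (fderiv ℝ f.1 (φ.1 x)).comp (fderiv ℝ φ.1 x) :=
      fderiv_comp x hf hφ
    exact congrArg (fun L => L (EuclideanSpace.single i 1)) h0
  have h2 : ∀ j, (pd i (coord φ j)).1 x = (fderiv ℝ φ.1 x (EuclideanSpace.single i 1)) j := by
    intro j
    have : HasFDerivAt (fun y => φ.1 y j)
        ((EuclideanSpace.proj j : R m →L[ℝ] ℝ).comp (fderiv ℝ φ.1 x)) x :=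
      (EuclideanSpace.proj j : R m →L[ℝ] ℝ).hasFDerivAt.comp x hφ.hasFDerivAt
    simp only [pd, coord, LinearMap.coe_mk, AddHom.coe_mk]
    rw [this.fderiv]
    rfl
  set v := fderiv ℝ φ.1 x (EuclideanSpace.single i 1) with hv
  have h3 : v = ∑ j : Fin m, v j • EuclideanSpace.single j (1 : ℝ) := by
    ext j
    simp [Finset.sum_apply, Pi.single_apply]
  have h4 : (∑ j : Fin m, pullFn φ (pd j f) * pd i (coord φ j)).1 x =
      ∑ j : Fin m, (fderiv ℝ f.1 (φ.1 x) (EuclideanSpace.single j 1)) * v j := by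
    rw [AddSubmonoidClass.coe_finsetSum, Finset.sum_apply]
    refine Finset.sum_congr rfl fun j _ => ?_
    exact congrArg _ (h2 j)
  refine h1.trans (Eq.trans ?_ h4.symm)
  conv_lhs => rw [h3, map_sum]
  refine Finset.sum_congr rfl fun j _ => ?_
  rw [map_smul, smul_eq_mul, mul_comm]

theorem d_fn (f : smooth k) :
    d k (fn k f) = ∑ i : Fin k, (pd i f) ⊗ₜ FGC.gen (fun _ : Fin k => 1) i := by
  simp [fn, d_tmul]

theorem pull_d_fn (φ : SMap k m) (f : smooth m) :
    pull φ (d m (fn m f)) = d k (pull φ (fn m f)) := by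
  rw [pull_fn, d_fn, d_fn, map_sum]
  have h1 : ∀ j : Fin m, pull φ ((pd j f) ⊗ₜ FGC.gen (fun _ : Fin m => 1) j) =
      ∑ i : Fin k, (pullFn φ (pd j f) * pd i (coord φ j)) ⊗ₜ[ℝ] FGC.gen (fun _ : Fin k => 1) i := by
    intro j
    rw [tmul_eq, map_mul, pull_fn, pull_dx, d_fn, Finset.mul_sum]
    refine Finset.sum_congr rfl fun i _ => ?_
    simp [fn, Algebra.TensorProduct.tmul_mul_tmul]
  simp only [h1, pd_pullFn, TensorProduct.sum_tmul]
  exact Finset.sum_comm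

theorem d_const (a : constForms k) : d k (1 ⊗ₜ a) = 0 := by
  rw [d_tmul]
  refine Finset.sum_eq_zero fun i _ => ?_
  have : pd i (1 : smooth k) = 0 := by
    have := pd_mul i (1 : smooth k) 1
    simpa using this
  rw [this, TensorProduct.zero_tmul]

theorem d_pull_const (φ : SMap k m) (a : constForms m) : d k (pull φ (1 ⊗ₜ a)) = 0 := by
  induction a using FGC.induction_mon with
  | hm l =>
    induction l with
    | nil =>
      rw [FGC.mon_nil, ← Algebra.TensorProduct.one_def, map_one]
      exact d_const 1
    | cons i l ih =>
      have h : (1 : smooth m) ⊗ₜ[ℝ] FGC.mon (fun _ : Fin m => 1) (i :: l) =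
          (1 ⊗ₜ FGC.gen (fun _ : Fin m => 1) i) * (1 ⊗ₜ FGC.mon (fun _ : Fin m => 1) l) := by
        simp [Algebra.TensorProduct.tmul_mul_tmul]
      rw [h, map_mul, pull_dx, leibniz (d_mem (fn_mem (coord φ i))), ih, d_d, zero_mul, mul_zero,
        smul_zero, add_zero]
  | ha x y h1 h2 => rw [TensorProduct.tmul_add, map_add, map_add, h1, h2, add_zero]
  | hs a x h => rw [TensorProduct.tmul_smul, map_smul, map_smul, h, smul_zero]

theorem pull_d (φ : SMap k m) (x : EForms m) : pull φ (d m x) = d k (pull φ x) := by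
  induction x using TensorProduct.induction_on with
  | zero => simp
  | add y z h1 h2 => rw [map_add, map_add, h1, h2, map_add, map_add]
  | tmul f a =>
    have h := fn_mem (pullFn φ f)
    rw [tmul_eq, leibniz (fn_mem f), d_const, map_mul, pull_fn, leibniz h, d_pull_const,
      mul_zero, smul_zero, add_zero, mul_zero, smul_zero, add_zero, map_mul, pull_d_fn, pull_fn]

end EForms

/-! ### Subalgebras and images -/

namespace DGCA

/-- A subalgebra closed under the differential, with the induced grading. -/
def sub (A : DGCA.{u}) (B : Subalgebra ℝ A.carrier) (hB : ∀ x ∈ B, A.d x ∈ B) : DGCA.{u} where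
  carrier := B
  gr p := (A.gr p).comap B.val.toLinearMap
  d := A.d.restrict (p := Subalgebra.toSubmodule B) (q := Subalgebra.toSubmodule B) hB
  one_mem := A.one_mem
  mul_mem := fun hx hy => A.mul_mem hx hy
  comm := fun hx hy => Subtype.ext (A.comm hx hy)
  d_mem := fun hx => A.d_mem hx
  leibniz := fun hx y => Subtype.ext (A.leibniz hx y)
  d_d x := Subtype.ext (A.d_d x)

/-- The image of a morphism, the elements of degree `p` being the images of elements of
degree `p`. -/
def image {A : DGCA.{u}} {B : DGCA.{v}} (f : DGHom A B) : DGCA.{v} where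
  carrier := f.toAlgHom.range
  gr p := (A.gr p).map f.toAlgHom.rangeRestrict.toLinearMap
  d := B.d.restrict (p := Subalgebra.toSubmodule f.toAlgHom.range)
    (q := Subalgebra.toSubmodule f.toAlgHom.range)
    (by rintro _ ⟨x, rfl⟩; exact ⟨A.d x, f.map_d x⟩)
  one_mem := ⟨1, A.one_mem, map_one f.toAlgHom.rangeRestrict⟩
  mul_mem := by
    rintro p q _ _ ⟨x, hx, rfl⟩ ⟨y, hy, rfl⟩
    exact ⟨x * y, A.mul_mem hx hy, map_mul f.toAlgHom.rangeRestrict x y⟩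
  comm := by
    rintro p q _ _ ⟨x, hx, rfl⟩ ⟨y, hy, rfl⟩
    exact Subtype.ext (B.comm (f.map_gr p x hx) (f.map_gr q y hy))
  d_mem := by
    rintro p _ ⟨x, hx, rfl⟩
    exact ⟨A.d x, A.d_mem hx, Subtype.ext (f.map_d x)⟩
  leibniz := by
    rintro p _ ⟨x, hx, rfl⟩ y
    exact Subtype.ext (B.leibniz (f.map_gr p x hx) y.1)
  d_d x := Subtype.ext (B.d_d x)

/-- The surjection onto the image. -/
def toImage {A : DGCA.{u}} {B : DGCA.{v}} (f : DGHom A B) : DGHom A (image f) where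
  toAlgHom := f.toAlgHom.rangeRestrict
  map_gr _ x hx := ⟨x, hx, rfl⟩
  map_d x := Subtype.ext (f.map_d x)

/-- Families of differential forms on Cartesian spaces. -/
def families {S : Type u} (κ : S → ℕ) : DGCA.{u} where
  carrier := ∀ s, EForms (κ s)
  gr p := Submodule.pi Set.univ (fun s => EForms.gr (κ s) p)
  d := LinearMap.pi (fun s => EForms.d (κ s) ∘ₗ LinearMap.proj s)
  one_mem := fun _ _ => EForms.one_mem
  mul_mem := fun hx hy s hs => EForms.mul_mem (hx s hs) (hy s hs)
  comm := fun hx hy => funext fun s => EForms.comm (hx s trivial) (hy s trivial)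
  d_mem := fun hx s hs => EForms.d_mem (hx s hs)
  leibniz := fun hx y => funext fun s => EForms.leibniz (hx s trivial) (y s)
  d_d x := funext fun s => EForms.d_d (x s)

end DGCA

/-! ### Differential forms on manifolds -/

section Forms

variable {E : Type*} [NormedAddCommGroup E] [NormedSpace ℝ E] {H : Type*} [TopologicalSpace H]
  (I : ModelWithCorners ℝ E H)
  (Y : Type u) [TopologicalSpace Y] [ChartedSpace H Y]

/-- The plots of `Y`: smooth maps `ℝ^k → Y`, for all `k`. -/
structure Plot where
  dim : ℕ
  map : R dim → Y
  smooth : ContMDiff 𝓘(ℝ, R dim) I ∞ map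

variable {I Y}

/-- Precomposition of a plot with a smooth map of Cartesian spaces. -/
def Plot.comp (s : Plot I Y) {m : ℕ} (ψ : EForms.SMap m s.dim) : Plot I Y where
  dim := m
  map := s.map ∘ ψ.1
  smooth := s.smooth.comp ψ.2.contMDiff

variable (I Y)

/-- The de Rham algebra `Ω•(Y)`: a differential form on `Y` is a family of differential forms, one
on the domain of each plot, which is compatible with pullback along smooth maps of the domains.
For a manifold this is the same as a differential form given in charts. -/
def Omega : DGCA.{u} :=
  (DGCA.families (fun s : Plot I Y => s.dim)).sub
    { carrier := {θ | ∀ (s : Plot I Y) (m : ℕ) (ψ : EForms.SMap m s.dim),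
        θ (s.comp ψ) = EForms.pull ψ (θ s)}
      mul_mem' := fun ha hb s m ψ =>
        (congrArg₂ (fun x y : EForms m => x * y) (ha s m ψ) (hb s m ψ)).trans
          (map_mul (EForms.pull ψ) _ _).symm
      add_mem' := fun ha hb s m ψ =>
        (congrArg₂ (fun x y : EForms m => x + y) (ha s m ψ) (hb s m ψ)).trans
          (map_add (EForms.pull ψ) _ _).symm
      algebraMap_mem' := fun r _ _ ψ => ((EForms.pull ψ).commutes r).symm }
    (fun θ hθ s m ψ => (congrArg (EForms.d m) (hθ s m ψ)).trans (EForms.pull_d ψ (θ s)).symm)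

variable {I Y}

variable {E' : Type*} [NormedAddCommGroup E'] [NormedSpace ℝ E'] {H' : Type*} [TopologicalSpace H']
  {J : ModelWithCorners ℝ E' H'} {X : Type v} [TopologicalSpace X] [ChartedSpace H' X]

/-- Postcomposition of a plot with a smooth map of manifolds. -/
def Plot.push (π : Y → X) (hπ : ContMDiff I J ∞ π) (s : Plot I Y) : Plot J X where
  dim := s.dim
  map := π ∘ s.map
  smooth := hπ.comp s.smooth

/-- The pullback `π* : Ω•(X) → Ω•(Y)`. -/
def pullback (π : Y → X) (hπ : ContMDiff I J ∞ π) : DGHom (Omega J X) (Omega I Y) where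
  toFun θ := ⟨fun s => θ.1 (s.push π hπ), fun s m ψ => θ.2 (s.push π hπ) m ψ⟩
  map_one' := rfl
  map_mul' _ _ := rfl
  map_zero' := rfl
  map_add' _ _ := rfl
  commutes' _ := rfl
  map_gr _ _ hθ := fun s _ => hθ (s.push π hπ) trivial
  map_d _ := rfl

variable (I)

/-- The vertical plots: those with image in a single fibre of `π`. -/
def VPlot (π : Y → X) : Type u := {s : Plot I Y // ∀ x y, π (s.map x) = π (s.map y)}

/-- The restriction of differential forms to vertical plots. -/
def restrictVert (π : Y → X) :
    DGHom (Omega I Y) (DGCA.families (fun s : VPlot I π => s.1.dim)) where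
  toFun θ := fun s => θ.1 s.1
  map_one' := rfl
  map_mul' _ _ := rfl
  map_zero' := rfl
  map_add' _ _ := rfl
  commutes' _ := rfl
  map_gr _ _ hθ := fun s _ => hθ s.1 trivial
  map_d _ := rfl

/-- The vertical forms `Ω•_vert(Y)` of a surjective submersion `π : Y → X`: the quotient of `Ω•(Y)`
by the forms which vanish on vertical vectors. As the vertical vectors are the tangent vectors to
the fibres, this is the image of `Ω•(Y)` under restriction to the plots of the fibres. -/
def OmegaVert (π : Y → X) : DGCA.{u} := DGCA.image (restrictVert I π)

/-- The projection `Ω•(Y) → Ω•_vert(Y)`. -/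
def toVert (π : Y → X) : DGHom (Omega I Y) (OmegaVert I π) := DGCA.toImage (restrictVert I π)

end Forms

/-! ### Forms on the interval, concordance and homotopy -/

/-- The algebra `C^∞([0,1])`. -/
def smoothI : Subalgebra ℝ (Set.Icc (0 : ℝ) 1 → ℝ) where
  carrier := {f | ∃ F : ℝ → ℝ, ContDiff ℝ ∞ F ∧ ∀ t, f t = F t}
  mul_mem' := by
    rintro f g ⟨F, hF, h1⟩ ⟨G, hG, h2⟩
    exact ⟨fun t => F t * G t, hF.mul hG, fun t => congrArg₂ (· * ·) (h1 t) (h2 t)⟩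
  add_mem' := by
    rintro f g ⟨F, hF, h1⟩ ⟨G, hG, h2⟩
    exact ⟨fun t => F t + G t, hF.add hG, fun t => congrArg₂ (· + ·) (h1 t) (h2 t)⟩
  algebraMap_mem' r := ⟨fun _ => r, contDiff_const, fun _ => rfl⟩

theorem derivWithin_smoothI {f : Set.Icc (0 : ℝ) 1 → ℝ} {F : ℝ → ℝ} (hF : ContDiff ℝ ∞ F)
    (h : ∀ t, f t = F t) (t : Set.Icc (0 : ℝ) 1) :
    derivWithin (Set.IccExtend zero_le_one f) (Set.Icc 0 1) t = deriv F t := by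
  have h1 : Set.EqOn (Set.IccExtend zero_le_one f) F (Set.Icc 0 1) := by
    intro s hs
    rw [Set.IccExtend_of_mem _ _ hs, h]
  rw [derivWithin_congr h1 (h1 t.2)]
  exact ((hF.differentiable (by simp)) t).derivWithin ((uniqueDiffOn_Icc zero_lt_one) t t.2)

/-- The derivative of smooth functions on `[0,1]`. -/
def dI : smoothI →ₗ[ℝ] smoothI where
  toFun f := ⟨fun t => derivWithin (Set.IccExtend zero_le_one f.1) (Set.Icc 0 1) t, by
    obtain ⟨f, F, hF, h⟩ := f
    refine ⟨deriv F, ?_, derivWithin_smoothI hF h⟩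
    exact ((contDiff_infty_iff_deriv).mp hF).2⟩
  map_add' := by
    rintro ⟨f, F, hF, h1⟩ ⟨g, G, hG, h2⟩
    ext t
    have h3 := derivWithin_smoothI (f := f + g) (hF.add hG)
      (fun t => congrArg₂ (· + ·) (h1 t) (h2 t)) t
    have h4 := derivWithin_smoothI hF h1 t
    have h5 := derivWithin_smoothI hG h2 t
    have h6 := deriv_add ((hF.differentiable (by simp)) t) ((hG.differentiable (by simp)) t)
    exact h3.trans (h6.trans (congrArg₂ (· + ·) h4.symm h5.symm))
  map_smul' := by
    rintro a ⟨f, F, hF, h1⟩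
    ext t
    have h3 := derivWithin_smoothI (f := a • f) (F := fun t => a * F t) (contDiff_const.mul hF)
      (fun t => congrArg (a * ·) (h1 t)) t
    have h4 := derivWithin_smoothI hF h1 t
    have h6 := deriv_const_mul a ((hF.differentiable (by simp)) t)
    exact h3.trans (h6.trans (congrArg (a * ·) h4.symm))

/-- The evaluation of smooth functions on `[0,1]` at a point. -/
def evI (t : Set.Icc (0 : ℝ) 1) : smoothI →ₐ[ℝ] ℝ := (Pi.evalAlgHom ℝ _ t).comp smoothI.val

/-- The restriction `B ⊗ C^∞([0,1]) → B` to a point of the interval. -/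
def restrictI (B : DGCA.{v}) (t : Set.Icc (0 : ℝ) 1) : B.carrier ⊗[ℝ] smoothI →ₐ[ℝ] B.carrier :=
  Algebra.TensorProduct.lift (AlgHom.id ℝ B.carrier) ((Algebra.ofId ℝ B.carrier).comp (evI t))
    (fun x f => (Algebra.commutes (evI t f) x).symm)

/-- The elements of degree `p` of `B ⊗ C^∞([0,1])`. -/
def grI (B : DGCA.{v}) (p : ℕ) : Submodule ℝ (B.carrier ⊗[ℝ] smoothI) :=
  Submodule.span ℝ {x | ∃ b ∈ B.gr p, ∃ f, x = b ⊗ₜ[ℝ] f}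

/-- A concordance between morphisms `φ, ψ : A → B`: a morphism `η : A → B ⊗ Ω•([0,1])` which
restricts to `φ` at `0` and to `ψ` at `1`. It is written in components as `η = α + dt ∧ ρ` with
values of `α` and `ρ` in `B ⊗ C^∞([0,1])`; the conditions below say that `η` preserves degrees,
products and differentials. -/
structure Concordance {A : DGCA.{u}} {B : DGCA.{v}} (φ ψ : DGHom A B) where
  α : A.carrier →ₐ[ℝ] B.carrier ⊗[ℝ] smoothI
  ρ : A.carrier →ₗ[ℝ] B.carrier ⊗[ℝ] smoothI
  α_mem : ∀ (p : ℕ) (x : A.carrier), x ∈ A.gr p → α x ∈ grI B p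
  ρ_mem : ∀ (p : ℕ) (x : A.carrier), x ∈ A.gr (p + 1) → ρ x ∈ grI B p
  ρ_zero : ∀ x ∈ A.gr 0, ρ x = 0
  ρ_mul : ∀ (p : ℕ) (x y : A.carrier), x ∈ A.gr p →
    ρ (x * y) = ρ x * α y + (-1 : ℝ) ^ p • (α x * ρ y)
  α_d : ∀ x, α (A.d x) = TensorProduct.map B.d LinearMap.id (α x)
  ρ_d : ∀ x, TensorProduct.map LinearMap.id dI (α x) =
    TensorProduct.map B.d LinearMap.id (ρ x) + ρ (A.d x)
  at_zero : ∀ x, restrictI B 0 (α x) = φ x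
  at_one : ∀ x, restrictI B 1 (α x) = ψ x

/-- Two morphisms are concordant. -/
def Concordant {A : DGCA.{u}} {B : DGCA.{v}} (φ ψ : DGHom A B) : Prop :=
  Nonempty (Concordance φ ψ)

/-- Two morphisms are cochain homotopic. -/
def CochainHomotopic {A : DGCA.{u}} {B : DGCA.{v}} (φ ψ : DGHom A B) : Prop :=
  ∃ τ : A.carrier →ₗ[ℝ] B.carrier, (∀ x ∈ A.gr 0, τ x = 0) ∧
    (∀ (p : ℕ) (x : A.carrier), x ∈ A.gr (p + 1) → τ x ∈ B.gr p) ∧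
    ∀ x, ψ x - φ x = B.d (τ x) + τ (A.d x)

/-- `ψ` is a weak inverse of `φ`: both composites are equivalent to the identity, through
concordances which induce cochain homotopies. -/
structure IsWeakInverse {A : DGCA.{u}} {B : DGCA.{v}} (φ : DGHom A B) (ψ : DGHom B A) : Prop where
  left : Concordant (ψ.comp φ) (DGHom.id A)
  right : Concordant (φ.comp ψ) (DGHom.id B)
  left_homotopic : CochainHomotopic (ψ.comp φ) (DGHom.id A)
  right_homotopic : CochainHomotopic (φ.comp ψ) (DGHom.id B)

/-- A morphism out of `CE(𝔤)` is trivial if it is concordant to one vanishing on all generators. -/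
def IsTrivial {g : LInfty} {B : DGCA.{v}} (φ : DGHom g.CE B) : Prop :=
  ∃ φ₀ : DGHom g.CE B, (∀ i, φ₀ (g.gen i) = 0) ∧ Concordant φ₀ φ

/-! ### Descent objects -/

section Descent

variable {E : Type*} [NormedAddCommGroup E] [NormedSpace ℝ E] {H : Type*} [TopologicalSpace H]
  (I : ModelWithCorners ℝ E H) {Y : Type u} [TopologicalSpace Y] [ChartedSpace H Y]
  {E' : Type*} [NormedAddCommGroup E'] [NormedSpace ℝ E'] {H' : Type*} [TopologicalSpace H']
  (J : ModelWithCorners ℝ E' H') {X : Type v} [TopologicalSpace X] [ChartedSpace H' X]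

/-- A `𝔤`-descent object on `X`, relative to `π : Y → X`: a flat vertical `𝔤`-valued form. -/
abbrev Descent (g : LInfty) (π : Y → X) : Type _ := DGHom g.CE (OmegaVert I π)

/-- A `𝔤`-connection descent object on `X`, relative to `π : Y → X`: a commuting diagram with the
horizontal morphisms `Avert`, `A` and `K`
```
  CE(𝔤)   →  Ω_vert(Y)
    ↑           ↑
  W(𝔤)    →   Ω(Y)
    ↑           ↑
  inv(𝔤)  →   Ω(X)
```
-/
structure ConnDescent (g : LInfty) (π : Y → X) (hπ : ContMDiff I J ∞ π) where
  Avert : Descent I g π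
  A : DGHom g.W (Omega I Y)
  K : DGHom g.inv (Omega J X)
  top : ∀ x, toVert I π (A x) = Avert (g.toCEHom x)
  bot : ∀ P, A (g.invHom P) = pullback π hπ (K P)

end Descent


/-! ### The mapping cones and their generators -/

theorem LInfty.line_curv_inv (k : ℕ) (hk : 0 < k) :
    (line k hk).inn.gen (Sum.inr ()) ∈ (line k hk).invSubalgebra := by
  intro i
  refine ⟨FGC.deriv_gen _ _ _ _, ?_⟩
  have h0 : (line k hk).d ((line k hk).gen ()) = 0 := ofGen_d_gen _ _ _ _ _ _
  have h := (line k hk).inn_d_inr ()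
  rw [h0, map_zero, map_zero, neg_zero] at h
  refine (congrArg _ h).trans (map_zero _)

/-- The generator of `inv(b^{k-1}𝔲(1))`: the shifted generator of `W(b^{k-1}𝔲(1))`. -/
def LInfty.lineCurv (k : ℕ) (hk : 0 < k) : (line k hk).inv.carrier :=
  ⟨(line k hk).inn.gen (Sum.inr ()), line_curv_inv k hk⟩

theorem LInfty.d_lineCurv (k : ℕ) (hk : 0 < k) : (line k hk).inv.d (lineCurv k hk) = 0 := by
  have h0 : (line k hk).d ((line k hk).gen ()) = 0 := ofGen_d_gen _ _ _ _ _ _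
  have h := (line k hk).inn_d_inr ()
  rw [h0, map_zero, map_zero, neg_zero] at h
  exact Subtype.ext h

namespace Transgression

variable {g : LInfty} {n : ℕ} (T : Transgression g n) (hn : 0 < n)

/-- The transgressed invariant polynomial, as an element of `inv(𝔤)`. -/
def Pinv : g.inv.carrier := ⟨T.P, T.P_inv⟩

theorem d_Pinv : g.inv.d T.Pinv = 0 := Subtype.ext T.d_P

/-- The mapping cone `(b^{n-1}𝔲(1) ↪ 𝔤_μ)`. -/
def coneCE : LInfty := (T.stringSub hn).cone

/-- The generators of the mapping cone in `𝔤*`. -/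
def coneCE_g (i : g.ι) : FGC (T.coneCE hn).deg := (T.coneCE hn).gen (Sum.inl (Sum.inl i))

/-- The generator `b` of the mapping cone. -/
def coneCE_b : FGC (T.coneCE hn).deg := (T.coneCE hn).gen (Sum.inl (Sum.inr ()))

/-- The generator `σ b` of the mapping cone. -/
def coneCE_σb : FGC (T.coneCE hn).deg := (T.coneCE hn).gen (Sum.inr ())

/-- The mapping cone `(inn(b^{n-1}𝔲(1)) ↪ cs_P(𝔤))`. -/
def coneW : LInfty := (T.csSub hn).cone

/-- The generators of the mapping cone in `𝔤* ⊕ 𝔤*[1]`. -/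
def coneW_g (i : g.inn.ι) : FGC (T.coneW hn).deg :=
  (T.coneW hn).gen (Sum.inl (Sum.inl (Sum.inl i)))

/-- The generator `c` of the mapping cone. -/
def coneW_c : FGC (T.coneW hn).deg := (T.coneW hn).gen (Sum.inl (Sum.inl (Sum.inr ())))

/-- The generator `b` of the mapping cone. -/
def coneW_b : FGC (T.coneW hn).deg := (T.coneW hn).gen (Sum.inl (Sum.inr ()))

/-- The generator `σ b` of the mapping cone. -/
def coneW_σb : FGC (T.coneW hn).deg := (T.coneW hn).gen (Sum.inr (Sum.inl ()))

/-- The generator `σ c` of the mapping cone. -/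
def coneW_σc : FGC (T.coneW hn).deg := (T.coneW hn).gen (Sum.inr (Sum.inr ()))

end Transgression

/-- The characteristic class in `H_dR(X)` of a `𝔤`-connection descent object for a closed
invariant polynomial. -/
def ConnDescent.charClass {E : Type*} [NormedAddCommGroup E] [NormedSpace ℝ E] {H : Type*}
    [TopologicalSpace H] {I : ModelWithCorners ℝ E H} {Y : Type u} [TopologicalSpace Y]
    [ChartedSpace H Y] {E' : Type*} [NormedAddCommGroup E'] [NormedSpace ℝ E'] {H' : Type*}
    [TopologicalSpace H'] {J : ModelWithCorners ℝ E' H'} {X : Type v} [TopologicalSpace X]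
    [ChartedSpace H' X] {g : LInfty} {π : Y → X} {hπ : ContMDiff I J ∞ π}
    (D : ConnDescent I J g π hπ) (P : g.inv.carrier) (hP : g.inv.d P = 0) :
    (Omega J X).Cohomology :=
  D.K.mapCohomology (g.inv.cls P hP)

end LiftObstruction

end

open LiftObstruction

/-! In the cone $C$ one has $db=\sigma b-\mu$ and $d\sigma b=0$, so with $\sigma b-\mu$ in place of
$\sigma b$ as a generator, $C$ is $\mathrm{CE}(\mathfrak g)$ with a free acyclic pair $(b,db)$
adjoined. In $\hat C$ one has $db=c-\mathrm{cs}+\sigma b$, $dc=P+\sigma c$ and $d\sigma b=-\sigma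
c$, and $\hat C$ is $W(\mathfrak g)$ with the two acyclic pairs $(b,db)$ and $(c,dc)$ adjoined. A
retraction that kills $b$ and $c$ must kill their differentials, which forces $\sigma b\mapsto\mu$
on the one hand and $\sigma b\mapsto\mathrm{cs}$, $\sigma c\mapsto-P$ on the other. If $q$ denotes
the composite of the retraction and the inclusion, the path $x\mapsto q(x)+t\,(x-q(x))$ on
generators joins $q$ to the identity; its $dt$-component is $\sigma b\mapsto b$, $\sigma c\mapsto c$
and zero on the other generators.

A concordance $\alpha+dt\wedge\rho$ out of a free algebra may be prescribed and checked on
generators (`concordant_of_gen`), because both sides of each of its equations are derivations along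
$\alpha$. For a path that is constant on a subalgebra only the added generators matter
(`concordant_id_of_affine_rel`); this yields `coneCE_right_concordant` and `coneW_right_concordant`.
Integrating $\rho$ over $[0,1]$ turns any concordance into a cochain homotopy
(`Concordant.cochainHomotopic`).

For the obstruction, a morphism out of $\mathrm{CE}(b^n\mathfrak u(1))$ is a closed element $\omega$
of degree $n+1$. It is trivial precisely if $\omega$ is exact: a concordance integrates to a
primitive, and a primitive $\beta$ gives the concordance $t\omega+dt\wedge\beta$
(`isTrivial_iff_of_unique`). To extend $\varphi$ from $\mathrm{CE}(\mathfrak g)$ to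
$\mathrm{CE}(\mathfrak g_\mu)$ is to choose an image $\beta$ of $b$ with $d\beta=-\varphi(\mu)$,
which is the same condition up to sign (`exists_lift_iff`).

For connections, the Weil algebra is free as a dgca on the unshifted generators
(`LInfty.exists_W_hom`, `LInfty.W_hom_ext`), so $W(\mathfrak g)\to\Omega^\bullet(Y)$ extends to
$W(\mathfrak g_\mu)$ with any $n$-form as the image of $b$. Choosing an $n$-form that restricts to
the vertical primitive makes the pair compatible (`exists_pair_lift_iff`), and no further
obstruction appears. On invariant polynomials everything follows from `LInfty.line_invSubalgebra`:
rescaling $h$ by $t$ has derivative $h$ times the contraction, so an element annihilated by the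
contraction does not involve $h$. Hence $\mathrm{inv}(b^n\mathfrak u(1))$ is generated by $\sigma
h$, whose image is the invariant polynomial $P$. -/

noncomputable section

namespace LiftObstruction

universe u v

/-! ### Derivations along algebra maps out of free graded-commutative algebras -/

namespace FGC

variable {ι : Type} {deg : ι → ℕ} {S : Type*} [Ring S] [Algebra ℝ S]

/-- A derivation of degree parity one along `φ` is freely given by its values on generators. -/
theorem exists_derivAlong (φ : FGC deg →ₐ[ℝ] S) (v : ι → S)
    (hv : ∀ i j, φ (gen deg i) * v j =
      (-1 : ℝ) ^ (deg i * (deg j + 1)) • (v j * φ (gen deg i))) :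
    ∃ ρ : FGC deg →ₗ[ℝ] S, (∀ i, ρ (gen deg i) = v i) ∧
      ∀ x y, ρ (x * y) = ρ x * φ y + φ (parity deg x) * ρ y := by
  -- Upper triangular matrices with diagonal `φ ∘ parity`, `φ` and upper right entry `ρ` multiply
  -- like values of an algebra map exactly when `ρ` satisfies the signed Leibniz rule. The universal
  -- property for algebra maps therefore produces the derivation.
  let Φ : FGC deg →ₐ[ℝ] Matrix (Fin 2) (Fin 2) S :=
    lift (fun i => !![φ (parity deg (gen deg i)), v i; 0, φ (gen deg i)]) (by
      intro i j
      have h1 := congrArg φ (gen_comm (deg := deg) i j)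
      rw [map_mul, map_smul, map_mul] at h1
      -- The upper right entry of the relation between two generators has two summands; `h2` and
      -- `h3` match them crosswise with the two summands of the opposite product.
      have h2 : (-1 : ℝ) ^ deg i • (φ (gen deg i) * v j) =
          (-1 : ℝ) ^ (deg i * deg j) • (v j * φ (gen deg i)) := by
        rw [hv i j, smul_smul, ← pow_add,
          show deg i + deg i * (deg j + 1) = deg i * deg j + 2 * deg i by ring,
          pow_add, pow_mul (-1 : ℝ) 2]
        simp
      have h3 : v i * φ (gen deg j) =
          (-1 : ℝ) ^ (deg i * deg j) • ((-1 : ℝ) ^ deg j • (φ (gen deg j) * v i)) := by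
        rw [hv j i, smul_smul, smul_smul, ← pow_add, ← pow_add,
          show deg i * deg j + deg j + deg j * (deg i + 1) =
            2 * (deg i * deg j + deg j) by ring, pow_mul]
        simp
      rw [parity_gen, parity_gen, map_smul, map_smul]
      ext a b
      fin_cases a <;> fin_cases b
      · simp only [Matrix.mul_apply, Fin.sum_univ_two, Matrix.smul_apply]
        simp only [Fin.zero_eta, Fin.isValue, Matrix.of_apply, Matrix.cons_val',
          Matrix.cons_val_zero, Matrix.cons_val_fin_one, Matrix.cons_val_one, mul_zero, add_zero,
          smul_mul_smul_comm]
        rw [h1, smul_comm, mul_comm ((-1 : ℝ) ^ deg i)]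
      · simp only [Matrix.mul_apply, Fin.sum_univ_two, Matrix.smul_apply]
        simp [h2, h3, add_comm]
      · simp [Matrix.mul_apply, Fin.sum_univ_two]
      · simp only [Matrix.mul_apply, Fin.sum_univ_two, Matrix.smul_apply]
        simp [h1])
  have hg : ∀ i, Φ (gen deg i) = !![φ (parity deg (gen deg i)), v i; 0, φ (gen deg i)] :=
    fun i => lift_gen _ _ i
  have key : ∀ x, Φ x 0 0 = φ (parity deg x) ∧ Φ x 1 0 = 0 ∧ Φ x 1 1 = φ x := by
    intro x
    induction x using induction_mon with
    | hm l =>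
      induction l with
      | nil => simp
      | cons i l ih =>
        simp only [mon_cons, map_mul, Matrix.mul_apply, Fin.sum_univ_two, hg, ih.1, ih.2.1, ih.2.2]
        simp
    | ha x y h1 h2 => simp [h1, h2]
    | hs a x h => simp [h]
  refine ⟨{ toFun := fun x => Φ x 0 1, map_add' := by simp, map_smul' := by simp }, ?_, ?_⟩
  · intro i
    simp [hg]
  · intro x y
    change Φ (x * y) 0 1 = Φ x 0 1 * φ y + _ * Φ y 0 1
    rw [map_mul, Matrix.mul_apply, Fin.sum_univ_two, (key x).1, (key y).2.2, add_comm]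

/-- Two derivations along an algebra map which agree on generators agree. -/
theorem derivAlong_ext (φ : FGC deg →ₐ[ℝ] S) (k : ℕ) {D E : FGC deg →ₗ[ℝ] S}
    (hD : ∀ i y, D (gen deg i * y) =
      D (gen deg i) * φ y + (-1 : ℝ) ^ (k * deg i) • (φ (gen deg i) * D y))
    (hE : ∀ i y, E (gen deg i * y) =
      E (gen deg i) * φ y + (-1 : ℝ) ^ (k * deg i) • (φ (gen deg i) * E y))
    (h1 : D 1 = E 1) (h : ∀ i, D (gen deg i) = E (gen deg i)) (x : FGC deg) : D x = E x := by
  induction x using induction_mon with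
  | hm l =>
    induction l with
    | nil => simpa using h1
    | cons i l ih => rw [mon_cons, hD, hE, h, ih]
  | ha x y h1 h2 => simp [h1, h2]
  | hs a x h => simp [h]

theorem map_one_eq_zero_of_leibniz (φ : FGC deg →ₐ[ℝ] S) {D : FGC deg →ₗ[ℝ] S}
    (hD : D (1 * 1) = D 1 * φ 1 + φ (parity deg 1) * D 1) : D 1 = 0 := by
  simpa using hD

end FGC

/-! ### The algebra `B ⊗ C^∞([0,1])` -/

theorem dI_mul (f g : smoothI) : dI (f * g) = dI f * g + f * dI g := by
  obtain ⟨f, F, hF, h1⟩ := f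
  obtain ⟨g, G, hG, h2⟩ := g
  ext t
  have h3 := derivWithin_smoothI (f := f * g) (hF.mul hG)
    (fun t => congrArg₂ (· * ·) (h1 t) (h2 t)) t
  have h4 := derivWithin_smoothI hF h1 t
  have h5 := derivWithin_smoothI hG h2 t
  have h6 := deriv_mul ((hF.differentiable (by simp)) t) ((hG.differentiable (by simp)) t)
  refine h3.trans (h6.trans ?_)
  rw [← h1, ← h2]
  exact congrArg₂ (fun a b => a * g t + f t * b) h4.symm h5.symm

theorem dI_one : dI 1 = 0 := by
  have := dI_mul 1 1
  simpa using this

/-- The coordinate function on the interval. -/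
def coordI : smoothI := ⟨fun t => t, fun t => t, contDiff_id, fun _ => rfl⟩

theorem dI_coordI : dI coordI = 1 := by
  ext t
  have h := derivWithin_smoothI (f := fun t : Set.Icc (0 : ℝ) 1 => (t : ℝ)) (F := fun t => t)
    contDiff_id (fun _ => rfl) t
  exact h.trans (deriv_id _)

theorem evI_coordI (t : Set.Icc (0 : ℝ) 1) : evI t coordI = t := rfl

/-- The integral of smooth functions on `[0,1]`. -/
def integralI : smoothI →ₗ[ℝ] ℝ where
  toFun f := ∫ t in (0 : ℝ)..1, Set.IccExtend zero_le_one f.1 t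
  map_add' := by
    rintro ⟨f, F, hF, h1⟩ ⟨g, G, hG, h2⟩
    have hf : Continuous f := (hF.continuous.comp continuous_subtype_val).congr fun t => (h1 t).symm
    have hg : Continuous g := (hG.continuous.comp continuous_subtype_val).congr fun t => (h2 t).symm
    exact intervalIntegral.integral_add ((hf.Icc_extend' (h := zero_le_one)).intervalIntegrable _ _)
      ((hg.Icc_extend' (h := zero_le_one)).intervalIntegrable _ _)
  map_smul' := by
    rintro a ⟨f, F, hF, h1⟩
    exact intervalIntegral.integral_smul a _

/-- The fundamental theorem of calculus, applied to a smooth extension `F` of `f` to the line: on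
the interval the one-sided derivative agrees with that of `F`. -/
theorem integralI_dI (f : smoothI) : integralI (dI f) = evI 1 f - evI 0 f := by
  obtain ⟨f, F, hF, h⟩ := f
  have h1 : integralI (dI ⟨f, F, hF, h⟩) = ∫ t in (0 : ℝ)..1, deriv F t := by
    refine intervalIntegral.integral_congr fun t ht => ?_
    rw [Set.uIcc_of_le zero_le_one] at ht
    exact (Set.IccExtend_of_mem _ _ ht).trans (derivWithin_smoothI hF h ⟨t, ht⟩)
  have h2 : ∫ t in (0 : ℝ)..1, deriv F t = F 1 - F 0 :=
    intervalIntegral.integral_deriv_eq_sub (fun t _ => hF.differentiable (by simp) t)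
      ((hF.continuous_deriv (by simp)).intervalIntegrable _ _)
  exact h1.trans (h2.trans (congrArg₂ (· - ·) (h 1).symm (h 0).symm))

section Path

variable (B : DGCA.{v})

/-- The differential of `B` on `B ⊗ C^∞([0,1])`. -/
abbrev dB : B.carrier ⊗[ℝ] smoothI →ₗ[ℝ] B.carrier ⊗[ℝ] smoothI :=
  TensorProduct.map B.d LinearMap.id

/-- The derivative along the interval on `B ⊗ C^∞([0,1])`. -/
abbrev dt (B : Type v) [Ring B] [Algebra ℝ B] : B ⊗[ℝ] smoothI →ₗ[ℝ] B ⊗[ℝ] smoothI :=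
  TensorProduct.map LinearMap.id dI

/-- Integration over the fibre `[0,1]`. -/
def fiberIntegral (B : Type v) [Ring B] [Algebra ℝ B] : B ⊗[ℝ] smoothI →ₗ[ℝ] B :=
  (TensorProduct.rid ℝ B).toLinearMap ∘ₗ TensorProduct.map LinearMap.id integralI

variable {B}

theorem fiberIntegral_tmul {B : Type v} [Ring B] [Algebra ℝ B] (b : B) (f : smoothI) :
    fiberIntegral B (b ⊗ₜ f) = integralI f • b := by
  simp [fiberIntegral]

theorem restrictI_tmul (t : Set.Icc (0 : ℝ) 1) (b : B.carrier) (f : smoothI) :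
    restrictI B t (b ⊗ₜ f) = evI t f • b := by
  refine (Algebra.TensorProduct.lift_tmul _ _ _ _ _).trans ?_
  rw [Algebra.smul_def, Algebra.commutes]
  rfl

/-- Together with `fiberIntegral_dB` this is Stokes' theorem for the projection that forgets the
interval. The two are what makes the integral of a concordance a cochain homotopy. -/
theorem fiberIntegral_dt (x : B.carrier ⊗[ℝ] smoothI) :
    fiberIntegral B.carrier (dt B.carrier x) = restrictI B 1 x - restrictI B 0 x := by
  induction x using TensorProduct.induction_on with
  | zero => simp
  | add x y h1 h2 => rw [map_add, map_add, map_add, map_add, h1, h2]; abel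
  | tmul b f =>
    rw [TensorProduct.map_tmul, fiberIntegral_tmul, restrictI_tmul, restrictI_tmul, integralI_dI,
      sub_smul]
    rfl

theorem fiberIntegral_dB (x : B.carrier ⊗[ℝ] smoothI) :
    fiberIntegral B.carrier (dB B x) = B.d (fiberIntegral B.carrier x) := by
  induction x using TensorProduct.induction_on with
  | zero => simp
  | add x y h1 h2 => rw [map_add, map_add, map_add, map_add, h1, h2]
  | tmul b f =>
    rw [TensorProduct.map_tmul, fiberIntegral_tmul, fiberIntegral_tmul, map_smul]
    rfl

theorem fiberIntegral_mem {p : ℕ} {x : B.carrier ⊗[ℝ] smoothI} (hx : x ∈ grI B p) :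
    fiberIntegral B.carrier x ∈ B.gr p := by
  induction hx using Submodule.span_induction with
  | mem x hx =>
    obtain ⟨b, hb, f, rfl⟩ := hx
    rw [fiberIntegral_tmul]
    exact Submodule.smul_mem _ _ hb
  | zero => simp
  | add y z _ _ h1 h2 => rw [map_add]; exact Submodule.add_mem _ h1 h2
  | smul a y _ h => rw [map_smul]; exact Submodule.smul_mem _ _ h

theorem tmul_mem {p : ℕ} {b : B.carrier} (hb : b ∈ B.gr p) (f : smoothI) :
    b ⊗ₜ[ℝ] f ∈ grI B p := Submodule.subset_span ⟨b, hb, f, rfl⟩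

theorem one_mem_grI : (1 : B.carrier ⊗[ℝ] smoothI) ∈ grI B 0 := tmul_mem B.one_mem 1

theorem mul_mem_grI {p q : ℕ} {x y : B.carrier ⊗[ℝ] smoothI} (hx : x ∈ grI B p)
    (hy : y ∈ grI B q) : x * y ∈ grI B (p + q) := by
  induction hx using Submodule.span_induction with
  | mem x hx =>
    obtain ⟨b, hb, f, rfl⟩ := hx
    induction hy using Submodule.span_induction with
    | mem y hy =>
      obtain ⟨c, hc, g, rfl⟩ := hy
      rw [Algebra.TensorProduct.tmul_mul_tmul]
      exact tmul_mem (B.mul_mem hb hc) _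
    | zero => rw [mul_zero]; exact Submodule.zero_mem _
    | add y z _ _ h1 h2 => rw [mul_add]; exact Submodule.add_mem _ h1 h2
    | smul a y _ h => rw [mul_smul_comm]; exact Submodule.smul_mem _ _ h
  | zero => rw [zero_mul]; exact Submodule.zero_mem _
  | add y z _ _ h1 h2 => rw [add_mul]; exact Submodule.add_mem _ h1 h2
  | smul a y _ h => rw [smul_mul_assoc]; exact Submodule.smul_mem _ _ h

theorem comm_grI {p q : ℕ} {x y : B.carrier ⊗[ℝ] smoothI} (hx : x ∈ grI B p)
    (hy : y ∈ grI B q) : x * y = (-1 : ℝ) ^ (p * q) • (y * x) := by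
  induction hx using Submodule.span_induction with
  | mem x hx =>
    obtain ⟨b, hb, f, rfl⟩ := hx
    induction hy using Submodule.span_induction with
    | mem y hy =>
      obtain ⟨c, hc, g, rfl⟩ := hy
      rw [Algebra.TensorProduct.tmul_mul_tmul, Algebra.TensorProduct.tmul_mul_tmul,
        B.comm hb hc, mul_comm f g, TensorProduct.smul_tmul']
    | zero => rw [mul_zero, zero_mul, smul_zero]
    | add y z _ _ h1 h2 => rw [mul_add, add_mul, smul_add, h1, h2]
    | smul a y _ h => rw [mul_smul_comm, smul_mul_assoc, h, smul_comm]
  | zero => rw [mul_zero, zero_mul, smul_zero]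
  | add y z _ _ h1 h2 => rw [mul_add, add_mul, smul_add, h1, h2]
  | smul a y _ h => rw [mul_smul_comm, smul_mul_assoc, h, smul_comm]

theorem dB_leibniz {p : ℕ} {x : B.carrier ⊗[ℝ] smoothI} (hx : x ∈ grI B p)
    (y : B.carrier ⊗[ℝ] smoothI) :
    dB B (x * y) = dB B x * y + (-1 : ℝ) ^ p • (x * dB B y) := by
  induction hx using Submodule.span_induction with
  | mem x hx =>
    obtain ⟨b, hb, f, rfl⟩ := hx
    induction y using TensorProduct.induction_on with
    | zero => simp
    | add y z h1 h2 => rw [mul_add, map_add, map_add, mul_add, mul_add, h1, h2, smul_add]; abel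
    | tmul c g =>
      rw [Algebra.TensorProduct.tmul_mul_tmul, TensorProduct.map_tmul, TensorProduct.map_tmul,
        TensorProduct.map_tmul, Algebra.TensorProduct.tmul_mul_tmul,
        Algebra.TensorProduct.tmul_mul_tmul, B.leibniz hb, TensorProduct.add_tmul,
        TensorProduct.smul_tmul']
      rfl
  | zero => simp
  | add x z _ _ h1 h2 => simp only [add_mul, map_add, smul_add, h1, h2]; abel
  | smul a x _ h => simp only [smul_mul_assoc, map_smul, h, smul_add, smul_comm a]

/-- No sign occurs: the one-form of the interval has been split off, and what remains is the even
derivation differentiating coefficients. -/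
theorem dt_mul {B : Type v} [Ring B] [Algebra ℝ B] (x y : B ⊗[ℝ] smoothI) :
    dt B (x * y) = dt B x * y + x * dt B y := by
  induction x using TensorProduct.induction_on with
  | zero => simp
  | add x z h1 h2 => simp only [add_mul, map_add, h1, h2]; abel
  | tmul b f =>
    induction y using TensorProduct.induction_on with
    | zero => simp
    | add y z h1 h2 => simp only [mul_add, map_add, h1, h2]; abel
    | tmul c g =>
      rw [Algebra.TensorProduct.tmul_mul_tmul, TensorProduct.map_tmul, TensorProduct.map_tmul,
        TensorProduct.map_tmul, Algebra.TensorProduct.tmul_mul_tmul,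
        Algebra.TensorProduct.tmul_mul_tmul, dI_mul, TensorProduct.tmul_add]
      rfl

end Path

/-! ### Concordances -/

theorem concordant_refl {A : DGCA.{u}} {B : DGCA.{v}} (φ : DGHom A B) : Concordant φ φ :=
  ⟨{  α := (Algebra.TensorProduct.includeLeft (R := ℝ) (S := ℝ) (B := smoothI)).comp φ.toAlgHom
      ρ := 0
      α_mem := fun p x hx => tmul_mem (φ.map_gr p x hx) 1
      ρ_mem := fun _ _ _ => Submodule.zero_mem _
      ρ_zero := fun _ _ => rfl
      ρ_mul := by intros; simp
      α_d := fun x => congrArg (· ⊗ₜ[ℝ] (1 : smoothI)) (φ.map_d x)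
      ρ_d := fun x => by
        change φ x ⊗ₜ[ℝ] dI 1 = _
        rw [dI_one]
        simp
      at_zero := fun x => (restrictI_tmul 0 (φ x) 1).trans (by rw [map_one, one_smul])
      at_one := fun x => (restrictI_tmul 1 (φ x) 1).trans (by rw [map_one, one_smul]) }⟩

/-- The homotopy is the integral over $[0,1]$ of the $dt$-component. Integrating the equation `ρ_d`
gives the difference of the endpoints on one side and the homotopy formula on the other. -/
theorem Concordant.cochainHomotopic {A : DGCA.{u}} {B : DGCA.{v}} {φ ψ : DGHom A B}
    (h : Concordant φ ψ) : CochainHomotopic φ ψ := by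
  obtain ⟨η⟩ := h
  refine ⟨fiberIntegral B.carrier ∘ₗ η.ρ, ?_, ?_, ?_⟩
  · intro x hx
    rw [LinearMap.comp_apply, η.ρ_zero x hx, map_zero]
  · intro p x hx
    exact fiberIntegral_mem (η.ρ_mem p x hx)
  · intro x
    rw [← η.at_zero x, ← η.at_one x, ← fiberIntegral_dt, LinearMap.comp_apply,
      LinearMap.comp_apply, ← fiberIntegral_dB, ← map_add]
    exact congrArg _ (η.ρ_d x)

theorem isWeakInverse_of_concordant {A : DGCA.{u}} {B : DGCA.{v}} {φ : DGHom A B} {ψ : DGHom B A}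
    (h1 : Concordant (ψ.comp φ) (DGHom.id A)) (h2 : Concordant (φ.comp ψ) (DGHom.id B)) :
    IsWeakInverse φ ψ := ⟨h1, h2, h1.cochainHomotopic, h2.cochainHomotopic⟩

section OfGen

variable {g : LInfty} {B : DGCA.{v}}

/-- Degrees are preserved if they are preserved on generators. -/
theorem FGC.map_mem_of_gen {ι : Type} {deg : ι → ℕ} {S : Type*} [Ring S] [Algebra ℝ S]
    {gr : ℕ → Submodule ℝ S} (h1 : (1 : S) ∈ gr 0)
    (hmul : ∀ {p q : ℕ} {x y : S}, x ∈ gr p → y ∈ gr q → x * y ∈ gr (p + q))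
    (α : FGC deg →ₐ[ℝ] S) (hα : ∀ i, α (FGC.gen deg i) ∈ gr (deg i)) {p : ℕ} {x : FGC deg}
    (hx : x ∈ FGC.gr deg p) : α x ∈ gr p := by
  induction hx using Submodule.span_induction with
  | mem x hx =>
    obtain ⟨l, rfl, rfl⟩ := hx
    induction l with
    | nil => simpa using h1
    | cons i l ih =>
      rw [FGC.mon_cons, map_mul, List.map_cons, List.sum_cons]
      exact hmul (hα i) ih
  | zero => simp
  | add y z _ _ h1 h2 => rw [map_add]; exact Submodule.add_mem _ h1 h2
  | smul a y _ h => rw [map_smul]; exact Submodule.smul_mem _ _ h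

/-- A concordance out of `CE(𝔤)` is given on generators. -/
theorem concordant_of_gen (φ ψ : DGHom g.CE B)
    (α : FGC g.deg →ₐ[ℝ] B.carrier ⊗[ℝ] smoothI) (ρ : FGC g.deg →ₗ[ℝ] B.carrier ⊗[ℝ] smoothI)
    (hα : ∀ i, α (g.gen i) ∈ grI B (g.deg i)) (hρ : ∀ i, ρ (g.gen i) ∈ grI B (g.deg i - 1))
    (hmul : ∀ x y, ρ (x * y) = ρ x * α y + α (FGC.parity g.deg x) * ρ y)
    (hαd : ∀ i, α (g.d (g.gen i)) = dB B (α (g.gen i)))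
    (hρd : ∀ i, dt B.carrier (α (g.gen i)) = dB B (ρ (g.gen i)) + ρ (g.d (g.gen i)))
    (h0 : ∀ i, restrictI B 0 (α (g.gen i)) = φ (g.gen i))
    (h1 : ∀ i, restrictI B 1 (α (g.gen i)) = ψ (g.gen i)) : Concordant φ ψ := by
  have hαm : ∀ (p : ℕ) (x : FGC g.deg), x ∈ FGC.gr g.deg p → α x ∈ grI B p :=
    fun p x hx => FGC.map_mem_of_gen one_mem_grI mul_mem_grI α hα hx
  have hρ1 : ρ 1 = 0 := FGC.map_one_eq_zero_of_leibniz α (hmul 1 1)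
  have hρmul : ∀ (p : ℕ) (x y : FGC g.deg), x ∈ FGC.gr g.deg p →
      ρ (x * y) = ρ x * α y + (-1 : ℝ) ^ p • (α x * ρ y) := by
    intro p x y hx
    rw [hmul, FGC.parity_mem hx, map_smul, smul_mul_assoc]
  -- Since `p - 1` is truncated subtraction, membership in degree `p - 1` says too little for `p =
  -- 0`; the vanishing of `ρ` there is carried along in the induction.
  have hρm : ∀ (p : ℕ) (x : FGC g.deg), x ∈ FGC.gr g.deg p →
      (p = 0 → ρ x = 0) ∧ ρ x ∈ grI B (p - 1) := by
    intro p x hx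
    induction hx using Submodule.span_induction with
    | mem x hx =>
      obtain ⟨l, rfl, rfl⟩ := hx
      induction l with
      | nil => simp [hρ1]
      | cons i l ih =>
        have hi := g.deg_pos i
        rw [FGC.mon_cons, hρmul _ _ _ (FGC.gen_mem i), List.map_cons, List.sum_cons]
        refine ⟨fun h => by omega, Submodule.add_mem _ ?_ (Submodule.smul_mem _ _ ?_)⟩
        · rw [show g.deg i + (l.map g.deg).sum - 1 = g.deg i - 1 + (l.map g.deg).sum by omega]
          exact mul_mem_grI (hρ i) (hαm _ _ (FGC.mon_mem l))
        -- If the remaining factor has degree zero, the truncated degrees do not add up, but then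
        -- `ρ` kills this factor.
        · rcases Nat.eq_zero_or_pos (l.map g.deg).sum with h | h
          · rw [ih.1 h, mul_zero]
            exact Submodule.zero_mem _
          · rw [show g.deg i + (l.map g.deg).sum - 1 = g.deg i + ((l.map g.deg).sum - 1) by omega]
            exact mul_mem_grI (hα i) ih.2
    | zero => simp
    | add y z _ _ h1 h2 =>
      rw [map_add]
      exact ⟨fun h => by rw [h1.1 h, h2.1 h, add_zero], Submodule.add_mem _ h1.2 h2.2⟩
    | smul a y _ h =>
      rw [map_smul]
      exact ⟨fun h' => by rw [h.1 h', smul_zero], Submodule.smul_mem _ _ h.2⟩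
  -- Both sides are odd derivations along `α`, whence the parity `1`, so equality on generators is
  -- enough.
  have hαd' : ∀ x, α (g.d x) = dB B (α x) := by
    refine FGC.derivAlong_ext α 1 (D := α.toLinearMap ∘ₗ g.d) (E := dB B ∘ₗ α.toLinearMap)
      ?_ ?_ ?_ hαd
    · intro i y
      simp [g.leibniz (FGC.gen_mem i)]
    · intro i y
      rw [one_mul]
      exact (congrArg _ (map_mul α _ _)).trans (dB_leibniz (hα i) (α y))
    · have : (1 : B.carrier ⊗[ℝ] smoothI) = 1 ⊗ₜ 1 := rfl
      have h := B.leibniz B.one_mem 1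
      simp at h
      simp [g.d_one, this, h]
  -- Both sides are even derivations along `α`, whence the parity `0`: the right side is the graded
  -- commutator of the differential with an odd derivation.
  have hρd' : ∀ x, dt B.carrier (α x) = dB B (ρ x) + ρ (g.d x) := by
    refine FGC.derivAlong_ext α 0 (D := dt B.carrier ∘ₗ α.toLinearMap)
      (E := dB B ∘ₗ ρ + ρ ∘ₗ g.d) ?_ ?_ ?_ hρd
    · intro i y
      rw [zero_mul, pow_zero, one_smul]
      exact (congrArg _ (map_mul α _ _)).trans (dt_mul _ _)
    · intro i y
      -- With the degree written as `q + 1`, the value of `ρ` on the generator has degree `q`. The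
      -- mixed terms of $d\rho+\rho d$ then appear in pairs of opposite sign, once `α` is known to
      -- commute with the differentials.
      obtain ⟨q, hq⟩ : ∃ q, g.deg i = q + 1 := ⟨g.deg i - 1, by have := g.deg_pos i; omega⟩
      have e1 : g.gen i ∈ FGC.gr g.deg (q + 1) := hq ▸ FGC.gen_mem i
      have e2 := hα i
      have e3 := hρ i
      rw [hq] at e2 e3
      rw [Nat.add_sub_cancel] at e3
      rw [zero_mul, pow_zero, one_smul]
      change dB B (ρ (g.gen i * y)) + ρ (g.d (g.gen i * y)) =
        (dB B (ρ (g.gen i)) + ρ (g.d (g.gen i))) * α y + α (g.gen i) * (dB B (ρ y) + ρ (g.d y))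
      rw [hρmul _ _ _ e1, g.leibniz e1, map_add, map_add, map_smul, map_smul, dB_leibniz e3,
        dB_leibniz e2, hρmul _ _ _ (g.d_mem e1), hρmul _ _ _ e1, hαd', hαd']
      have e4 : (-1 : ℝ) ^ q * (-1) ^ q = 1 := by
        rw [← pow_add, ← two_mul, pow_mul]; simp
      simp only [smul_add, smul_smul, e4, one_smul, pow_succ, mul_neg, neg_mul, mul_one, neg_neg,
        neg_smul, add_mul, mul_add]
      abel
    · have : (1 : B.carrier ⊗[ℝ] smoothI) = 1 ⊗ₜ 1 := rfl
      simp [hρ1, g.d_one, this, dI_one]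
  exact ⟨{
    α := α
    ρ := ρ
    α_mem := hαm
    ρ_mem := fun p x hx => (hρm (p + 1) x hx).2
    ρ_zero := fun x hx => (hρm 0 x hx).1 rfl
    ρ_mul := hρmul
    α_d := hαd'
    ρ_d := hρd'
    at_zero := fun x => DFunLike.congr_fun
      (FGC.algHom_ext (f := (restrictI B 0).comp α) (g := φ.toAlgHom) h0) x
    at_one := fun x => DFunLike.congr_fun
      (FGC.algHom_ext (f := (restrictI B 1).comp α) (g := ψ.toAlgHom) h1) x }⟩

end OfGen

/-! ### Morphisms given on generators -/

section Free

variable {B : DGCA.{v}}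

/-- The algebra map out of a free graded-commutative algebra with given values on generators. -/
def FGC.liftGr {ι : Type} {deg : ι → ℕ} (B : DGCA.{v}) (a : ι → B.carrier)
    (ha : ∀ i, a i ∈ B.gr (deg i)) : FGC deg →ₐ[ℝ] B.carrier :=
  FGC.lift a fun i j => B.comm (ha i) (ha j)

theorem FGC.liftGr_gen {ι : Type} {deg : ι → ℕ} (a : ι → B.carrier)
    (ha : ∀ i, a i ∈ B.gr (deg i)) (i : ι) : FGC.liftGr B a ha (FGC.gen deg i) = a i :=
  FGC.lift_gen _ _ _

theorem DGCA.d_one (B : DGCA.{v}) : B.d 1 = 0 := by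
  simpa using B.leibniz B.one_mem 1

/-- A morphism out of `CE(𝔤)` is given on generators. -/
def DGHom.ofGen {g : LInfty} (f : FGC g.deg →ₐ[ℝ] B.carrier)
    (hf : ∀ i, f (g.gen i) ∈ B.gr (g.deg i)) (hd : ∀ i, f (g.d (g.gen i)) = B.d (f (g.gen i))) :
    DGHom g.CE B where
  toAlgHom := f
  map_gr _ _ hx := FGC.map_mem_of_gen B.one_mem B.mul_mem f hf hx
  map_d := by
    refine FGC.derivAlong_ext f 1 (D := f.toLinearMap ∘ₗ g.d) (E := B.d ∘ₗ f.toLinearMap)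
      ?_ ?_ ?_ hd
    · intro i y
      simp [g.leibniz (FGC.gen_mem i)]
    · intro i y
      rw [one_mul]
      exact (congrArg _ (map_mul f _ _)).trans (B.leibniz (hf i) (f y))
    · simp [g.d_one, B.d_one]

theorem LInfty.inclW_gen (g : LInfty) (i : g.ι) :
    g.inclW (g.gen i) = g.inn.gen (Sum.inl i) := (NormalSub.refl g).incl_gen i

/-- The Weil algebra is freely generated by `𝔤*` as a differential graded-commutative algebra. -/
theorem LInfty.exists_W_hom (g : LInfty) (a : g.ι → B.carrier) (ha : ∀ i, a i ∈ B.gr (g.deg i)) :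
    ∃ F : DGHom g.W B, ∀ i, F (g.inn.gen (Sum.inl i)) = a i := by
  let F₀ : FGC g.deg →ₐ[ℝ] B.carrier := FGC.liftGr B a ha
  have hF₀ : ∀ {p : ℕ} {x : FGC g.deg}, x ∈ FGC.gr g.deg p → F₀ x ∈ B.gr p := fun hx =>
    FGC.map_mem_of_gen B.one_mem B.mul_mem F₀
      (fun i => (congrArg (· ∈ B.gr (g.deg i)) (FGC.liftGr_gen a ha i)).mpr (ha i)) hx
  -- The value on a shifted generator is forced by $\sigma a=da-d_{\mathrm{CE}}a$ in the Weil
  -- algebra.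
  have hs : ∀ i : g.inn.ι, (Sum.elim a (fun i => B.d (a i) - F₀ (g.d (g.gen i))) i : B.carrier) ∈
      B.gr (g.inn.deg i) := by
    rintro (i | i)
    · exact ha i
    · exact Submodule.sub_mem _ (B.d_mem (ha i)) (hF₀ (g.d_mem (FGC.gen_mem i)))
  let F : FGC g.inn.deg →ₐ[ℝ] B.carrier := FGC.liftGr B _ hs
  have hl : ∀ i, F (g.inn.gen (Sum.inl i)) = a i := fun i => FGC.liftGr_gen _ hs (Sum.inl i)
  have hr : ∀ i, F (g.inn.gen (Sum.inr i)) = B.d (a i) - F₀ (g.d (g.gen i)) :=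
    fun i => FGC.liftGr_gen _ hs (Sum.inr i)
  have hincl : ∀ x, F (g.inclW x) = F₀ x := fun x => DFunLike.congr_fun
    (FGC.algHom_ext (f := F.comp g.inclW) (g := F₀) fun i =>
      (congrArg F (g.inclW_gen i)).trans ((hl i).trans (FGC.liftGr_gen a ha i).symm)) x
  -- The identity $F\sigma=dF_0-F_0d_{\mathrm{CE}}$ holds on generators by the choice of values,
  -- hence everywhere on $\wedge^\bullet\mathfrak g^*$, because both sides are odd derivations along
  -- `F₀`. Applied to $d_{\mathrm{CE}}a$ it gives compatibility with $d\sigma a=-\sigma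
  -- d_{\mathrm{CE}}a$.
  have hshift : ∀ x, F (g.shiftW (g.inclW x)) = B.d (F₀ x) - F₀ (g.d x) := by
    refine FGC.derivAlong_ext F₀ 1 (D := F.toLinearMap ∘ₗ g.shiftW ∘ₗ g.inclW.toLinearMap)
      (E := B.d ∘ₗ F₀.toLinearMap - F₀.toLinearMap ∘ₗ g.d) ?_ ?_ ?_ ?_
    · intro i y
      have hi : g.inclW (FGC.gen g.deg i) ∈ FGC.gr g.inn.deg (g.deg i) :=
        (NormalSub.refl g).incl_mem (FGC.gen_mem i)
      have h : g.shiftW (g.inclW (FGC.gen g.deg i) * g.inclW y) = _ :=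
        FGC.deriv_leibniz (FGC.isDerivData_of_mem (NormalSub.refl g).shiftVal_mem) hi (g.inclW y)
      have h2 : F (g.shiftW (g.inclW (FGC.gen g.deg i * y))) = _ :=
        congrArg F ((congrArg g.shiftW (map_mul g.inclW _ _)).trans h)
      have h3 := congrArg₂ (fun u w => F (g.shiftW (g.inclW (g.gen i))) * u +
        (-1 : ℝ) ^ g.deg i • (w * F (g.shiftW (g.inclW y)))) (hincl y) (hincl (g.gen i))
      rw [one_mul]
      refine h2.trans (Eq.trans ?_ h3)
      refine (map_add F _ _).trans (congrArg₂ (· + ·) (map_mul F _ _) ?_)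
      exact (map_smul F _ _).trans (congrArg _ (map_mul F _ _))
    · intro i y
      have h := B.leibniz (hF₀ (FGC.gen_mem i)) (F₀ y)
      simp only [LinearMap.sub_apply, LinearMap.comp_apply, AlgHom.toLinearMap_apply, map_mul, h,
        g.leibniz (FGC.gen_mem i), map_add, map_smul, one_mul, mul_sub, sub_mul, smul_sub]
      abel
    · have h1 : g.shiftW 1 = 0 := FGC.deriv_one _ _ _
      simp [h1, g.d_one, B.d_one]
    · intro i
      have h1 : g.shiftW (g.inclW (g.gen i)) = g.inn.gen (Sum.inr i) := by
        rw [g.inclW_gen]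
        exact (FGC.deriv_gen _ _ _ _).trans ((NormalSub.refl g).shiftVal_s i)
      have h2 : F₀ (g.gen i) = a i := FGC.liftGr_gen a ha i
      change F (g.shiftW (g.inclW (g.gen i))) = B.d (F₀ (g.gen i)) - F₀ (g.d (g.gen i))
      rw [h1, h2, hr]
  refine ⟨DGHom.ofGen F (fun i => ?_) ?_, hl⟩
  · exact (congrArg (· ∈ B.gr (g.inn.deg i)) (FGC.liftGr_gen _ hs i)).mpr (hs i)
  · rintro (i | i)
    · rw [g.inn_d_inl, map_add, hincl, hr, hl, add_sub_cancel]
    · rw [g.inn_d_inr, map_neg, hshift, g.d_d, map_zero, sub_zero, hr, map_sub, B.d_d, zero_sub]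

/-- The values of a morphism out of the Weil algebra on the shifted generators. -/
theorem LInfty.W_hom_inr {g : LInfty} (F : DGHom g.W B) (i : g.ι) :
    F (g.inn.gen (Sum.inr i)) =
      B.d (F (g.inn.gen (Sum.inl i))) - F (g.inclW (g.d (g.gen i))) := by
  have h2 : g.inn.gen (Sum.inr i) =
      g.inn.d (g.inn.gen (Sum.inl i)) - g.inclW (g.d (g.gen i)) := by
    rw [g.inn_d_inl, add_sub_cancel_left]
  exact (congrArg F h2).trans ((map_sub F.toAlgHom _ _).trans
    (congrArg (fun y => y - F (g.inclW (g.d (g.gen i)))) (F.map_d (g.inn.gen (Sum.inl i)))))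

/-- Morphisms out of the Weil algebra agree if they agree on `𝔤*`. -/
theorem LInfty.W_hom_ext {g : LInfty} {F G : DGHom g.W B}
    (h : ∀ i, F (g.inn.gen (Sum.inl i)) = G (g.inn.gen (Sum.inl i))) (x : FGC g.inn.deg) :
    F x = G x := by
  have h1 : ∀ y, F (g.inclW y) = G (g.inclW y) := fun y => DFunLike.congr_fun
    (FGC.algHom_ext (f := F.toAlgHom.comp g.inclW) (g := G.toAlgHom.comp g.inclW) fun i =>
      (congrArg F (g.inclW_gen i)).trans ((h i).trans (congrArg G (g.inclW_gen i).symm))) y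
  refine DFunLike.congr_fun (FGC.algHom_ext (f := F.toAlgHom) (g := G.toAlgHom) ?_) x
  rintro (i | i)
  · exact h i
  · exact (LInfty.W_hom_inr F i).trans
      (((congrArg₂ (fun y z => B.d y - z) (h i) (h1 _))).trans (LInfty.W_hom_inr G i).symm)

theorem LInfty.line_d_gen (k : ℕ) (hk : 0 < k) : (line k hk).d ((line k hk).gen ()) = 0 :=
  ofGen_d_gen _ _ _ _ _ _

end Free

/-! ### Concordances from homotopies on generators -/

/-- Freeness of the underlying graded algebra: the two components of a prospective concordance can
be prescribed on generators subject only to degrees. Compatibility with differentials remains to be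
checked on generators afterwards, by `concordant_of_gen`. -/
theorem exists_path_of_gen (g : LInfty) (B : DGCA.{v}) (a r : g.ι → B.carrier ⊗[ℝ] smoothI)
    (ha : ∀ i, a i ∈ grI B (g.deg i)) (hr : ∀ i, r i ∈ grI B (g.deg i - 1)) :
    ∃ (α : FGC g.deg →ₐ[ℝ] B.carrier ⊗[ℝ] smoothI) (ρ : FGC g.deg →ₗ[ℝ] B.carrier ⊗[ℝ] smoothI),
      (∀ i, α (g.gen i) = a i) ∧ (∀ i, ρ (g.gen i) = r i) ∧
        ∀ x y, ρ (x * y) = ρ x * α y + α (FGC.parity g.deg x) * ρ y := by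
  let α : FGC g.deg →ₐ[ℝ] B.carrier ⊗[ℝ] smoothI := FGC.lift a fun i j => comm_grI (ha i) (ha j)
  have hα : ∀ i, α (g.gen i) = a i := fun i => FGC.lift_gen _ _ i
  obtain ⟨ρ, h1, h2⟩ := FGC.exists_derivAlong α r (by
    intro i j
    have h : α (FGC.gen g.deg i) = a i := hα i
    -- The values `r j` have degree `deg j - 1`, while `exists_derivAlong` states its sign with `deg
    -- j + 1`; the two agree modulo 2.
    obtain ⟨q, hq⟩ : ∃ q, g.deg j = q + 1 := ⟨g.deg j - 1, by have := g.deg_pos j; omega⟩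
    have h3 := comm_grI (ha i) (hr j)
    rw [hq, Nat.add_sub_cancel] at h3
    rw [h, h3, hq, show g.deg i * (q + 1 + 1) = g.deg i * q + 2 * g.deg i by ring, pow_add,
      pow_mul (-1 : ℝ) 2]
    simp)
  exact ⟨α, ρ, hα, h1, h2⟩

theorem dt_affine {B : Type v} [Ring B] [Algebra ℝ B] (x y : B) :
    dt B (x ⊗ₜ 1 + y ⊗ₜ coordI) = y ⊗ₜ 1 := by
  rw [map_add, TensorProduct.map_tmul, TensorProduct.map_tmul, dI_one, dI_coordI,
    TensorProduct.tmul_zero, zero_add]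
  rfl

theorem restrictI_zero_affine {B : DGCA.{v}} (x y : B.carrier) :
    restrictI B 0 (x ⊗ₜ 1 + y ⊗ₜ coordI) = x := by
  rw [map_add, restrictI_tmul, restrictI_tmul, map_one, one_smul, evI_coordI, Set.Icc.coe_zero,
    zero_smul, add_zero]

theorem restrictI_one_affine {B : DGCA.{v}} (x y : B.carrier) :
    restrictI B 1 (x ⊗ₜ 1 + y ⊗ₜ coordI) = x + y := by
  rw [map_add, restrictI_tmul, restrictI_tmul, map_one, one_smul, evI_coordI, Set.Icc.coe_one,
    one_smul]

/-- The composite `φ` is concordant to the identity through the affine path on generators, if there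
are values `s` of a homotopy on the generators. -/
theorem concordant_id_of_affine {k : LInfty} (φ : DGHom k.CE k.CE) (q s : k.ι → FGC k.deg)
    (hφ : ∀ j, φ (k.gen j) = q j) (hs : ∀ j, s j ∈ FGC.gr k.deg (k.deg j - 1))
    (H : ∀ (α : FGC k.deg →ₐ[ℝ] FGC k.deg ⊗[ℝ] smoothI)
      (ρ : FGC k.deg →ₗ[ℝ] FGC k.deg ⊗[ℝ] smoothI),
      (∀ j, α (k.gen j) = q j ⊗ₜ 1 + (k.gen j - q j) ⊗ₜ coordI) →
      (∀ j, ρ (k.gen j) = s j ⊗ₜ 1) →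
      (∀ x y, ρ (x * y) = ρ x * α y + α (FGC.parity k.deg x) * ρ y) → ∀ j,
        α (k.d (k.gen j)) = k.d (q j) ⊗ₜ 1 + (k.d (k.gen j) - k.d (q j)) ⊗ₜ coordI ∧
        (k.gen j - q j) ⊗ₜ 1 = k.d (s j) ⊗ₜ 1 + ρ (k.d (k.gen j))) :
    Concordant φ (DGHom.id k.CE) := by
  have hq : ∀ j, q j ∈ FGC.gr k.deg (k.deg j) := fun j => by
    rw [← hφ]
    exact φ.map_gr _ _ (FGC.gen_mem j)
  have ha : ∀ j, q j ⊗ₜ[ℝ] (1 : smoothI) + (k.gen j - q j) ⊗ₜ[ℝ] coordI ∈ grI k.CE (k.deg j) :=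
    fun j => Submodule.add_mem _ (tmul_mem (B := k.CE) (hq j) 1)
      (tmul_mem (B := k.CE) (Submodule.sub_mem _ (FGC.gen_mem j) (hq j)) coordI)
  have hr : ∀ j, s j ⊗ₜ[ℝ] (1 : smoothI) ∈ grI k.CE (k.deg j - 1) :=
    fun j => tmul_mem (B := k.CE) (hs j) 1
  obtain ⟨α, ρ, hα, hρ, hmul⟩ := exists_path_of_gen k k.CE _ _ ha hr
  have hH := H α ρ hα hρ hmul
  refine concordant_of_gen _ _ α ρ ?_ ?_ hmul ?_ ?_ ?_ ?_
  · intro j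
    rw [hα]
    exact ha j
  · intro j
    rw [hρ]
    exact hr j
  · intro j
    refine (hH j).1.trans ?_
    rw [← map_sub]
    exact ((congrArg (dB k.CE) (hα j)).trans (map_add (dB k.CE) _ _)).symm
  · intro j
    refine Eq.trans ?_ ((hH j).2.trans (congrArg (fun y => dB k.CE y + _) (hρ j).symm))
    exact (congrArg (dt k.CE.carrier) (hα j)).trans (dt_affine (B := FGC k.deg) _ _)
  · intro j
    exact (congrArg (restrictI k.CE 0) (hα j)).trans
      ((restrictI_zero_affine (B := k.CE) _ _).trans (hφ j).symm)
  · intro j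
    exact (congrArg (restrictI k.CE 1) (hα j)).trans
      ((restrictI_one_affine (B := k.CE) _ _).trans (add_sub_cancel (q j) (k.gen j)))

/-- For an inclusion of generators `i : CE(𝔤) → CE(𝔨)` an affine path as in
`concordant_id_of_affine`, constant on `CE(𝔤)`, has to be controlled only on the other
generators. -/
theorem concordant_id_of_affine_rel {g k : LInfty} (i : FGC g.deg →ₐ[ℝ] FGC k.deg) (e : g.ι → k.ι)
    (hi : ∀ j, i (g.gen j) = k.gen (e j)) (hid : ∀ j, i (g.d (g.gen j)) = k.d (k.gen (e j)))
    (φ : DGHom k.CE k.CE) (q s : k.ι → FGC k.deg) (hφ : ∀ j, φ (k.gen j) = q j)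
    (hq : ∀ j, q (e j) = k.gen (e j)) (hs : ∀ j, s j ∈ FGC.gr k.deg (k.deg j - 1))
    (hse : ∀ j, s (e j) = 0)
    (H : ∀ (α : FGC k.deg →ₐ[ℝ] FGC k.deg ⊗[ℝ] smoothI)
      (ρ : FGC k.deg →ₗ[ℝ] FGC k.deg ⊗[ℝ] smoothI),
      (∀ j, α (k.gen j) = q j ⊗ₜ 1 + (k.gen j - q j) ⊗ₜ coordI) →
      (∀ j, ρ (k.gen j) = s j ⊗ₜ 1) → (∀ x, α (i x) = i x ⊗ₜ 1) → (∀ x, ρ (i x) = 0) →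
      ∀ j, j ∉ Set.range e →
        α (k.d (k.gen j)) = k.d (q j) ⊗ₜ 1 + (k.d (k.gen j) - k.d (q j)) ⊗ₜ coordI ∧
        (k.gen j - q j) ⊗ₜ 1 = k.d (s j) ⊗ₜ 1 + ρ (k.d (k.gen j))) :
    Concordant φ (DGHom.id k.CE) := by
  refine concordant_id_of_affine φ q s hφ hs fun α ρ hα hρ hmul => ?_
  -- On generators coming from `g` the affine path has equal endpoints and the homotopy vanishes.
  -- Hence `α` is constant in `t` and `ρ` is zero on the whole image of `i`, which settles both
  -- equations there.
  have hαe : ∀ j, α (k.gen (e j)) = k.gen (e j) ⊗ₜ 1 := fun j => by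
    rw [hα, hq, sub_self, TensorProduct.zero_tmul, add_zero]
  have hαi : ∀ x : FGC g.deg, α (i x) = i x ⊗ₜ 1 := fun x => DFunLike.congr_fun
    (FGC.algHom_ext (f := α.comp i) (g := (Algebra.TensorProduct.includeLeft (R := ℝ)
      (S := ℝ) (A := FGC k.deg) (B := smoothI)).comp i) fun j =>
        (congrArg α (hi j)).trans
          ((hαe j).trans (congrArg (· ⊗ₜ[ℝ] (1 : smoothI)) (hi j).symm))) x
  have hρi : ∀ x : FGC g.deg, ρ (i x) = 0 := by
    intro x
    induction x using FGC.induction_mon with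
    | hm l =>
      induction l with
      | nil =>
        rw [FGC.mon_nil, map_one]
        exact FGC.map_one_eq_zero_of_leibniz α (hmul 1 1)
      | cons j l ih =>
        have h1 : ρ (i (FGC.gen g.deg j)) = 0 := by
          refine (congrArg ρ (hi j)).trans ?_
          rw [hρ, hse, TensorProduct.zero_tmul]
        rw [FGC.mon_cons, map_mul, hmul, ih, h1, zero_mul, mul_zero, add_zero]
    | ha x y h1 h2 => rw [map_add, map_add, h1, h2, add_zero]
    | hs c x h => rw [map_smul, map_smul, h, smul_zero]
  intro j
  by_cases hj : j ∈ Set.range e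
  · obtain ⟨j, rfl⟩ := hj
    rw [← hid, hαi, hρi, hq, hse, hid, sub_self, sub_self]
    simp
  · exact H α ρ hα hρ hαi hρi j hj

/-! ### The weak inverses on mapping cones -/

theorem DGHom.ext_apply {A : DGCA.{u}} {B : DGCA.{v}} {φ ψ : DGHom A B} (h : ∀ x, φ x = ψ x) :
    φ = ψ := by
  obtain ⟨φ, _, _⟩ := φ
  obtain ⟨ψ, _, _⟩ := ψ
  obtain rfl : φ = ψ := AlgHom.ext h
  rfl

theorem concordant_of_apply_eq {A : DGCA.{u}} {B : DGCA.{v}} {φ ψ : DGHom A B}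
    (h : ∀ x, φ x = ψ x) : Concordant φ ψ := DGHom.ext_apply h ▸ concordant_refl φ

/-- The morphism out of `CE(b^{k-1}𝔲(1))` which sends the generator to the closed element `b`. -/
def LInfty.lineHom (k : ℕ) (hk : 0 < k) {B : DGCA.{v}} (b : B.carrier) (hb : b ∈ B.gr k)
    (hd : B.d b = 0) : DGHom (line k hk).CE B :=
  DGHom.ofGen (g := line k hk) (FGC.liftGr B (fun _ : (line k hk).ι => b) fun _ => hb)
    (fun i => (congrArg (· ∈ B.gr k) (FGC.liftGr_gen _ _ i)).mpr hb)
    (fun i => (congrArg _ (line_d_gen k hk)).trans ((map_zero _).trans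
      ((congrArg B.d (FGC.liftGr_gen _ _ i)).trans hd).symm))

theorem LInfty.lineHom_gen (k : ℕ) (hk : 0 < k) {B : DGCA.{v}} (b : B.carrier) (hb : b ∈ B.gr k)
    (hd : B.d b = 0) : lineHom k hk b hb hd ((line k hk).gen ()) = b :=
  FGC.liftGr_gen (deg := (line k hk).deg) _ (fun _ => hb) _

/-! ### The differential of a mapping cone on its generators -/

namespace NormalSub

variable {h g : LInfty} (t : NormalSub h g)

/-- The inclusion of `∧•(𝔤*)` into the mapping cone. -/
def coneIncl : FGC g.deg →ₐ[ℝ] FGC t.cone.deg := t.incl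

theorem coneIncl_gen (i : g.ι) : t.coneIncl (g.gen i) = t.cone.gen (Sum.inl i) := t.incl_gen i

/-- On elements built from the kernel of $\mathfrak g^*\to\mathfrak h^*$ the derivation $\sigma t^*$
vanishes, so the cone differential has no correction term. -/
theorem cone_d_incl {x : FGC g.deg} (hx : x ∈ Algebra.adjoin ℝ (g.gen '' (Set.range t.s)ᶜ)) :
    t.cone.d (t.coneIncl x) = t.coneIncl (g.d x) := by
  have h1 := t.coneD_incl x
  rw [t.shift_incl_adjoin hx, add_zero] at h1
  exact h1

theorem shift_incl_s (x : h.ι) :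
    t.shift (t.incl (g.gen (t.s x))) = FGC.gen t.coneDeg (Sum.inr x) := by
  rw [incl_gen, shift, FGC.deriv_gen, shiftVal_s]

theorem cone_d_s (x : h.ι) : t.cone.d (t.cone.gen (Sum.inl (t.s x))) =
    t.coneIncl (g.d (g.gen (t.s x))) + t.cone.gen (Sum.inr x) := by
  have h1 := t.coneD_incl (g.gen (t.s x))
  rw [shift_incl_s, incl_gen] at h1
  exact h1

theorem cone_d_inr (x : h.ι) : t.cone.d (t.cone.gen (Sum.inr x)) =
    -t.shift (t.incl (g.d (g.gen (t.s x)))) :=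
  LInfty.ofGen_d_gen t.coneDeg _ _ t.coneVal_mem t.coneD_coneVal _

end NormalSub

theorem FGC.algHom_mem {ι : Type} {deg : ι → ℕ} {S : Type*} [Ring S] [Algebra ℝ S]
    (f : FGC deg →ₐ[ℝ] S) (C : Subalgebra ℝ S) (h : ∀ i, f (FGC.gen deg i) ∈ C) (x : FGC deg) :
    f x ∈ C := by
  induction x using FGC.induction_mon with
  | hm l =>
    induction l with
    | nil => rw [FGC.mon_nil, map_one]; exact C.one_mem
    | cons i l ih => rw [FGC.mon_cons, map_mul]; exact C.mul_mem (h i) ih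
  | ha x y h1 h2 => rw [map_add]; exact C.add_mem h1 h2
  | hs a x h => rw [map_smul]; exact C.smul_mem h a

theorem LInfty.gen_mem (g : LInfty) (i : g.ι) : g.gen i ∈ FGC.gr g.deg (g.deg i) := FGC.gen_mem i

namespace Transgression

variable {g : LInfty} {n : ℕ} (T : Transgression g n) (hn : 0 < n)

/-! ### The cone $b^{n-1}\mathfrak u(1)\hookrightarrow\mathfrak g_\mu$ contracts onto
$\mathrm{CE}(\mathfrak g)$ -/

section CE

/-- The inclusion of `∧•(𝔤*)` into the mapping cone `(b^{n-1}𝔲(1) ↪ 𝔤_μ)`. -/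
def inclConeCE : FGC g.deg →ₐ[ℝ] FGC (T.coneCE hn).deg :=
  (T.stringSub hn).coneIncl.comp (T.stringIncl hn).toAlgHom

theorem stringIncl_gen (i : g.ι) :
    T.stringIncl hn (g.gen i) = (T.stringExt hn).gen (Sum.inl i) :=
  g.addGenIncl_gen n hn _ _ _ i

theorem inclConeCE_gen (i : g.ι) : T.inclConeCE hn (g.gen i) = T.coneCE_g hn i :=
  (congrArg _ (T.stringIncl_gen hn i)).trans ((T.stringSub hn).coneIncl_gen _)

/-- Elements of $\mathrm{CE}(\mathfrak g)$ do not involve $b$. This is the hypothesis under which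
`cone_d_incl` and `shift_incl_adjoin` apply to them, in particular to $\mu$. -/
theorem stringIncl_adjoin (x : FGC g.deg) : T.stringIncl hn x ∈
    Algebra.adjoin ℝ ((T.stringExt hn).gen '' (Set.range (T.stringSub hn).s)ᶜ) := by
  refine g.addGenIncl_adjoin n hn _ _ _ x _ ?_
  rintro i ⟨_, hi⟩
  exact Sum.inr_ne_inl hi

theorem coneCE_d_incl (x : FGC g.deg) :
    (T.coneCE hn).d (T.inclConeCE hn x) = T.inclConeCE hn (g.d x) :=
  ((T.stringSub hn).cone_d_incl (T.stringIncl_adjoin hn x)).trans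
    (congrArg (T.stringSub hn).coneIncl ((T.stringIncl hn).map_d x).symm)

theorem stringExt_d_b : (T.stringExt hn).d ((T.stringExt hn).gen (Sum.inr ())) =
    T.stringIncl hn (-T.μ) := g.addGen_d_gen n hn _ _ _

/-- The relation behind the weak equivalence: the cone turns the defining relation $db=-\mu$ into a
homotopy between $\sigma b$ and $\mu$. -/
theorem coneCE_d_b : (T.coneCE hn).d (T.coneCE_b hn) =
    T.coneCE_σb hn - T.inclConeCE hn T.μ := by
  refine ((T.stringSub hn).cone_d_s ()).trans ?_
  have h : (T.stringSub hn).coneIncl ((T.stringExt hn).d ((T.stringExt hn).gen (Sum.inr ()))) =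
      -T.inclConeCE hn T.μ := by
    rw [stringExt_d_b]
    exact map_neg (T.inclConeCE hn) T.μ
  rw [sub_eq_neg_add, ← h]
  rfl

/-- Up to sign the differential of $\sigma b$ is $\sigma t^*$ of $db=-\mu$, and $\mu$ does not
involve $b$. -/
theorem coneCE_d_σb : (T.coneCE hn).d (T.coneCE_σb hn) = 0 := by
  refine ((T.stringSub hn).cone_d_inr ()).trans ?_
  have h : (T.stringSub hn).shift ((T.stringSub hn).incl
      ((T.stringExt hn).d ((T.stringExt hn).gen ((T.stringSub hn).s ())))) = 0 := by
    refine (congrArg (fun y => (T.stringSub hn).shift ((T.stringSub hn).incl y))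
      (T.stringExt_d_b hn)).trans ?_
    exact (T.stringSub hn).shift_incl_adjoin (T.stringIncl_adjoin hn _)
  rw [h]
  exact neg_zero

/-- The values of the retraction of the mapping cone onto `CE(𝔤)`. -/
def retractCEVal : (g.ι ⊕ Unit) ⊕ Unit → FGC g.deg :=
  Sum.elim (Sum.elim g.gen fun _ => 0) fun _ => T.μ

theorem retractCEVal_mem (i : (T.coneCE hn).ι) :
    T.retractCEVal i ∈ FGC.gr g.deg ((T.coneCE hn).deg i) := by
  rcases i with (i | _) | _
  · exact g.gen_mem i
  · exact Submodule.zero_mem _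
  · exact T.μ_mem

/-- The retraction of the mapping cone onto `CE(𝔤)`. -/
def retractCE : FGC (T.coneCE hn).deg →ₐ[ℝ] FGC g.deg :=
  FGC.lift T.retractCEVal fun i j => FGC.comm (T.retractCEVal_mem hn i) (T.retractCEVal_mem hn j)

theorem retractCE_g (i : g.ι) : T.retractCE hn (T.coneCE_g hn i) = g.gen i := FGC.lift_gen _ _ _

theorem retractCE_b : T.retractCE hn (T.coneCE_b hn) = 0 := FGC.lift_gen _ _ _

theorem retractCE_σb : T.retractCE hn (T.coneCE_σb hn) = T.μ := FGC.lift_gen _ _ _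

theorem retractCE_incl (x : FGC g.deg) : T.retractCE hn (T.inclConeCE hn x) = x :=
  DFunLike.congr_fun (FGC.algHom_ext (f := (T.retractCE hn).comp (T.inclConeCE hn))
    (g := AlgHom.id ℝ _) fun i =>
      (congrArg _ (T.inclConeCE_gen hn i)).trans (T.retractCE_g hn i)) x

theorem coneCE_g_mem (i : g.ι) :
    T.coneCE_g hn i ∈ FGC.gr (T.coneCE hn).deg (g.deg i) :=
  FGC.gen_mem (deg := (T.coneCE hn).deg) (Sum.inl (Sum.inl i))

/-- The morphism `f`. -/
def coneCEHom : DGHom g.CE (T.coneCE hn).CE :=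
  LInfty.homOfGen (T.inclConeCE hn)
    (fun i => by rw [inclConeCE_gen]; exact T.coneCE_g_mem hn i)
    (fun i => (T.coneCE_d_incl hn _).symm)

/-- The morphism `f⁻¹`. -/
def coneCEInv : DGHom (T.coneCE hn).CE g.CE :=
  LInfty.homOfGen (T.retractCE hn)
    (fun i => (congrArg (· ∈ FGC.gr g.deg ((T.coneCE hn).deg i)) (FGC.lift_gen _ _ _)).mpr
      (T.retractCEVal_mem hn i))
    (by
      rintro ((i | _) | _)
      · change T.retractCE hn ((T.coneCE hn).d (T.coneCE_g hn i)) =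
          g.d (T.retractCE hn (T.coneCE_g hn i))
        rw [← inclConeCE_gen, coneCE_d_incl, retractCE_incl, retractCE_incl]
      -- Since $b\mapsto0$, the relation $db=\sigma b-\mu$ leaves $\mu$ as the only possible value
      -- on $\sigma b$.
      · change T.retractCE hn ((T.coneCE hn).d (T.coneCE_b hn)) =
          g.d (T.retractCE hn (T.coneCE_b hn))
        rw [coneCE_d_b, retractCE_b, map_sub, retractCE_σb, retractCE_incl, sub_self, map_zero]
      · change T.retractCE hn ((T.coneCE hn).d (T.coneCE_σb hn)) =
          g.d (T.retractCE hn (T.coneCE_σb hn))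
        rw [coneCE_d_σb, retractCE_σb, map_zero, T.d_μ])

/-- The morphism `j`. -/
def coneCELine : DGHom (LInfty.line (n + 1) n.succ_pos).CE (T.coneCE hn).CE :=
  LInfty.lineHom (n + 1) n.succ_pos (B := (T.coneCE hn).CE) (T.coneCE_σb hn)
    (FGC.gen_mem (deg := (T.coneCE hn).deg) (Sum.inr ())) (T.coneCE_d_σb hn)

theorem coneCELine_gen :
    T.coneCELine hn ((LInfty.line (n + 1) n.succ_pos).gen ()) = T.coneCE_σb hn :=
  LInfty.lineHom_gen _ _ _ _ _

/-- The values on generators of the homotopy on the mapping cone. -/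
def homotopyCE : (g.ι ⊕ Unit) ⊕ Unit → FGC (T.coneCE hn).deg :=
  Sum.elim (Sum.elim (fun _ => 0) fun _ => 0) fun _ => T.coneCE_b hn

/-- The path is constant on $\mathfrak g^*$, with $b\mapsto tb$ and $\sigma b\mapsto\mu+t(\sigma
b-\mu)$; its $dt$-component sends $\sigma b$ to $b$. -/
theorem coneCE_right_concordant :
    Concordant ((T.coneCEHom hn).comp (T.coneCEInv hn)) (DGHom.id (T.coneCE hn).CE) := by
  refine concordant_id_of_affine_rel (T.inclConeCE hn) (fun i => Sum.inl (Sum.inl i))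
    (T.inclConeCE_gen hn) (fun j => ?_) _
    (fun j => T.inclConeCE hn (T.retractCE hn ((T.coneCE hn).gen j))) (T.homotopyCE hn)
    (fun _ => rfl) (fun j => ?_) ?_ (fun _ => rfl) ?_
  · refine (T.coneCE_d_incl hn (g.gen j)).symm.trans ?_
    rw [inclConeCE_gen]
    rfl
  · refine (congrArg _ (T.retractCE_g hn j)).trans (T.inclConeCE_gen hn j)
  · rintro ((i | _) | _)
    · exact Submodule.zero_mem _
    · exact Submodule.zero_mem _
    · exact FGC.gen_mem (deg := (T.coneCE hn).deg) (Sum.inl (Sum.inr ()))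
  · intro α ρ hα hρ hαi hρi
    have a1 : α (T.coneCE_σb hn) = T.inclConeCE hn T.μ ⊗ₜ 1 +
        (T.coneCE_σb hn - T.inclConeCE hn T.μ) ⊗ₜ coordI := by
      rw [← retractCE_σb T hn]
      exact hα (Sum.inr ())
    have r1 : ρ (T.coneCE_σb hn) = T.coneCE_b hn ⊗ₜ 1 := hρ (Sum.inr ())
    rintro ((i | _) | _) hj
    · exact absurd ⟨i, rfl⟩ hj
    -- For $b$ the homotopy equation reads $b=\rho(\sigma b-\mu)$, where $\rho(\mu)=0$ because $\mu$
    -- comes from $\mathrm{CE}(\mathfrak g)$.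
    · change α ((T.coneCE hn).d (T.coneCE_b hn)) = (T.coneCE hn).d (T.inclConeCE hn
          (T.retractCE hn (T.coneCE_b hn))) ⊗ₜ 1 + ((T.coneCE hn).d (T.coneCE_b hn) -
          (T.coneCE hn).d (T.inclConeCE hn (T.retractCE hn (T.coneCE_b hn)))) ⊗ₜ coordI ∧
        (T.coneCE_b hn - T.inclConeCE hn (T.retractCE hn (T.coneCE_b hn))) ⊗ₜ 1 =
          (T.coneCE hn).d 0 ⊗ₜ 1 + ρ ((T.coneCE hn).d (T.coneCE_b hn))
      rw [coneCE_d_b, retractCE_b, map_zero, map_zero, map_sub, map_sub, a1, r1, hαi, hρi]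
      constructor
      · simp
      · simp
    -- For $\sigma b$ the homotopy equation is $\sigma b-\mu=db$ itself.
    · change α ((T.coneCE hn).d (T.coneCE_σb hn)) = (T.coneCE hn).d (T.inclConeCE hn
          (T.retractCE hn (T.coneCE_σb hn))) ⊗ₜ 1 + ((T.coneCE hn).d (T.coneCE_σb hn) -
          (T.coneCE hn).d (T.inclConeCE hn (T.retractCE hn (T.coneCE_σb hn)))) ⊗ₜ coordI ∧
        (T.coneCE_σb hn - T.inclConeCE hn (T.retractCE hn (T.coneCE_σb hn))) ⊗ₜ 1 =
          (T.coneCE hn).d (T.coneCE_b hn) ⊗ₜ 1 + ρ ((T.coneCE hn).d (T.coneCE_σb hn))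
      rw [coneCE_d_b, coneCE_d_σb, retractCE_σb, coneCE_d_incl, T.d_μ]
      constructor
      · simp
      · simp

theorem coneCE_isWeakInverse : IsWeakInverse (T.coneCEHom hn) (T.coneCEInv hn) :=
  isWeakInverse_of_concordant (concordant_of_apply_eq (T.retractCE_incl hn))
    (T.coneCE_right_concordant hn)

end CE

/-! ### The cone $\mathrm{inn}(b^{n-1}\mathfrak u(1))\hookrightarrow\mathrm{cs}_P(\mathfrak g)$
contracts onto $W(\mathfrak g)$ -/

section W

/-- The inclusion of `W(𝔤)` into the mapping cone `(inn(b^{n-1}𝔲(1)) ↪ cs_P(𝔤))`. -/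
def inclConeW : FGC g.inn.deg →ₐ[ℝ] FGC (T.coneW hn).deg :=
  (T.csSub hn).coneIncl.comp (T.csIncl hn)

theorem inclConeW_gen (i : g.inn.ι) : T.inclConeW hn (g.inn.gen i) = T.coneW_g hn i :=
  (congrArg _ (T.csIncl_gen hn i)).trans ((T.csSub hn).coneIncl_gen _)

theorem csIncl_adjoin (x : FGC g.inn.deg) : T.csIncl hn x ∈
    Algebra.adjoin ℝ ((T.csAlg hn).gen '' (Set.range (T.csSub hn).s)ᶜ) := by
  refine FGC.algHom_mem (T.csIncl hn) _ (fun i => ?_) x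
  have h := T.csIncl_gen hn i
  rw [LInfty.gen] at h
  rw [h]
  refine Algebra.subset_adjoin ⟨Sum.inl (Sum.inl i), ?_, rfl⟩
  rintro ⟨_ | _, hi⟩
  · exact Sum.inr_ne_inl hi
  · exact Sum.inr_ne_inl (Sum.inl_injective hi)

theorem coneW_d_incl (x : FGC g.inn.deg) :
    (T.coneW hn).d (T.inclConeW hn x) = T.inclConeW hn (g.inn.d x) :=
  ((T.csSub hn).cone_d_incl (T.csIncl_adjoin hn x)).trans
    (congrArg (T.csSub hn).coneIncl (T.csIncl_d hn x))

theorem coneW_d_b : (T.coneW hn).d (T.coneW_b hn) =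
    T.coneW_c hn - T.inclConeW hn T.cs + T.coneW_σb hn := by
  refine ((T.csSub hn).cone_d_s (Sum.inl ())).trans ?_
  have h : (T.csSub hn).coneIncl ((T.csAlg hn).d ((T.csAlg hn).gen (Sum.inr ()))) =
      T.coneW_c hn - T.inclConeW hn T.cs := by
    rw [csAlg_d_b, map_sub]
    exact congrArg (fun y => y - T.inclConeW hn T.cs)
      ((T.csSub hn).coneIncl_gen (Sum.inl (Sum.inr ())))
  rw [← h]
  rfl

theorem coneW_d_c : (T.coneW hn).d (T.coneW_c hn) = T.inclConeW hn T.P + T.coneW_σc hn := by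
  refine ((T.csSub hn).cone_d_s (Sum.inr ())).trans ?_
  have h : (T.csSub hn).coneIncl ((T.csAlg hn).d ((T.csAlg hn).gen (Sum.inl (Sum.inr ())))) =
      T.inclConeW hn T.P := by
    rw [csAlg_d_c]
    rfl
  rw [← h]
  rfl

/-- Of the two terms of $db=c-\mathrm{cs}$, only $c$ is seen by $\sigma t^*$, as $\mathrm{cs}$ lies
in $W(\mathfrak g)$. This sign is the one in $\hat\jmath(\sigma h)=-\sigma c$. -/
theorem coneW_d_σb : (T.coneW hn).d (T.coneW_σb hn) = -T.coneW_σc hn := by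
  refine ((T.csSub hn).cone_d_inr (Sum.inl ())).trans ?_
  have h : (T.csSub hn).shift ((T.csSub hn).incl
      ((T.csAlg hn).d ((T.csAlg hn).gen (Sum.inr ())))) = T.coneW_σc hn := by
    rw [csAlg_d_b, map_sub, map_sub, (T.csSub hn).shift_incl_adjoin (T.csIncl_adjoin hn _),
      sub_zero]
    exact (T.csSub hn).shift_incl_s (Sum.inr ())
  exact congrArg Neg.neg h

theorem coneW_d_σc : (T.coneW hn).d (T.coneW_σc hn) = 0 := by
  refine ((T.csSub hn).cone_d_inr (Sum.inr ())).trans ?_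
  have h : (T.csSub hn).shift ((T.csSub hn).incl
      ((T.csAlg hn).d ((T.csAlg hn).gen (Sum.inl (Sum.inr ()))))) = 0 := by
    rw [csAlg_d_c, (T.csSub hn).shift_incl_adjoin (T.csIncl_adjoin hn _)]
  exact (congrArg Neg.neg h).trans neg_zero

/-- The values of the retraction of the mapping cone onto `W(𝔤)`. -/
def retractWVal : ((g.inn.ι ⊕ Unit) ⊕ Unit) ⊕ (Unit ⊕ Unit) → FGC g.inn.deg :=
  Sum.elim (Sum.elim (Sum.elim g.inn.gen fun _ => 0) fun _ => 0)
    (Sum.elim (fun _ => T.cs) fun _ => -T.P)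

theorem retractWVal_mem (i : (T.coneW hn).ι) :
    T.retractWVal i ∈ FGC.gr g.inn.deg ((T.coneW hn).deg i) := by
  rcases i with ((i | _) | _) | (_ | _)
  · exact g.inn.gen_mem i
  · exact Submodule.zero_mem _
  · exact Submodule.zero_mem _
  · exact T.cs_mem
  · exact Submodule.neg_mem _ T.P_mem

/-- The retraction of the mapping cone onto `W(𝔤)`. -/
def retractW : FGC (T.coneW hn).deg →ₐ[ℝ] FGC g.inn.deg :=
  FGC.lift T.retractWVal fun i j => FGC.comm (T.retractWVal_mem hn i) (T.retractWVal_mem hn j)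

theorem retractW_g (i : g.inn.ι) : T.retractW hn (T.coneW_g hn i) = g.inn.gen i :=
  FGC.lift_gen _ _ _

theorem retractW_b : T.retractW hn (T.coneW_b hn) = 0 := FGC.lift_gen _ _ _

theorem retractW_c : T.retractW hn (T.coneW_c hn) = 0 := FGC.lift_gen _ _ _

theorem retractW_σb : T.retractW hn (T.coneW_σb hn) = T.cs := FGC.lift_gen _ _ _

theorem retractW_σc : T.retractW hn (T.coneW_σc hn) = -T.P := FGC.lift_gen _ _ _

theorem retractW_incl (x : FGC g.inn.deg) : T.retractW hn (T.inclConeW hn x) = x :=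
  DFunLike.congr_fun (FGC.algHom_ext (f := (T.retractW hn).comp (T.inclConeW hn))
    (g := AlgHom.id ℝ _) fun i =>
      (congrArg _ (T.inclConeW_gen hn i)).trans (T.retractW_g hn i)) x

theorem coneW_g_mem (i : g.inn.ι) :
    T.coneW_g hn i ∈ FGC.gr (T.coneW hn).deg (g.inn.deg i) :=
  FGC.gen_mem (deg := (T.coneW hn).deg) (Sum.inl (Sum.inl (Sum.inl i)))

/-- The morphism `f̂`. -/
def coneWHom : DGHom g.W (T.coneW hn).CE :=
  LInfty.homOfGen (T.inclConeW hn)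
    (fun i => by rw [inclConeW_gen]; exact T.coneW_g_mem hn i)
    (fun i => (T.coneW_d_incl hn _).symm)

/-- The morphism `f̂⁻¹`. -/
def coneWInv : DGHom (T.coneW hn).CE g.W :=
  LInfty.homOfGen (T.retractW hn)
    (fun i => (congrArg (· ∈ FGC.gr g.inn.deg ((T.coneW hn).deg i)) (FGC.lift_gen _ _ _)).mpr
      (T.retractWVal_mem hn i))
    (by
      rintro (((i | _) | _) | (_ | _))
      · change T.retractW hn ((T.coneW hn).d (T.coneW_g hn i)) =
          g.inn.d (T.retractW hn (T.coneW_g hn i))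
        rw [← inclConeW_gen, coneW_d_incl, retractW_incl, retractW_incl]
      -- With $c\mapsto0$, the relation $dc=P+\sigma c$ forces $\sigma c\mapsto-P$.
      · change T.retractW hn ((T.coneW hn).d (T.coneW_c hn)) =
          g.inn.d (T.retractW hn (T.coneW_c hn))
        rw [coneW_d_c, retractW_c, map_add, retractW_σc, retractW_incl, add_neg_cancel, map_zero]
      -- With $b,c\mapsto0$, the relation $db=c-\mathrm{cs}+\sigma b$ forces $\sigma
      -- b\mapsto\mathrm{cs}$.
      · change T.retractW hn ((T.coneW hn).d (T.coneW_b hn)) =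
          g.inn.d (T.retractW hn (T.coneW_b hn))
        rw [coneW_d_b, retractW_b, map_add, map_sub, retractW_c, retractW_σb, retractW_incl,
          zero_sub, neg_add_cancel, map_zero]
      -- The two forced values fit together because $d\,\mathrm{cs}=P$: this is where transgression
      -- enters.
      · change T.retractW hn ((T.coneW hn).d (T.coneW_σb hn)) =
          g.inn.d (T.retractW hn (T.coneW_σb hn))
        rw [coneW_d_σb, retractW_σb, map_neg, retractW_σc, neg_neg, T.d_cs]
      · change T.retractW hn ((T.coneW hn).d (T.coneW_σc hn)) =
          g.inn.d (T.retractW hn (T.coneW_σc hn))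
        rw [coneW_d_σc, retractW_σc, map_zero, map_neg, T.d_P, neg_zero])

/-- The values on generators of the homotopy on the mapping cone. -/
def homotopyW : ((g.inn.ι ⊕ Unit) ⊕ Unit) ⊕ (Unit ⊕ Unit) → FGC (T.coneW hn).deg :=
  Sum.elim (Sum.elim (Sum.elim (fun _ => 0) fun _ => 0) fun _ => 0)
    (Sum.elim (fun _ => T.coneW_b hn) fun _ => T.coneW_c hn)

/-- The affine path scales $b$ and $c$ by $t$ and moves $\sigma b$ from $\mathrm{cs}$ and $\sigma c$
from $-P$ to themselves; its $dt$-component sends $\sigma b$ to $b$ and $\sigma c$ to $c$. -/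
theorem coneW_right_concordant :
    Concordant ((T.coneWHom hn).comp (T.coneWInv hn)) (DGHom.id (T.coneW hn).CE) := by
  refine concordant_id_of_affine_rel (T.inclConeW hn) (fun i => Sum.inl (Sum.inl (Sum.inl i)))
    (T.inclConeW_gen hn) (fun j => ?_) _
    (fun j => T.inclConeW hn (T.retractW hn ((T.coneW hn).gen j))) (T.homotopyW hn)
    (fun _ => rfl) (fun j => ?_) ?_ (fun _ => rfl) ?_
  · refine (T.coneW_d_incl hn (g.inn.gen j)).symm.trans ?_
    rw [inclConeW_gen]
    rfl
  · refine (congrArg _ (T.retractW_g hn j)).trans (T.inclConeW_gen hn j)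
  · rintro (((i | _) | _) | (_ | _))
    · exact Submodule.zero_mem _
    · exact Submodule.zero_mem _
    · exact Submodule.zero_mem _
    · exact FGC.gen_mem (deg := (T.coneW hn).deg) (Sum.inl (Sum.inr ()))
    · exact FGC.gen_mem (deg := (T.coneW hn).deg) (Sum.inl (Sum.inl (Sum.inr ())))
  · intro α ρ hα hρ hαi hρi
    -- A substitution device: for a generator `z` with endpoint `y` and homotopy value `s`, the goal
    -- may be checked with explicit formulas in place of the differentials.
    have key : ∀ (z s y : FGC (T.coneW hn).deg),
        T.inclConeW hn (T.retractW hn z) = y → ∀ dz dy ds : FGC (T.coneW hn).deg,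
        (T.coneW hn).d z = dz → (T.coneW hn).d y = dy → (T.coneW hn).d s = ds →
        (α dz = dy ⊗ₜ 1 + (dz - dy) ⊗ₜ coordI ∧ (z - y) ⊗ₜ 1 = ds ⊗ₜ 1 + ρ dz) →
        α ((T.coneW hn).d z) = (T.coneW hn).d (T.inclConeW hn (T.retractW hn z)) ⊗ₜ 1 +
          ((T.coneW hn).d z - (T.coneW hn).d (T.inclConeW hn (T.retractW hn z))) ⊗ₜ coordI ∧
        (z - T.inclConeW hn (T.retractW hn z)) ⊗ₜ 1 =
          (T.coneW hn).d s ⊗ₜ 1 + ρ ((T.coneW hn).d z) := by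
      rintro z s y rfl dz dy ds rfl rfl rfl h
      exact h
    have qb : T.inclConeW hn (T.retractW hn (T.coneW_b hn)) = 0 := by rw [retractW_b, map_zero]
    have qc : T.inclConeW hn (T.retractW hn (T.coneW_c hn)) = 0 := by rw [retractW_c, map_zero]
    have qσb : T.inclConeW hn (T.retractW hn (T.coneW_σb hn)) = T.inclConeW hn T.cs := by
      rw [retractW_σb]
    have qσc : T.inclConeW hn (T.retractW hn (T.coneW_σc hn)) = -T.inclConeW hn T.P := by
      rw [retractW_σc, map_neg]
    have ac : α (T.coneW_c hn) = _ := hα (Sum.inl (Sum.inl (Sum.inr ())))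
    have aσb : α (T.coneW_σb hn) = _ := hα (Sum.inr (Sum.inl ()))
    have aσc : α (T.coneW_σc hn) = _ := hα (Sum.inr (Sum.inr ()))
    change _ = T.inclConeW hn (T.retractW hn (T.coneW_c hn)) ⊗ₜ 1 + (T.coneW_c hn -
      T.inclConeW hn (T.retractW hn (T.coneW_c hn))) ⊗ₜ coordI at ac
    change _ = T.inclConeW hn (T.retractW hn (T.coneW_σb hn)) ⊗ₜ 1 + (T.coneW_σb hn -
      T.inclConeW hn (T.retractW hn (T.coneW_σb hn))) ⊗ₜ coordI at aσb
    change _ = T.inclConeW hn (T.retractW hn (T.coneW_σc hn)) ⊗ₜ 1 + (T.coneW_σc hn -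
      T.inclConeW hn (T.retractW hn (T.coneW_σc hn))) ⊗ₜ coordI at aσc
    rw [qc] at ac
    rw [qσb] at aσb
    rw [qσc] at aσc
    have rc : ρ (T.coneW_c hn) = 0 :=
      (hρ (Sum.inl (Sum.inl (Sum.inr ())))).trans (TensorProduct.zero_tmul _ _)
    have rσb : ρ (T.coneW_σb hn) = T.coneW_b hn ⊗ₜ 1 := hρ (Sum.inr (Sum.inl ()))
    have rσc : ρ (T.coneW_σc hn) = T.coneW_c hn ⊗ₜ 1 := hρ (Sum.inr (Sum.inr ()))
    have dcs : (T.coneW hn).d (T.inclConeW hn T.cs) = T.inclConeW hn T.P := by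
      rw [coneW_d_incl, T.d_cs]
    have dP : (T.coneW hn).d (-T.inclConeW hn T.P) = 0 := by
      rw [map_neg, coneW_d_incl, T.d_P, map_zero, neg_zero]
    rintro (((i | _) | _) | (_ | _)) hj
    · exact absurd ⟨i, rfl⟩ hj
    · refine key (T.coneW_c hn) 0 _ qc _ _ _ (T.coneW_d_c hn) (map_zero _) (map_zero _) ?_
      rw [map_add, map_add, hαi, hρi, aσc, rσc]
      constructor
      · simp [TensorProduct.add_tmul, TensorProduct.neg_tmul]; abel
      · simp
    · refine key (T.coneW_b hn) 0 _ qb _ _ _ (T.coneW_d_b hn) (map_zero _) (map_zero _) ?_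
      rw [map_add, map_add, map_sub, map_sub, hαi, hρi, aσb, rσb, ac, rc]
      constructor
      · simp [TensorProduct.add_tmul, TensorProduct.sub_tmul]; abel
      · simp
    -- The only generator for which both terms of the homotopy formula contribute: $db+\rho(-\sigma
    -- c)=(c-\mathrm{cs}+\sigma b)-c=\sigma b-\mathrm{cs}$.
    · refine key (T.coneW_σb hn) (T.coneW_b hn) _ qσb _ _ _ (T.coneW_d_σb hn) dcs
        (T.coneW_d_b hn) ?_
      rw [map_neg, map_neg, aσc, rσc]
      constructor
      · simp [TensorProduct.add_tmul, TensorProduct.sub_tmul, TensorProduct.neg_tmul]; abel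
      · simp [TensorProduct.add_tmul, TensorProduct.sub_tmul]; abel
    · refine key (T.coneW_σc hn) (T.coneW_c hn) _ qσc _ _ _ (T.coneW_d_σc hn) dP
        (T.coneW_d_c hn) ?_
      constructor
      · simp
      · simp [add_comm]

theorem coneW_isWeakInverse : IsWeakInverse (T.coneWHom hn) (T.coneWInv hn) :=
  isWeakInverse_of_concordant (concordant_of_apply_eq (T.retractW_incl hn))
    (T.coneW_right_concordant hn)

/-- The morphism `ĵ` exists. -/
theorem exists_coneWLine : ∃ j : DGHom (LInfty.line (n + 1) n.succ_pos).W (T.coneW hn).CE,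
    j ((LInfty.line (n + 1) n.succ_pos).inn.gen (Sum.inl ())) = T.coneW_σb hn ∧
      j ((LInfty.line (n + 1) n.succ_pos).inn.gen (Sum.inr ())) = -T.coneW_σc hn := by
  obtain ⟨j, hj⟩ := (LInfty.line (n + 1) n.succ_pos).exists_W_hom (B := (T.coneW hn).CE)
    (fun _ => T.coneW_σb hn)
    (fun _ => FGC.gen_mem (deg := (T.coneW hn).deg) (Sum.inr (Sum.inl ())))
  refine ⟨j, hj (), ?_⟩
  -- Only $h\mapsto\sigma b$ is a choice; as $dh=\sigma h$ in the Weil algebra, $\sigma h$ must go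
  -- to $d\sigma b=-\sigma c$.
  have h := (LInfty.line (n + 1) n.succ_pos).inn_d_inl ()
  rw [LInfty.line_d_gen, map_zero, zero_add] at h
  refine (congrArg j h.symm).trans ((j.map_d _).trans ?_)
  exact (congrArg (T.coneW hn).d (hj ())).trans (T.coneW_d_σb hn)

end W

end Transgression

/-! ### The invariant polynomials of `b^{k-1}𝔲(1)` -/

namespace LInfty

theorem contractionVal_self (L : LInfty) (x : L.ι) : L.contractionVal x (Sum.inl x) = 1 :=
  if_pos rfl

theorem contractionVal_of_ne (L : LInfty) {x : L.ι} {i : L.inn.ι} (h : i ≠ Sum.inl x) :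
    L.contractionVal x i = 0 := by
  rcases i with i | i
  · exact if_neg fun h' => h (congrArg Sum.inl h')
  · rfl

theorem contraction_gen_mul (L : LInfty) (x : L.ι) (i : L.inn.ι) (y : FGC L.inn.deg) :
    L.contraction x (L.inn.gen i * y) = L.contractionVal x i * y +
      (-1 : ℝ) ^ (L.deg x * L.inn.deg i) • (L.inn.gen i * L.contraction x y) := by
  have h1 := FGC.deriv_mul (L.deg x) _ (L.isDerivData_contractionVal x) (L.inn.gen i) y
  have h2 : (FGC.parity L.inn.deg ^ L.deg x) (L.inn.gen i) =
    (-1 : ℝ) ^ (L.deg x * L.inn.deg i) • L.inn.gen i := FGC.parity_pow_gen _ _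
  have h3 : FGC.deriv (L.deg x) _ (L.isDerivData_contractionVal x) (L.inn.gen i) =
    L.contractionVal x i := FGC.deriv_gen _ _ _ i
  rw [h2, smul_mul_assoc, h3] at h1
  exact h1

/-- An element of `W(𝔤)` which is annihilated by the contraction with a basis vector does not
involve the dual generator. -/
theorem mem_adjoin_of_contraction (L : LInfty) (x : L.ι) {P : FGC L.inn.deg}
    (hP : L.contraction x P = 0) :
    P ∈ Algebra.adjoin ℝ (L.inn.gen '' {Sum.inl x}ᶜ) := by
  classical
  -- The map `θ` below rescales the generator dual to `x` by the coordinate of the interval and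
  -- fixes all others.
  let c : L.inn.ι → smoothI := fun i => if i = Sum.inl x then coordI else 1
  have hc1 : c (Sum.inl x) = coordI := if_pos rfl
  have hc2 : ∀ {i}, i ≠ Sum.inl x → c i = 1 := fun h => if_neg h
  have hc : ∀ i, L.inn.gen i ⊗ₜ[ℝ] c i ∈ grI L.W (L.inn.deg i) :=
    fun i => tmul_mem (B := L.W) (FGC.gen_mem i) (c i)
  let θ : FGC L.inn.deg →ₐ[ℝ] FGC L.inn.deg ⊗[ℝ] smoothI :=
    FGC.lift (fun i => L.inn.gen i ⊗ₜ c i) fun i j => comm_grI (B := L.W) (hc i) (hc j)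
  have hθ : ∀ i, θ (L.inn.gen i) = L.inn.gen i ⊗ₜ c i := fun i => FGC.lift_gen _ _ i
  let h : FGC L.inn.deg := L.inn.gen (Sum.inl x)
  have hι1 : L.contraction x 1 = 0 := FGC.deriv_one _ _ _
  have hι : ∀ i, L.contraction x (L.inn.gen i) = L.contractionVal x i :=
    fun i => FGC.deriv_gen _ _ _ i
  -- An Euler-type identity: differentiating the rescaling is contracting and multiplying by the
  -- generator `h`. The right side is an even derivation along `θ`, since the parities of `h` and of
  -- the contraction agree, so generators suffice.
  have key : ∀ y, dt (FGC L.inn.deg) (θ y) = (h ⊗ₜ 1) * θ (L.contraction x y) := by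
    refine FGC.derivAlong_ext θ 0 (D := dt (FGC L.inn.deg) ∘ₗ θ.toLinearMap)
      (E := LinearMap.mulLeft ℝ (h ⊗ₜ 1) ∘ₗ θ.toLinearMap ∘ₗ L.contraction x) ?_ ?_ ?_ ?_
    · intro i y
      rw [zero_mul, pow_zero, one_smul]
      exact (congrArg _ (map_mul θ _ _)).trans (dt_mul _ _)
    · intro i y
      have h2 : (h ⊗ₜ[ℝ] (1 : smoothI)) * (L.inn.gen i ⊗ₜ[ℝ] c i) =
          (-1 : ℝ) ^ (L.deg x * L.inn.deg i) •
            ((L.inn.gen i ⊗ₜ[ℝ] c i) * (h ⊗ₜ[ℝ] (1 : smoothI))) :=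
        comm_grI (B := L.W) (p := L.deg x)
          (tmul_mem (B := L.W) (FGC.gen_mem (deg := L.inn.deg) (Sum.inl x)) 1) (hc i)
      have h3 : ((-1 : ℝ) ^ (L.deg x * L.inn.deg i)) * (-1) ^ (L.deg x * L.inn.deg i) = 1 := by
        rw [← pow_add, ← two_mul, pow_mul]; simp
      change (h ⊗ₜ[ℝ] (1 : smoothI)) * θ (L.contraction x (L.inn.gen i * y)) =
        (h ⊗ₜ[ℝ] (1 : smoothI)) * θ (L.contraction x (L.inn.gen i)) * θ y +
          (-1 : ℝ) ^ (0 * L.inn.deg i) •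
            (θ (L.inn.gen i) * ((h ⊗ₜ[ℝ] (1 : smoothI)) * θ (L.contraction x y)))
      rw [contraction_gen_mul, hι, map_add, map_mul, map_smul, map_mul, mul_add, mul_smul_comm, hθ,
        ← mul_assoc, ← mul_assoc, ← mul_assoc, h2, smul_mul_assoc, smul_smul, h3, zero_mul,
        pow_zero]
    · simp [hι1, Algebra.TensorProduct.one_def, dI_one]
    · intro i
      change dt (FGC L.inn.deg) (θ (L.inn.gen i)) =
        (h ⊗ₜ[ℝ] (1 : smoothI)) * θ (L.contraction x (L.inn.gen i))
      rw [hθ, hι, TensorProduct.map_tmul]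
      by_cases hi : i = Sum.inl x
      · subst hi
        rw [L.contractionVal_self, hc1, map_one, mul_one, dI_coordI]
        rfl
      · rw [L.contractionVal_of_ne hi, hc2 hi, map_zero, mul_zero, dI_one,
          TensorProduct.tmul_zero]
  have h1 : dt (FGC L.inn.deg) (θ P) = 0 := by rw [key, hP, map_zero, mul_zero]
  -- The contraction kills `P`, so `θ P` has zero derivative and its values at the endpoints agree:
  -- at 1 this is `P`, and at 0 it is `P` with the generator `h` replaced by zero.
  have h2 := fiberIntegral_dt (B := L.W) (θ P)
  have h3 : restrictI L.W 1 (θ P) - restrictI L.W 0 (θ P) = 0 :=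
    h2.symm.trans ((congrArg (fiberIntegral (FGC L.inn.deg)) h1).trans (map_zero _))
  have hr : ∀ t i, restrictI L.W t (θ (L.inn.gen i)) = evI t (c i) • L.inn.gen i := fun t i =>
    (congrArg (restrictI L.W t) (hθ i)).trans (restrictI_tmul (B := L.W) t _ _)
  have h4 : restrictI L.W 1 (θ P) = P := DFunLike.congr_fun
    (FGC.algHom_ext (f := (restrictI L.W 1).comp θ) (g := AlgHom.id ℝ (FGC L.inn.deg)) fun i => by
      refine (hr 1 i).trans ?_
      have h5 : evI 1 (c i) = 1 := by
        by_cases hi : i = Sum.inl x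
        · subst hi
          rw [hc1]
          rfl
        · rw [hc2 hi, map_one]
      rw [h5]
      exact one_smul _ _) P
  let C : Subalgebra ℝ (FGC L.inn.deg) := Algebra.adjoin ℝ (L.inn.gen '' {Sum.inl x}ᶜ)
  let ev0 : FGC L.inn.deg →ₐ[ℝ] FGC L.inn.deg := (restrictI L.W 0).comp θ
  have h5 : ev0 P ∈ C := by
    refine FGC.algHom_mem ev0 C (fun i => ?_) P
    have h6 : ev0 (FGC.gen L.inn.deg i) = evI 0 (c i) • FGC.gen L.inn.deg i := hr 0 i
    rw [h6]
    by_cases hi : i = Sum.inl x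
    · have h7 : evI 0 (c i) = 0 := by
        rw [hi, hc1]
        rfl
      rw [h7, zero_smul]
      exact C.zero_mem
    · exact C.smul_mem (Algebra.subset_adjoin ⟨i, hi, rfl⟩) _
  have h6 : ev0 P = P := (sub_eq_zero.mp h3).symm.trans h4
  rwa [h6] at h5

/-- `inv(b^{k-1}𝔲(1))` is generated by the shifted generator. -/
theorem line_invSubalgebra (k : ℕ) (hk : 0 < k) : (line k hk).invSubalgebra =
    Algebra.adjoin ℝ {(line k hk).inn.gen (Sum.inr ())} := by
  refine le_antisymm (fun P hP => ?_) ?_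
  -- The Weil algebra here has just the generators $h$ and $\sigma h$, so excluding $h$ leaves
  -- $\sigma h$ alone.
  · refine Algebra.adjoin_mono ?_ (mem_adjoin_of_contraction (line k hk) () (hP ()).1)
    rintro _ ⟨i | i, hi, rfl⟩
    · exact absurd rfl hi
    · rfl
  · exact Algebra.adjoin_le (Set.singleton_subset_iff.mpr (line_curv_inv k hk))

end LInfty

/-! ### The obstruction -/

/-- If `CE(𝔤)` has a single generator, closed and of degree `n + 1`, then a morphism is trivial
precisely if its value on the generator is exact. -/
theorem isTrivial_iff_of_unique {L : LInfty} {n : ℕ} {B : DGCA.{v}} (x : L.ι) (hx : ∀ i, i = x)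
    (hn : L.deg x = n + 1) (hd : L.d (L.gen x) = 0) (φ : DGHom L.CE B) :
    IsTrivial φ ↔ ∃ β ∈ B.gr n, B.d β = φ (L.gen x) := by
  have hg : L.gen x ∈ FGC.gr L.deg (n + 1) := hn ▸ L.gen_mem x
  constructor
  -- The homotopy evaluated on the generator is the primitive: `φ₀` vanishes there, and the second
  -- term of the homotopy formula drops out because the generator is closed.
  · rintro ⟨φ₀, h0, hφ⟩
    obtain ⟨τ, -, hτ, h⟩ := hφ.cochainHomotopic
    refine ⟨τ (L.gen x), hτ n _ hg, ?_⟩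
    have h1 := h (L.gen x)
    have h2 : τ (L.CE.d (L.gen x)) = 0 := (congrArg τ hd).trans (map_zero τ)
    rw [h0, sub_zero, h2, add_zero] at h1
    exact h1.symm
  · rintro ⟨β, hβ, h⟩
    have hφ : φ (L.gen x) ∈ B.gr (n + 1) := φ.map_gr _ _ hg
    -- The path is $t\omega+dt\wedge\beta$ with $\omega$ the value of `φ` on the generator; the zero
    -- summand only fits it to the affine form of `dt_affine`.
    have ha : ∀ i : L.ι, (0 : B.carrier) ⊗ₜ[ℝ] (1 : smoothI) + φ (L.gen x) ⊗ₜ coordI ∈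
        grI B (L.deg i) := fun i => by
      rw [hx i, hn, TensorProduct.zero_tmul, zero_add]
      exact tmul_mem hφ coordI
    have hr : ∀ i : L.ι, β ⊗ₜ[ℝ] (1 : smoothI) ∈ grI B (L.deg i - 1) := fun i => by
      rw [hx i, hn, Nat.add_sub_cancel]
      exact tmul_mem hβ 1
    obtain ⟨α, ρ, hα, hρ, hmul⟩ := exists_path_of_gen L B _ _ ha hr
    have hz : ∀ i : L.ι, (0 : B.carrier) ∈ B.gr (L.deg i) := fun _ => Submodule.zero_mem _
    have h0 : ∀ i, FGC.liftGr B (fun _ => 0) hz (L.gen i) = 0 := fun i => FGC.liftGr_gen _ hz i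
    refine ⟨DGHom.ofGen (FGC.liftGr B (fun _ => 0) hz) (fun i => ?_) (fun i => ?_), h0,
      concordant_of_gen _ _ α ρ ?_ ?_ hmul ?_ ?_ ?_ ?_⟩
    · rw [h0]
      exact hz i
    · rw [h0, hx i, hd, map_zero, map_zero]
    · intro i
      rw [hα]
      exact ha i
    · intro i
      rw [hρ]
      exact hr i
    · intro i
      have h2 : B.d (φ (L.gen x)) = 0 := by rw [← h, B.d_d]
      rw [hα, hx i, hd, map_zero, map_add, TensorProduct.map_tmul, TensorProduct.map_tmul, h2,
        map_zero, TensorProduct.zero_tmul, TensorProduct.zero_tmul, add_zero]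
    · intro i
      rw [hα, hρ, hx i, hd, map_zero, add_zero, TensorProduct.map_tmul, h]
      exact dt_affine _ _
    · intro i
      rw [hα, restrictI_zero_affine]
      exact (h0 i).symm
    · intro i
      rw [hα, restrictI_one_affine, zero_add, hx i]

theorem isTrivial_line_iff {n : ℕ} {B : DGCA.{v}}
    (φ : DGHom (LInfty.line (n + 1) n.succ_pos).CE B) :
    IsTrivial φ ↔ ∃ β ∈ B.gr n, B.d β = φ ((LInfty.line (n + 1) n.succ_pos).gen ()) :=
  isTrivial_iff_of_unique (L := LInfty.line (n + 1) n.succ_pos) () (fun _ => rfl) rfl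
    (LInfty.line_d_gen _ _) φ

/-- A morphism of Weil algebras preserving invariant polynomials restricts to them. -/
def DGHom.invMap {h g : LInfty} (F : DGHom h.W g.W)
    (hF : ∀ Q ∈ h.invSubalgebra, F Q ∈ g.invSubalgebra) : DGHom h.inv g.inv where
  toFun Q := ⟨F Q.1, hF _ Q.2⟩
  map_one' := Subtype.ext (map_one F.toAlgHom)
  map_mul' _ _ := Subtype.ext (map_mul F.toAlgHom _ _)
  map_zero' := Subtype.ext (map_zero F.toAlgHom)
  map_add' _ _ := Subtype.ext (map_add F.toAlgHom _ _)
  commutes' r := Subtype.ext (F.toAlgHom.commutes r)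
  map_gr p Q hQ := F.map_gr p Q.1 hQ
  map_d Q := Subtype.ext (F.map_d Q.1)

theorem DGHom.mapCohomology_cls {A : DGCA.{u}} {B : DGCA.{v}} (f : DGHom A B) {x : A.carrier}
    (hx : A.d x = 0) {y : B.carrier} (hy : B.d y = 0) (h : f x = y) :
    f.mapCohomology (A.cls x hx) = B.cls y hy := by
  subst h
  rfl

namespace Transgression

variable {g : LInfty} {n : ℕ} (T : Transgression g n) (hn : 0 < n)

/-! ### Extending morphisms to $\mathrm{CE}(\mathfrak g_\mu)$ and to $W(\mathfrak g_\mu)$ -/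

section Lift

variable {B : DGCA.{v}}

/-- The only differential relation added is $db=-\mu$, so a primitive of $-\varphi(\mu)$ is exactly
what a lift needs; `d_string_lift` is the converse. Keeping `β` as the value on $b$ matters later,
when the vertical lift has to match a form on $Y$. -/
theorem exists_string_lift (φ : DGHom g.CE B) {β : B.carrier} (hβ : β ∈ B.gr n)
    (hd : B.d β = -φ T.μ) :
    ∃ ψ : DGHom (T.stringExt hn).CE B, (∀ x, ψ (T.stringIncl hn x) = φ x) ∧
      ψ ((T.stringExt hn).gen (Sum.inr ())) = β := by
  let a : g.ι ⊕ Unit → B.carrier := Sum.elim (fun i => φ (g.gen i)) fun _ => β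
  have ha : ∀ i : (T.stringExt hn).ι, a i ∈ B.gr ((T.stringExt hn).deg i) := by
    rintro (i | _)
    · exact φ.map_gr _ _ (FGC.gen_mem i)
    · exact hβ
  let F : FGC (T.stringExt hn).deg →ₐ[ℝ] B.carrier := FGC.liftGr B a ha
  have hF : ∀ i, F ((T.stringExt hn).gen i) = a i := fun i => FGC.liftGr_gen _ ha i
  have hincl : ∀ x, F (T.stringIncl hn x) = φ x := fun x => DFunLike.congr_fun
    (FGC.algHom_ext (f := F.comp (T.stringIncl hn).toAlgHom) (g := φ.toAlgHom) fun i =>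
      (congrArg F (T.stringIncl_gen hn i)).trans (hF (Sum.inl i))) x
  refine ⟨DGHom.ofGen F (fun i => ?_) ?_, hincl, hF (Sum.inr ())⟩
  · rw [hF]
    exact ha i
  · rintro (i | _)
    · have h1 : (T.stringExt hn).d ((T.stringExt hn).gen (Sum.inl i)) =
          T.stringIncl hn (g.d (g.gen i)) :=
        (congrArg _ (T.stringIncl_gen hn i).symm).trans ((T.stringIncl hn).map_d _).symm
      refine (congrArg F h1).trans ((hincl _).trans ((φ.map_d (g.gen i)).trans ?_))
      exact congrArg B.d (hF (Sum.inl i)).symm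
    · refine (congrArg F (T.stringExt_d_b hn)).trans ((hincl _).trans ?_)
      refine (map_neg φ.toAlgHom _).trans (hd.symm.trans ?_)
      exact congrArg B.d (hF (Sum.inr ())).symm

theorem d_string_lift {φ : DGHom g.CE B} {ψ : DGHom (T.stringExt hn).CE B}
    (h : ∀ x, ψ (T.stringIncl hn x) = φ x) :
    B.d (ψ ((T.stringExt hn).gen (Sum.inr ()))) = -φ T.μ :=
  (ψ.map_d _).symm.trans ((congrArg ψ (T.stringExt_d_b hn)).trans
    ((h _).trans (map_neg φ.toAlgHom _)))

theorem coneCEInv_line :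
    T.coneCEInv hn (T.coneCELine hn ((LInfty.line (n + 1) n.succ_pos).gen ())) = T.μ :=
  (congrArg _ (T.coneCELine_gen hn)).trans (T.retractCE_σb hn)

/-- Triviality means that $\varphi(\mu)$ is exact. Primitives are negated to match $db=-\mu$. -/
theorem isTrivial_iff (φ : DGHom g.CE B) :
    IsTrivial (φ.comp ((T.coneCEInv hn).comp (T.coneCELine hn))) ↔
      ∃ β ∈ B.gr n, B.d β = -φ T.μ := by
  have h : φ.comp ((T.coneCEInv hn).comp (T.coneCELine hn))
      ((LInfty.line (n + 1) n.succ_pos).gen ()) = φ T.μ := congrArg φ (T.coneCEInv_line hn)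
  rw [isTrivial_line_iff, h]
  constructor
  · rintro ⟨β, hβ, hd⟩
    exact ⟨-β, Submodule.neg_mem _ hβ, by rw [map_neg, hd]⟩
  · rintro ⟨β, hβ, hd⟩
    exact ⟨-β, Submodule.neg_mem _ hβ, by rw [map_neg, hd, neg_neg]⟩

/-- A morphism `CE(𝔤) → B` extends to `CE(𝔤_μ)` precisely if the obstruction is trivial. -/
theorem exists_lift_iff (φ : DGHom g.CE B) :
    (∃ ψ : DGHom (T.stringExt hn).CE B, ∀ x, ψ (T.stringIncl hn x) = φ x) ↔
      IsTrivial (φ.comp ((T.coneCEInv hn).comp (T.coneCELine hn))) := by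
  rw [isTrivial_iff]
  constructor
  · rintro ⟨ψ, h⟩
    exact ⟨_, ψ.map_gr n _ (FGC.gen_mem (deg := (T.stringExt hn).deg) (Sum.inr ())),
      T.d_string_lift hn h⟩
  · rintro ⟨β, hβ, hd⟩
    obtain ⟨ψ, h, -⟩ := T.exists_string_lift hn φ hβ hd
    exact ⟨ψ, h⟩

theorem stringInclW_inl (i : g.ι) : T.stringInclW hn (g.inn.gen (Sum.inl i)) =
    (T.stringExt hn).inn.gen (Sum.inl (Sum.inl i)) :=
  FGC.map_gen _ (by rintro (i | i) <;> rfl) _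

theorem stringInclW_inr (i : g.ι) : T.stringInclW hn (g.inn.gen (Sum.inr i)) =
    (T.stringExt hn).inn.gen (Sum.inr (Sum.inl i)) :=
  FGC.map_gen _ (by rintro (i | i) <;> rfl) _

theorem stringInclW_inclW (x : FGC g.deg) : T.stringInclW hn (g.inclW x) =
    (T.stringExt hn).inclW (T.stringIncl hn x) :=
  DFunLike.congr_fun (FGC.algHom_ext (f := (T.stringInclW hn).comp g.inclW)
    (g := (T.stringExt hn).inclW.comp (T.stringIncl hn).toAlgHom) fun i =>
      (congrArg (T.stringInclW hn) (g.inclW_gen i)).trans ((T.stringInclW_inl hn i).trans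
        ((congrArg (T.stringExt hn).inclW (T.stringIncl_gen hn i)).trans
          ((T.stringExt hn).inclW_gen (Sum.inl i))).symm)) x

/-- A morphism `W(𝔤) → B` extends to `W(𝔤_μ)` with an arbitrary value on the new generator. -/
theorem exists_stringW_lift (A : DGHom g.W B) {β : B.carrier} (hβ : β ∈ B.gr n) :
    ∃ F : DGHom (T.stringExt hn).W B, (∀ x, F (T.stringInclW hn x) = A x) ∧
      F ((T.stringExt hn).inn.gen (Sum.inl (Sum.inr ()))) = β := by
  let a : g.ι ⊕ Unit → B.carrier := Sum.elim (fun i => A (g.inn.gen (Sum.inl i))) fun _ => β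
  have ha : ∀ i : (T.stringExt hn).ι, a i ∈ B.gr ((T.stringExt hn).deg i) := by
    rintro (i | _)
    · exact A.map_gr _ _ (FGC.gen_mem (deg := g.inn.deg) (Sum.inl i))
    · exact hβ
  obtain ⟨F, hF⟩ := (T.stringExt hn).exists_W_hom a ha
  have hl : ∀ i, F (T.stringInclW hn (g.inn.gen (Sum.inl i))) = A (g.inn.gen (Sum.inl i)) :=
    fun i => (congrArg F (T.stringInclW_inl hn i)).trans (hF (Sum.inl i))
  have hincl : ∀ x, F (T.stringInclW hn (g.inclW x)) = A (g.inclW x) := fun x =>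
    DFunLike.congr_fun (FGC.algHom_ext
      (f := F.toAlgHom.comp ((T.stringInclW hn).comp g.inclW)) (g := A.toAlgHom.comp g.inclW)
      fun i => (congrArg (fun y => F (T.stringInclW hn y)) (g.inclW_gen i)).trans
        ((hl i).trans (congrArg A (g.inclW_gen i)).symm)) x
  refine ⟨F, fun x => DFunLike.congr_fun (FGC.algHom_ext
    (f := F.toAlgHom.comp (T.stringInclW hn)) (g := A.toAlgHom) ?_) x, hF (Sum.inr ())⟩
  rintro (i | i)
  · exact hl i
  -- On shifted generators both morphisms are determined by their unshifted values, and the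
  -- differential of a generator of $\mathfrak g^*$ is the same in $\mathfrak g$ and in $\mathfrak
  -- g_\mu$.
  · have h1 : (T.stringExt hn).d ((T.stringExt hn).gen (Sum.inl i)) =
        T.stringIncl hn (g.d (g.gen i)) :=
      (congrArg _ (T.stringIncl_gen hn i).symm).trans ((T.stringIncl hn).map_d _).symm
    have h2 : F ((T.stringExt hn).inclW ((T.stringExt hn).d
        ((T.stringExt hn).gen (Sum.inl i)))) = A (g.inclW (g.d (g.gen i))) := by
      rw [h1, ← stringInclW_inclW, hincl]
    refine (congrArg F (T.stringInclW_inr hn i)).trans ((LInfty.W_hom_inr F (Sum.inl i)).trans ?_)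
    exact (congrArg₂ (fun y z => B.d y - z) (hF (Sum.inl i)) h2).trans (LInfty.W_hom_inr A i).symm

end Lift

end Transgression

/-- The projection to vertical forms is surjective in each degree. -/
theorem exists_toVert_eq {E : Type*} [NormedAddCommGroup E] [NormedSpace ℝ E] {H : Type*}
    [TopologicalSpace H] (I : ModelWithCorners ℝ E H) {Y : Type u} [TopologicalSpace Y]
    [ChartedSpace H Y] {X : Type v} (π : Y → X) {p : ℕ} {β : (OmegaVert I π).carrier}
    (hβ : β ∈ (OmegaVert I π).gr p) :
    -- The grading of `DGCA.image` is by images of homogeneous elements, so the membership of `β` is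
    -- already such a preimage.
    ∃ β' ∈ (Omega I Y).gr p, toVert I π β' = β := hβ

theorem DGHom.mapCohomology_eq {A A' : DGCA.{0}} {B : DGCA.{v}} {f : DGHom A B} {f' : DGHom A' B}
    (x : A.carrier) (hx : A.d x = 0) (x' : A'.carrier) (hx' : A'.d x' = 0) (h : f x = f' x') :
    f.mapCohomology (A.cls x hx) = f'.mapCohomology (A'.cls x' hx') := by
  have hy : B.d (f' x') = 0 :=
    (f'.map_d x').symm.trans ((congrArg f' hx').trans (map_zero f'.toAlgHom))
  exact (f.mapCohomology_cls hx hy h).trans (f'.mapCohomology_cls hx' hy rfl).symm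

/-! ### The obstruction for connection descent objects -/

section Forms

variable {E : Type*} [NormedAddCommGroup E] [NormedSpace ℝ E] {H : Type*} [TopologicalSpace H]
  {I : ModelWithCorners ℝ E H} {Y : Type u} [TopologicalSpace Y] [ChartedSpace H Y]
  {E' : Type*} [NormedAddCommGroup E'] [NormedSpace ℝ E'] {H' : Type*} [TopologicalSpace H']
  {J : ModelWithCorners ℝ E' H'} {X : Type v} [TopologicalSpace X] [ChartedSpace H' X]
  {π : Y → X} {hπ : ContMDiff I J ∞ π}

/-- Connection descent objects are transported along compatible morphisms of Weil and
Chevalley–Eilenberg algebras preserving invariant polynomials. -/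
theorem ConnDescent.exists_push {g h : LInfty} (D : ConnDescent I J g π hπ) (F : DGHom h.W g.W)
    (G : DGHom h.CE g.CE) (hF : ∀ Q ∈ h.invSubalgebra, F Q ∈ g.invSubalgebra)
    (hFG : ∀ x, g.toCEHom (F x) = G (h.toCEHom x)) :
    ∃ D' : ConnDescent I J h π hπ, D'.Avert = D.Avert.comp G ∧ D'.A = D.A.comp F ∧
      ∀ Q : h.inv.carrier, D'.K Q = D.K ⟨F Q.1, hF Q.1 Q.2⟩ :=
  ⟨{  Avert := D.Avert.comp G
      A := D.A.comp F
      K := D.K.comp (F.invMap hF)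
      top := fun x => (D.top (F x)).trans (congrArg D.Avert (hFG x))
      bot := fun P => D.bot (F.invMap hF P) }, rfl, rfl, fun _ => rfl⟩

namespace Transgression

variable {g : LInfty} {n : ℕ} (T : Transgression g n) (hn : 0 < n)

/-- The signs of $\sigma h\mapsto-\sigma c$ and $\sigma c\mapsto-P$ cancel. -/
theorem coneWInv_line_curv {jW : DGHom (LInfty.line (n + 1) n.succ_pos).W (T.coneW hn).CE}
    (h : jW ((LInfty.line (n + 1) n.succ_pos).inn.gen (Sum.inr ())) = -T.coneW_σc hn) :
    T.coneWInv hn (jW ((LInfty.line (n + 1) n.succ_pos).inn.gen (Sum.inr ()))) = T.P := by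
  refine (congrArg (T.coneWInv hn) h).trans ((map_neg (T.retractW hn) _).trans ?_)
  rw [retractW_σc, neg_neg]

/-- The preimage of $\mathrm{inv}(\mathfrak g)$ is a subalgebra, and it contains the single
generator $\sigma h$ because $P$ is invariant. -/
theorem coneWInv_line_mem_inv {jW : DGHom (LInfty.line (n + 1) n.succ_pos).W (T.coneW hn).CE}
    (h : jW ((LInfty.line (n + 1) n.succ_pos).inn.gen (Sum.inr ())) = -T.coneW_σc hn) :
    ∀ Q ∈ (LInfty.line (n + 1) n.succ_pos).invSubalgebra,
      (T.coneWInv hn).comp jW Q ∈ g.invSubalgebra := by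
  let F : FGC (LInfty.line (n + 1) n.succ_pos).inn.deg →ₐ[ℝ] FGC g.inn.deg :=
    ((T.coneWInv hn).comp jW).toAlgHom
  have h1 : (LInfty.line (n + 1) n.succ_pos).invSubalgebra ≤ g.invSubalgebra.comap F := by
    rw [LInfty.line_invSubalgebra]
    refine Algebra.adjoin_le (Set.singleton_subset_iff.mpr ?_)
    exact (congrArg (· ∈ g.invSubalgebra) (T.coneWInv_line_curv hn h)).mpr T.P_inv
  exact fun Q hQ => h1 hQ

/-- The pair `(A_vert, A)` extends to `𝔤_μ` precisely if the obstruction is trivial. -/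
theorem exists_pair_lift_iff (D : ConnDescent I J g π hπ) :
    (∃ (Alift : Descent I (T.stringExt hn) π) (AWlift : DGHom (T.stringExt hn).W (Omega I Y)),
      (∀ x, Alift (T.stringIncl hn x) = D.Avert x) ∧
      (∀ x, AWlift (T.stringInclW hn x) = D.A x) ∧
      ∀ x, toVert I π (AWlift x) = Alift ((T.stringExt hn).toCEHom x)) ↔
    IsTrivial (D.Avert.comp ((T.coneCEInv hn).comp (T.coneCELine hn))) := by
  constructor
  · rintro ⟨Alift, -, h, -⟩
    exact (T.exists_lift_iff hn D.Avert).mp ⟨Alift, h⟩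
  · intro h
    obtain ⟨β, hβ, hd⟩ := (T.isTrivial_iff hn D.Avert).mp h
    obtain ⟨Alift, hA, hAb⟩ := T.exists_string_lift hn D.Avert hβ hd
    -- The vertical primitive is represented by an $n$-form on $Y$. No equation is asked of that
    -- form, since its differential is absorbed by the curvature generator of $W(\mathfrak g_\mu)$.
    obtain ⟨β', hβ', hb⟩ := exists_toVert_eq I π hβ
    obtain ⟨AW, hAW, hAWb⟩ := T.exists_stringW_lift hn D.A hβ'
    -- Compatibility is an equality of morphisms out of a Weil algebra, so only unshifted generators
    -- need comparison: those of $\mathfrak g^*$ by compatibility of `D`, and $b$ by the choice of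
    -- the form.
    refine ⟨Alift, AW, hA, hAW, LInfty.W_hom_ext (F := (toVert I π).comp AW)
      (G := Alift.comp (T.stringExt hn).toCEHom) ?_⟩
    have hce : ∀ i, Alift ((T.stringExt hn).toCEHom ((T.stringExt hn).inn.gen (Sum.inl i))) =
        Alift ((T.stringExt hn).gen i) := fun i =>
      congrArg Alift ((T.stringExt hn).toCE_inl i)
    rintro (i | _)
    · have h1 : AW ((T.stringExt hn).inn.gen (Sum.inl (Sum.inl i))) =
          D.A (g.inn.gen (Sum.inl i)) :=
        (congrArg AW (T.stringInclW_inl hn i)).symm.trans (hAW _)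
      have h2 : Alift ((T.stringExt hn).gen (Sum.inl i)) = D.Avert (g.gen i) :=
        (congrArg Alift (T.stringIncl_gen hn i)).symm.trans (hA _)
      refine (congrArg (toVert I π) h1).trans ((D.top _).trans ?_)
      exact (congrArg D.Avert (g.toCE_inl i)).trans (h2.symm.trans (hce (Sum.inl i)).symm)
    · exact (congrArg (toVert I π) hAWb).trans (hb.trans
        (hAb.symm.trans (hce (Sum.inr ())).symm))

end Transgression

end Forms

end LiftObstruction

end

/-! ### The theorem -/

theorem mainTheorem3
    {E : Type*} [NormedAddCommGroup E] [NormedSpace ℝ E] [FiniteDimensional ℝ E]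
    {H : Type*} [TopologicalSpace H] (I : ModelWithCorners ℝ E H) [I.Boundaryless]
    {E' : Type*} [NormedAddCommGroup E'] [NormedSpace ℝ E'] [FiniteDimensional ℝ E']
    {H' : Type*} [TopologicalSpace H'] (J : ModelWithCorners ℝ E' H') [J.Boundaryless]
    {Y : Type*} [TopologicalSpace Y] [ChartedSpace H Y] [IsManifold I ∞ Y]
    {X : Type*} [TopologicalSpace X] [ChartedSpace H' X] [IsManifold J ∞ X]
    (π : Y → X) (hπ : ContMDiff I J ∞ π) (hsurj : Function.Surjective π)
    (hsub : Manifold.IsSubmersion I J ∞ π)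
    (g : LInfty) (n : ℕ) (hn : 0 < n) (T : Transgression g n) :
    -- the map to the mapping cone, its weak inverse, and the injection of `b^n 𝔲(1)`,
    -- first for Chevalley–Eilenberg algebras, then for Weil algebras
    ∃ (f : DGHom g.CE (T.coneCE hn).CE) (finv : DGHom (T.coneCE hn).CE g.CE)
      (j : DGHom (LInfty.line (n + 1) n.succ_pos).CE (T.coneCE hn).CE)
      (fW : DGHom g.W (T.coneW hn).CE) (finvW : DGHom (T.coneW hn).CE g.W)
      (jW : DGHom (LInfty.line (n + 1) n.succ_pos).W (T.coneW hn).CE),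
      -- their values on generators
      ((∀ i, f (g.gen i) = T.coneCE_g hn i) ∧
        (∀ i, finv (T.coneCE_g hn i) = g.gen i) ∧
        finv (T.coneCE_b hn) = 0 ∧
        finv (T.coneCE_σb hn) = T.μ ∧
        j ((LInfty.line (n + 1) n.succ_pos).gen ()) = T.coneCE_σb hn) ∧
      ((∀ i, fW (g.inn.gen i) = T.coneW_g hn i) ∧
        (∀ i, finvW (T.coneW_g hn i) = g.inn.gen i) ∧
        finvW (T.coneW_b hn) = 0 ∧
        finvW (T.coneW_c hn) = 0 ∧
        finvW (T.coneW_σb hn) = T.cs ∧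
        finvW (T.coneW_σc hn) = -T.P ∧
        jW ((LInfty.line (n + 1) n.succ_pos).inn.gen (Sum.inl ())) = T.coneW_σb hn ∧
        jW ((LInfty.line (n + 1) n.succ_pos).inn.gen (Sum.inr ())) = -T.coneW_σc hn) ∧
      -- `finv` is a weak inverse, on both levels
      (∀ x, finv (f x) = x) ∧ IsWeakInverse f finv ∧
      (∀ x, finvW (fW x) = x) ∧ IsWeakInverse fW finvW ∧
      -- the obstruction to lifting a `𝔤`-descent object to a `𝔤_μ`-descent object
      (∀ Avert : Descent I g π,
        Avert.comp (finv.comp j) ((LInfty.line (n + 1) n.succ_pos).gen ()) = Avert T.μ ∧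
        ((∃ Alift : Descent I (T.stringExt hn) π, ∀ x, Alift (T.stringIncl hn x) = Avert x) ↔
          IsTrivial (Avert.comp (finv.comp j)))) ∧
      -- the obstruction for `𝔤`-connection descent objects
      (∀ D : ConnDescent I J g π hπ,
        ∃ D' : ConnDescent I J (LInfty.line (n + 1) n.succ_pos) π hπ,
          D'.Avert = D.Avert.comp (finv.comp j) ∧
          D'.A = D.A.comp (finvW.comp jW) ∧
          (∀ Q : (LInfty.line (n + 1) n.succ_pos).inv.carrier,
            ∃ hQ : finvW (jW Q.1) ∈ g.invSubalgebra, D'.K Q = D.K ⟨finvW (jW Q.1), hQ⟩) ∧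
          -- the connection form is the Chern–Simons form
          D'.A ((LInfty.line (n + 1) n.succ_pos).inn.gen (Sum.inl ())) = D.A T.cs ∧
          -- the curvature is `P(F_A)`, upstairs and on the base
          D'.A ((LInfty.line (n + 1) n.succ_pos).inn.gen (Sum.inr ())) = D.A T.P ∧
          D'.K (LInfty.lineCurv (n + 1) n.succ_pos) = D.K T.Pinv ∧
          -- the single characteristic class is the class of `P`
          D'.charClass (LInfty.lineCurv (n + 1) n.succ_pos) (LInfty.d_lineCurv _ _) =
            D.charClass T.Pinv T.d_Pinv ∧
          -- the cocycle and connection data lift precisely if the obstruction is trivial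
          ((∃ (Alift : Descent I (T.stringExt hn) π)
              (AWlift : DGHom (T.stringExt hn).W (Omega I Y)),
              (∀ x, Alift (T.stringIncl hn x) = D.Avert x) ∧
              (∀ x, AWlift (T.stringInclW hn x) = D.A x) ∧
              ∀ x, toVert I π (AWlift x) = Alift ((T.stringExt hn).toCEHom x)) ↔
            IsTrivial D'.Avert) ∧
          -- in particular, a lift of the whole object needs a trivial obstruction
          ((∃ Dlift : ConnDescent I J (T.stringExt hn) π hπ,
              (∀ x, Dlift.Avert (T.stringIncl hn x) = D.Avert x) ∧
              ∀ x, Dlift.A (T.stringInclW hn x) = D.A x) →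
            IsTrivial D'.Avert)) ∧
      -- `inv(b^n 𝔲(1))` is generated by the curvature
      (LInfty.line (n + 1) n.succ_pos).invSubalgebra =
        Algebra.adjoin ℝ {(LInfty.line (n + 1) n.succ_pos).inn.gen (Sum.inr ())} := by
  obtain ⟨jW, hjW1, hjW2⟩ := T.exists_coneWLine hn
  refine ⟨T.coneCEHom hn, T.coneCEInv hn, T.coneCELine hn, T.coneWHom hn, T.coneWInv hn, jW,
    ⟨T.inclConeCE_gen hn, T.retractCE_g hn, T.retractCE_b hn, T.retractCE_σb hn,
      T.coneCELine_gen hn⟩,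
    ⟨T.inclConeW_gen hn, T.retractW_g hn, T.retractW_b hn, T.retractW_c hn, T.retractW_σb hn,
      T.retractW_σc hn, hjW1, hjW2⟩,
    T.retractCE_incl hn, T.coneCE_isWeakInverse hn, T.retractW_incl hn, T.coneW_isWeakInverse hn,
    fun Avert => ⟨congrArg Avert (T.coneCEInv_line hn), T.exists_lift_iff hn Avert⟩, fun D => ?_,
    LInfty.line_invSubalgebra _ _⟩
  have hcs : T.coneWInv hn (jW ((LInfty.line (n + 1) n.succ_pos).inn.gen (Sum.inl ()))) = T.cs :=
    (congrArg (T.coneWInv hn) hjW1).trans (T.retractW_σb hn)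
  have hP : T.coneWInv hn (jW ((LInfty.line (n + 1) n.succ_pos).inn.gen (Sum.inr ()))) = T.P :=
    T.coneWInv_line_curv hn hjW2
  have hinv := T.coneWInv_line_mem_inv hn hjW2
  obtain ⟨D', h1, h2, h3⟩ := D.exists_push (T.coneWInv hn |>.comp jW)
    ((T.coneCEInv hn).comp (T.coneCELine hn)) hinv
    -- The square over $W\to\mathrm{CE}$ needs checking on $h$ alone, where it says that
    -- $\mathrm{cs}$ restricts to $\mu$.
    (LInfty.W_hom_ext (F := g.toCEHom.comp ((T.coneWInv hn).comp jW))
      (G := ((T.coneCEInv hn).comp (T.coneCELine hn)).comp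
        (LInfty.line (n + 1) n.succ_pos).toCEHom) fun _ =>
        ((congrArg g.toCE hcs).trans T.toCE_cs).trans ((congrArg
          (fun y => T.coneCEInv hn (T.coneCELine hn y))
          ((LInfty.line (n + 1) n.succ_pos).toCE_inl ())).trans (T.coneCEInv_line hn)).symm)
  have hK : D'.K (LInfty.lineCurv (n + 1) n.succ_pos) = D.K T.Pinv :=
    (h3 _).trans (congrArg D.K (Subtype.ext hP))
  refine ⟨D', h1, h2, fun Q => ⟨hinv Q.1 Q.2, h3 Q⟩, ?_, ?_, hK, ?_, ?_, ?_⟩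
  · rw [h2]
    exact congrArg D.A hcs
  · rw [h2]
    exact congrArg D.A hP
  · exact DGHom.mapCohomology_eq _ _ _ _ hK
  · rw [h1]
    exact T.exists_pair_lift_iff hn D
  -- The vertical part of a full lift is already a lift of the descent object.
  · rintro ⟨Dlift, h, -⟩
    rw [h1]
    exact (T.exists_lift_iff hn D.Avert).mp ⟨Dlift.Avert, h⟩
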